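/- Let $0\le d\le p$ and $\alpha\in[0,1]$. Let $\mathbf x=\boldsymbol\mu+\mathbf z$ be a random vector in $\mathbb R^p$, where $\boldsymbol\mu$ is constant and the components $z_1,\dots,z_p$ of $\mathbf z$ are independent with mean $0$ and variance $1$, $z_1,\dots,z_d$ (the signals) being non-Gaussian and $z_{d+1},\dots,z_p$ (the noise) Gaussian. This is the signal separation model $\mathbf x=\boldsymbol\mu+\boldsymbol\Omega\mathbf z$ with identity mixing $\boldsymbol\Omega=\mathbf I_p$. Write $\gamma_k=E(z_k^3)$, $\beta_k=E(z_k^4)$, $\kappa_k=\beta_k-3$, $\nu_k=\beta_k-1$, $\omega_k=E(z_k^6)-E(z_k^3)^2$, $\eta_k=E(z_k^5)-E(z_k^3)$, $\alpha_1=3\alpha$, $\alpha_2=4(1-\alpha)$ and $$A_k=\frac{\alpha_1^2\gamma_k^2(\nu_k-\gamma_k^2)+2\alpha_1\alpha_2\gamma_k\kappa_k(\eta_k-\gamma_k\beta_k)+\alpha_2^2\kappa_k^2(\omega_k-\beta_k^2)}{(\alpha_1\gamma_k^2+\alpha_2\kappa_k^2)^2},\qquad D_k=\frac{\kappa_k+2}{4}.$$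 For a distribution $F$ on $\mathbb R^p$ with mean $\mathbf m$ and non-singular covariance matrix $\boldsymbol\Sigma$, let $\mathbf y_{st}=\boldsymbol\Sigma^{-1/2}(\mathbf y-\mathbf m)$ for $\mathbf y\sim F$, with the symmetric positive definite root, and let $G_\alpha(\mathbf u)=\alpha\,\gamma(\mathbf u^T\mathbf y_{st})^2+(1-\alpha)\,\kappa(\mathbf u^T\mathbf y_{st})^2$, where $\gamma(\cdot)$ and $\kappa(\cdot)$ are the skewness and the excess kurtosis of a random variable (after standardization). The deflation-based projection pursuit functional is $\mathbf W=\mathbf U\boldsymbol\Sigma^{-1/2}\in\mathbb R^{d\times p}$, where the orthonormal rows $\mathbf u_1,\dots,\mathbf u_d$ of $\mathbf U$ are found one by one, $\mathbf u_k$ maximizing $G_\alpha$ over all unit vectors orthogonal to $\mathbf u_1,\dots,\mathbf u_{k-1}$. We call $\mathbf W$ a solution if every $\mathbf u_k$ is a local maximizer in this $k$th problem, and a global solution if every $\mathbf u_k$ is a global maximizer. Assume that the eighth moments $E(z_k^8)$ are finite and that $\alpha\gamma_j^2+(1-\alpha)\kappa_j^2>0$ for $1\le j\le d$. Let $\mathbf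 x_1,\mathbf x_2,\dots$ be independent copies of $\mathbf x$ and let $F_n$ be the empirical distribution of $\mathbf x_1,\dots,\mathbf x_n$. Then there is a sequence $\hat{\mathbf W}=\hat{\mathbf W}_n$ of random $d\times p$ matrices such that (a) $\hat{\mathbf W}_n$ is a solution for $F=F_n$ whenever the covariance matrix of $F_n$ is non-singular; and it is then a global solution if the values $\alpha\gamma_j^2+(1-\alpha)\kappa_j^2$, $1\le j\le d$, are strictly decreasing in $j$; (b) $\hat{\mathbf W}_n\to(\mathbf I_d,\mathbf 0)$ in probability; (c) $\sqrt n\,\mathrm{vec}(\hat{\mathbf W}_n-(\mathbf I_d,\mathbf 0))$ converges in distribution to a multivariate normal distribution with mean vector $\mathbf 0$, in which the variance that belongs to the element $(k,l)$, $1\le k\le d$, $1\le l\le p$, is $$ASV(\hat w_{kl})=A_l+1\ \ (l<k),\qquad ASV(\hat w_{kk})=D_k,\qquad ASV(\hat w_{kl})=A_k\ \ (l>k).$$ -/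

import Mathlib

open MeasureTheory ProbabilityTheory Filter Topology

namespace SignalSeparation

noncomputable section

/-! ### Univariate moments -/

section Univariate

variable {Ω : Type*} [MeasurableSpace Ω]

/-- The standardized version `(X - E X) / √(Var X)` of a random variable. -/
def standardizedVar (X : Ω → ℝ) (P : Measure Ω) (ω : Ω) : ℝ :=
  (X ω - ∫ ω', X ω' ∂P) / √(Var[X; P])

/-- Classical skewness. -/
def skewness (X : Ω → ℝ) (P : Measure Ω) : ℝ := ∫ ω, standardizedVar X P ω ^ 3 ∂P

/-- Classical excess kurtosis. -/
def excessKurtosis (X : Ω → ℝ) (P : Measure Ω) : ℝ := (∫ ω, standardizedVar X P ω ^ 4 ∂P) - 3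

/-! Shorthands for the moments of a (standardized) component `Y`. -/

def mGamma (Y : Ω → ℝ) (P : Measure Ω) : ℝ := ∫ ω, Y ω ^ 3 ∂P
def mBeta (Y : Ω → ℝ) (P : Measure Ω) : ℝ := ∫ ω, Y ω ^ 4 ∂P
def mKappa (Y : Ω → ℝ) (P : Measure Ω) : ℝ := (∫ ω, Y ω ^ 4 ∂P) - 3
def mNu (Y : Ω → ℝ) (P : Measure Ω) : ℝ := (∫ ω, Y ω ^ 4 ∂P) - 1
def mOmega (Y : Ω → ℝ) (P : Measure Ω) : ℝ := (∫ ω, Y ω ^ 6 ∂P) - (∫ ω, Y ω ^ 3 ∂P) ^ 2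
def mEta (Y : Ω → ℝ) (P : Measure Ω) : ℝ := (∫ ω, Y ω ^ 5 ∂P) - ∫ ω, Y ω ^ 3 ∂P

def zeta3 (Y : Ω → ℝ) (P : Measure Ω) : ℝ := mGamma Y P ^ 2 * (mNu Y P - mGamma Y P ^ 2)
def zeta4 (Y : Ω → ℝ) (P : Measure Ω) : ℝ := mKappa Y P ^ 2 * (mOmega Y P - mBeta Y P ^ 2)
def zeta34 (Y : Ω → ℝ) (P : Measure Ω) : ℝ :=
  mGamma Y P * mKappa Y P * (mEta Y P - mGamma Y P * mBeta Y P)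

/-- The value `α γ² + (1 - α) κ²` of the projection index at a component. -/
def indexValue (α : ℝ) (Y : Ω → ℝ) (P : Measure Ω) : ℝ :=
  α * mGamma Y P ^ 2 + (1 - α) * mKappa Y P ^ 2

/-- The quantity `A`, with the weights `α₁ = 3 α` and `α₂ = 4 (1 - α)`. -/
def asymptA (α : ℝ) (Y : Ω → ℝ) (P : Measure Ω) : ℝ :=
  ((3 * α) ^ 2 * zeta3 Y P + 2 * (3 * α) * (4 * (1 - α)) * zeta34 Y P
      + (4 * (1 - α)) ^ 2 * zeta4 Y P)
    / ((3 * α) * mGamma Y P ^ 2 + (4 * (1 - α)) * mKappa Y P ^ 2) ^ 2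

/-- The quantity `D = (κ + 2) / 4`. -/
def asymptD (Y : Ω → ℝ) (P : Measure Ω) : ℝ := (mKappa Y P + 2) / 4

end Univariate

/-! ### The model -/

/-- The signal separation model `x = μ + M z`, `z = (s, n)`, with non-singular mixing matrix `M`:
the `p` components of `z` are independent with mean zero and variance one, the first `d` (the
signals) are non-Gaussian and the remaining `p - d` (the noise) are Gaussian. -/
structure Model {Ω : Type*} [MeasurableSpace Ω] (d : ℕ) {p : ℕ} (μ : EuclideanSpace ℝ (Fin p))
    (M : Matrix (Fin p) (Fin p) ℝ) (x z : Ω → EuclideanSpace ℝ (Fin p)) (P : Measure Ω) :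
    Prop where
  nonsingular : IsUnit M.det
  generated : ∀ ω, x ω = μ + Matrix.toEuclideanCLM (𝕜 := ℝ) M (z ω)
  aemeasurable : AEMeasurable z P
  indep : iIndepFun (fun (k : Fin p) ω => z ω k) P
  memLp_two : ∀ k, MemLp (fun ω => z ω k) 2 P
  mean_zero : ∀ k, ∫ ω, z ω k ∂P = 0
  var_one : ∀ k, ∫ ω, z ω k ^ 2 ∂P = 1
  signal : ∀ k : Fin p, (k : ℕ) < d → ¬ HasGaussianLaw (fun ω => z ω k) P
  noise : ∀ k : Fin p, d ≤ (k : ℕ) → HasGaussianLaw (fun ω => z ω k) P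

/-! ### The deflation-based projection pursuit functional

All objects are functionals of a distribution `F` on `ℝᵖ`. -/

section Functional

variable {p : ℕ}

/-- Covariance matrix of `F`. -/
def covMatrix (F : Measure (EuclideanSpace ℝ (Fin p))) : Matrix (Fin p) (Fin p) ℝ :=
  Matrix.of fun i j => cov[fun x => x i, fun x => x j; F]

open scoped MatrixOrder in
/-- The symmetric positive definite inverse square root `S^{-1/2}` (of a positive definite `S`). -/
def invSqrt (S : Matrix (Fin p) (Fin p) ℝ) : Matrix (Fin p) (Fin p) ℝ := (CFC.sqrt S)⁻¹

/-- The standardization map `x ↦ x_st = Σ^{-1/2} (x - E x)`. -/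
def standardize (F : Measure (EuclideanSpace ℝ (Fin p))) (x : EuclideanSpace ℝ (Fin p)) :
    EuclideanSpace ℝ (Fin p) :=
  Matrix.toEuclideanCLM (𝕜 := ℝ) (invSqrt (covMatrix F)) (x - ∫ y, y ∂F)

/-- The projection index `G_α(u) = α γ²(uᵀ x_st) + (1 - α) κ²(uᵀ x_st)`. -/
def projIndex (α : ℝ) (F : Measure (EuclideanSpace ℝ (Fin p))) (u : EuclideanSpace ℝ (Fin p)) :
    ℝ :=
  α * skewness (fun x => inner ℝ u (standardize F x)) F ^ 2
    + (1 - α) * excessKurtosis (fun x => inner ℝ u (standardize F x)) F ^ 2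

/-- Unit vectors orthogonal to `u₁, …, u_{k-1}`. -/
def feasible {d : ℕ} (u : Fin d → EuclideanSpace ℝ (Fin p)) (k : Fin d) :
    Set (EuclideanSpace ℝ (Fin p)) :=
  {v | ‖v‖ = 1 ∧ ∀ l, l < k → inner ℝ v (u l) = 0}

/-- The matrix with rows `u₁, …, u_d`. -/
def rowMatrix {d : ℕ} (u : Fin d → EuclideanSpace ℝ (Fin p)) : Matrix (Fin d) (Fin p) ℝ :=
  Matrix.of fun k l => u k l

/-- `W = U Σ^{-1/2}`, the orthonormal rows of `U` being found one by one as global maximizers of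
the projection index over the unit vectors orthogonal to the rows already found. -/
def IsDeflationMax {d : ℕ} (α : ℝ) (F : Measure (EuclideanSpace ℝ (Fin p)))
    (W : Matrix (Fin d) (Fin p) ℝ) : Prop :=
  ∃ u : Fin d → EuclideanSpace ℝ (Fin p), Orthonormal ℝ u ∧
    (∀ k, IsMaxOn (projIndex α F) (feasible u k) (u k)) ∧
    W = rowMatrix u * invSqrt (covMatrix F)

/-- As `IsDeflationMax`, with local maximizers. -/
def IsDeflationLocalMax {d : ℕ} (α : ℝ) (F : Measure (EuclideanSpace ℝ (Fin p)))
    (W : Matrix (Fin d) (Fin p) ℝ) : Prop :=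
  ∃ u : Fin d → EuclideanSpace ℝ (Fin p), Orthonormal ℝ u ∧
    (∀ k, IsLocalMaxOn (projIndex α F) (feasible u k) (u k)) ∧
    W = rowMatrix u * invSqrt (covMatrix F)

/-- Empirical distribution of the first `n` observations. -/
def empirical (x : ℕ → EuclideanSpace ℝ (Fin p)) (n : ℕ) : Measure (EuclideanSpace ℝ (Fin p)) :=
  (n : ENNReal)⁻¹ • ∑ i ∈ Finset.range n, Measure.dirac (x i)

end Functional

/-! ### Limits -/

/-- The matrix `(I_d, 0)`. -/
def idZero (d p : ℕ) : Matrix (Fin d) (Fin p) ℝ :=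
  Matrix.of fun k l => if (l : ℕ) = (k : ℕ) then 1 else 0

/-- `vec(A)` as a vector of a Euclidean space; its `(l, k)` coordinate is `A k l`. -/
def vecE {d p : ℕ} (A : Matrix (Fin d) (Fin p) ℝ) : EuclideanSpace ℝ (Fin p × Fin d) :=
  WithLp.toLp 2 A.vec

/-- The asymptotic variance of the element `(k, l)`: `A_l + 1` for `l < k`, `D_k` for `l = k` and
`A_k` for `l > k`. -/
def asv {Ω : Type*} [MeasurableSpace Ω] {p : ℕ} (α : ℝ) (z : Ω → EuclideanSpace ℝ (Fin p))
    (P : Measure Ω) (k l : Fin p) : ℝ :=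
  if l < k then asymptA α (fun ω => z ω l) P + 1
  else if l = k then asymptD (fun ω => z ω k) P
  else asymptA α (fun ω => z ω k) P

end

end SignalSeparation

/-! Everything reduces to one deterministic function `f` of the moments of order at most four. The
skewness and kurtosis of a projection are a cubic and a quartic form in central moments, so the
index at an empirical distribution is a function of sample moments, and the estimator is `f` at the
sample moments of x - μ. Chebyshev's inequality, the central limit theorem and the delta method
finish the proof once `f` is measurable, gives a solution wherever the covariance is positive
definite, and has the right first-order expansion at the population moments.

Choice of `f`: by Cauchy-Schwarz the population index at a unit vector v is at most the sum of v_a⁴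
V_a, where V_a = α γ_a² + (1 - α) κ_a², and V_a = 0 for noise (`popIndex_le`). If V_1, ..., V_d
strictly decrease, the coordinate vectors are, up to sign, the only sequential maximizers. Otherwise
a penalty that vanishes near the k-th axis is subtracted from the k-th objective. Then e_k is again
the only population maximizer up to sign (`popIndex_sub_penalty_lt`), and near the population the
penalized maximizer lies where the penalty is zero, so it is a local maximizer of the index itself.
The maximizers form a correspondence with closed graph in a compact space, hence have a Borel
selection that is continuous where they are unique (`exists_measurable_solution`). This `f` may
depend on the population, since only existence is claimed.

Derivative of `f`: the rows satisfy smooth equations, namely orthonormality with respect to the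
covariance matrix and the Lagrange conditions (`halfGrad_eq_sum`). Linearized at independent
components, these determine the rows entry by entry, so mere continuity of `f` yields its
first-order expansion (`isLittleO_of_implicit`, `exists_solution_functional`). No smooth branch of
solutions has to be constructed.

Variances: applied to one centered observation, the derivative is s_k(z_k) z_l above the diagonal,
-(z_k² - 1)/2 on it, and -(s_l(z_l) + z_l) z_k below it. Here s_k is a cubic polynomial, s_k(z_k) is
uncorrelated with z_k, and its second moment is A_k. Independence turns these products into A_k, D_k
and A_l + 1 (`variance_entryDeriv`). -/

namespace SignalSeparation

/-! ### Selections of correspondences with closed graph. -/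

/-- A correspondence with closed graph and nonempty values in a compact metric space has a Borel
measurable selection. -/
theorem exists_measurable_selection {Q K : Type*} [TopologicalSpace Q] [MeasurableSpace Q]
    [OpensMeasurableSpace Q] [MetricSpace K] [CompactSpace K] [Nonempty K] [MeasurableSpace K]
    [BorelSpace K] {Γ : Set (Q × K)} (hΓ : IsClosed Γ) (hne : ∀ q, ∃ u, (q, u) ∈ Γ) :
    ∃ s : Q → K, Measurable s ∧ ∀ q, (q, s q) ∈ Γ := by
  -- A compact metric space is a continuous image of the Cantor set. The Cantor set lies in the real
  -- line, so each closed fibre, pulled back to it, has a least point, and this makes the choice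
  -- canonical.
  obtain ⟨f, hf, hfs⟩ := exists_nat_bool_continuous_surjective_of_compact K
  let g : cantorSet → K := fun c => f (cantorSetHomeomorphNatToBool c)
  have hg : Continuous g := hf.comp cantorSetHomeomorphNatToBool.continuous
  have hgs : Function.Surjective g := hfs.comp cantorSetHomeomorphNatToBool.surjective
  have : CompactSpace cantorSet := isCompact_iff_compactSpace.1 isCompact_cantorSet
  let C : Set (Q × cantorSet) := (fun x => (x.1, g x.2)) ⁻¹' Γ
  have hC : IsClosed C := hΓ.preimage (by fun_prop)
  have hmin : ∀ q, ∃ c : cantorSet, (q, c) ∈ C ∧ ∀ c', (q, c') ∈ C → (c : ℝ) ≤ c' := by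
    intro q
    have hcl : IsClosed {c : cantorSet | (q, c) ∈ C} := hC.preimage (by fun_prop)
    obtain ⟨u, hu⟩ := hne q
    obtain ⟨c₀, rfl⟩ := hgs u
    obtain ⟨c, hc, hc'⟩ := hcl.isCompact.exists_isMinOn ⟨c₀, hu⟩
      (f := fun c : cantorSet => (c : ℝ)) (by fun_prop)
    exact ⟨c, hc, fun c' h => hc' h⟩
  choose c hc hcmin using hmin
  have hmeas : Measurable fun q => (c q : ℝ) := by
    refine measurable_of_Iic fun t => ?_
    -- The least point is at most t exactly if some point of the fibre is. Such q form the
    -- projection of a closed set along a compact factor, which is closed.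
    have : (fun q => (c q : ℝ)) ⁻¹' Set.Iic t =
        Prod.fst '' (C ∩ {x : Q × cantorSet | (x.2 : ℝ) ≤ t}) := by
      ext q
      simp only [Set.mem_preimage, Set.mem_Iic, Set.mem_image, Set.mem_inter_iff,
        Set.mem_ofPred_eq, Prod.exists, exists_and_right, exists_eq_right]
      exact ⟨fun h => ⟨c q, hc q, h⟩, fun ⟨c', h1, h2⟩ => (hcmin q c' h1).trans h2⟩
    rw [this]
    refine (isClosedMap_fst_of_compactSpace _ (hC.inter ?_)).measurableSet
    exact isClosed_le (by fun_prop) continuous_const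
  refine ⟨fun q => g (c q), hg.measurable.comp (Measurable.subtype_mk hmeas), hc⟩

/-- A selection of a correspondence with closed graph in a compact space is continuous at every
point at which the correspondence is single-valued. -/
theorem tendsto_selection {Q K : Type*} [TopologicalSpace Q] [TopologicalSpace K] [CompactSpace K]
    {Γ : Set (Q × K)} (hΓ : IsClosed Γ) {s : Q → K} (hs : ∀ q, (q, s q) ∈ Γ) {q₀ : Q} {u₀ : K}
    (h : ∀ u, (q₀, u) ∈ Γ → u = u₀) : Tendsto s (𝓝 q₀) (𝓝 u₀) := by
  rw [tendsto_def]
  intro U hU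
  obtain ⟨V, hVU, hV, huV⟩ := mem_nhds_iff.1 hU
  have hcl : IsClosed (Prod.fst '' (Γ ∩ {x : Q × K | x.2 ∈ Vᶜ})) :=
    isClosedMap_fst_of_compactSpace _
      (hΓ.inter ((isClosed_compl_iff.2 hV).preimage continuous_snd))
  have hq : q₀ ∉ Prod.fst '' (Γ ∩ {x : Q × K | x.2 ∈ Vᶜ}) := by
    rintro ⟨⟨q, u⟩, ⟨h1, h2⟩, rfl⟩
    exact h2 (h u h1 ▸ huV)
  filter_upwards [hcl.isOpen_compl.mem_nhds hq] with q hq'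
  by_contra hcon
  exact hq' ⟨(q, s q), ⟨hs q, fun hsV => hcon (hVU hsV)⟩, rfl⟩

/-! ### Sequential maximization over orthonormal systems. -/

section Sequential

variable {d p : ℕ}

local notation "𝔼" => EuclideanSpace ℝ (Fin p)

/-- Orthonormal systems obtained by maximizing the objectives `H₁, …, H_d` one after the other over
the unit vectors orthogonal to the ones already found, with signs adjusted to the system `e`. -/
def seqArgmax (e : Fin d → EuclideanSpace ℝ (Fin p)) (H : Fin d → EuclideanSpace ℝ (Fin p) → ℝ) :
    Set (Fin d → EuclideanSpace ℝ (Fin p)) :=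
  {u | Orthonormal ℝ u ∧ (∀ k, 0 ≤ inner ℝ (u k) (e k)) ∧
    ∀ k, ∀ v ∈ feasible u k, H k v ≤ H k (u k)}

theorem feasible_congr {u u' : Fin d → 𝔼} {k : Fin d} (h : ∀ l, l < k → u l = u' l) :
    feasible u k = feasible u' k := by
  ext v
  simp only [feasible, Set.mem_ofPred_eq]
  exact and_congr_right fun _ => forall₂_congr fun l hl => by rw [h l hl]

theorem isCompact_feasible (u : Fin d → 𝔼) (k : Fin d) : IsCompact (feasible u k) := by
  have : feasible u k = Metric.sphere 0 1 ∩ ⋂ l, ⋂ (_ : l < k), {v | inner ℝ v (u l) = 0} := by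
    ext v; simp [feasible]
  rw [this]
  refine (isCompact_sphere _ _).inter_right ?_
  exact isClosed_iInter fun l => isClosed_iInter fun _ =>
    isClosed_eq (by fun_prop) continuous_const

theorem feasible_nonempty (hd : d ≤ p) (u : Fin d → 𝔼) (k : Fin d) : (feasible u k).Nonempty := by
  let V : Submodule ℝ 𝔼 := Submodule.span ℝ (Set.range fun l : Fin k => u ⟨l, l.2.trans k.2⟩)
  have h1 : Module.finrank ℝ V ≤ k :=
    (finrank_range_le_card (R := ℝ) (fun l : Fin k => u ⟨l, l.2.trans k.2⟩)).trans (by simp)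
  have h2 : Module.finrank ℝ V + Module.finrank ℝ Vᗮ = p := by
    simpa using V.finrank_add_finrank_orthogonal
  have h3 : 0 < Module.finrank ℝ Vᗮ := by have := k.2; omega
  have : Nontrivial Vᗮ := Module.finrank_pos_iff.1 h3
  obtain ⟨v, hv⟩ := exists_ne (0 : Vᗮ)
  have hv0 : (v : 𝔼) ≠ 0 := by simpa using hv
  refine ⟨(‖(v : 𝔼)‖⁻¹ : ℝ) • (v : 𝔼), ?_, fun l hl => ?_⟩
  · rw [norm_smul, norm_inv, norm_norm, inv_mul_cancel₀ (norm_ne_zero_iff.2 hv0)]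
  · rw [inner_smul_left]
    have : inner ℝ (v : 𝔼) (u l) = 0 :=
      Submodule.inner_left_of_mem_orthogonal
        (K := V) (Submodule.subset_span ⟨(⟨l, hl⟩ : Fin k), rfl⟩) v.2
    simp [this]

theorem orthonormal_of_mem_feasible {u : Fin d → 𝔼} (h : ∀ k, u k ∈ feasible u k) :
    Orthonormal ℝ u := by
  refine ⟨fun k => (h k).1, fun k l hkl => ?_⟩
  rcases lt_or_gt_of_ne hkl with h' | h'
  · rw [real_inner_comm]; exact (h l).2 k h'
  · exact (h k).2 l h'

theorem seqArgmax_nonempty (hd : d ≤ p) (e : Fin d → 𝔼) {H : Fin d → 𝔼 → ℝ}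
    (hH : ∀ k, Continuous (H k)) (heven : ∀ k v, H k (-v) = H k v) :
    (seqArgmax e H).Nonempty := by
  -- Only the first m vectors are constrained. Feasibility looks at earlier vectors only, so
  -- replacing the vector with index m does not disturb them.
  have key : ∀ m : ℕ, ∃ u : Fin d → 𝔼, ∀ k : Fin d, (k : ℕ) < m →
      u k ∈ feasible u k ∧ 0 ≤ inner ℝ (u k) (e k) ∧ ∀ v ∈ feasible u k, H k v ≤ H k (u k) := by
    intro m
    induction m with
    | zero => exact ⟨0, fun k hk => absurd hk (Nat.not_lt_zero _)⟩
    | succ m ih =>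
      obtain ⟨u, hu⟩ := ih
      by_cases hm : m < d
      · let k₀ : Fin d := ⟨m, hm⟩
        obtain ⟨v, hv, hvmax⟩ := (isCompact_feasible u k₀).exists_isMaxOn
          (feasible_nonempty hd u k₀) (hH k₀).continuousOn
        obtain ⟨w, hw, hws, hwmax⟩ : ∃ w ∈ feasible u k₀, 0 ≤ inner ℝ w (e k₀) ∧
            ∀ v ∈ feasible u k₀, H k₀ v ≤ H k₀ w := by
          rcases le_total 0 (inner ℝ v (e k₀)) with h | h
          · exact ⟨v, hv, h, fun v' hv' => hvmax hv'⟩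
          · refine ⟨-v, ⟨by simpa using hv.1, fun l hl => by simpa using hv.2 l hl⟩, by simpa using h,
              fun v' hv' => ?_⟩
            rw [heven]; exact hvmax hv'
        refine ⟨Function.update u k₀ w, fun k hk => ?_⟩
        have hcongr : feasible (Function.update u k₀ w) k = feasible u k :=
          feasible_congr fun l hl => Function.update_of_ne (by
            rintro rfl; exact absurd (Fin.lt_def.1 hl) (by simp [k₀]; omega)) _ _
        rw [hcongr]
        rcases Nat.lt_succ_iff_lt_or_eq.1 hk with hk' | hk'
        · have : k ≠ k₀ := by rintro rfl; simp [k₀] at hk'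
          rw [Function.update_of_ne this]; exact hu k hk'
        · obtain rfl : k = k₀ := Fin.ext hk'
          rw [Function.update_self]; exact ⟨hw, hws, hwmax⟩
      · exact ⟨u, fun k _ => hu k (by have := k.2; omega)⟩
  obtain ⟨u, hu⟩ := key d
  exact ⟨u, orthonormal_of_mem_feasible fun k => (hu k k.2).1, fun k => (hu k k.2).2.1,
    fun k => (hu k k.2).2.2⟩

theorem isClosed_setOf_orthonormal : IsClosed {u : Fin d → 𝔼 | Orthonormal ℝ u} := by
  simp only [Orthonormal, Set.ofPred_and, Pairwise, Set.ofPred_forall]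
  refine IsClosed.inter (isClosed_iInter fun k => isClosed_eq (by fun_prop) continuous_const) ?_
  exact isClosed_iInter fun k => isClosed_iInter fun l => isClosed_iInter fun _ =>
    isClosed_eq (by fun_prop) continuous_const

theorem isCompact_setOf_orthonormal : IsCompact {u : Fin d → 𝔼 | Orthonormal ℝ u} := by
  refine Metric.isCompact_of_isClosed_isBounded isClosed_setOf_orthonormal ?_
  refine (Metric.isBounded_closedBall (x := (0 : Fin d → 𝔼)) (r := 1)).subset fun u hu => ?_
  rw [mem_closedBall_zero_iff, pi_norm_le_iff_of_nonneg zero_le_one]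
  exact fun k => (hu.1 k).le

/-- The difficulty is that the feasible set moves with u. If some feasible v beats u_k strictly,
then for nearby systems y a Gram-Schmidt step (subtract the projections on the earlier y_l,
normalize) turns v into a vector that is feasible for y and close to v. By continuity it still beats
y_k, so failure to maximize is an open condition. -/
theorem isClosed_seqArgmax_graph {Q : Type*} [TopologicalSpace Q] (e : Fin d → 𝔼)
    {H : Fin d → Q → 𝔼 → ℝ} (hH : ∀ k, Continuous fun x : Q × 𝔼 => H k x.1 x.2) :
    IsClosed {x : Q × (Fin d → 𝔼) | x.2 ∈ seqArgmax e fun k => H k x.1} := by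
  have h1 : IsClosed {x : Q × (Fin d → 𝔼) | Orthonormal ℝ x.2} :=
    isClosed_setOf_orthonormal.preimage continuous_snd
  have h2 : IsClosed {x : Q × (Fin d → 𝔼) | ∀ k, 0 ≤ inner ℝ (x.2 k) (e k)} := by
    simp only [Set.ofPred_forall]
    exact isClosed_iInter fun k => isClosed_le continuous_const (by fun_prop)
  rw [← isOpen_compl_iff, isOpen_iff_mem_nhds]
  rintro ⟨q, u⟩ hx
  by_cases hu1 : Orthonormal ℝ u
  swap
  · filter_upwards [h1.isOpen_compl.mem_nhds hu1] with y hy hy'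
    exact hy hy'.1
  by_cases hu2 : ∀ k, 0 ≤ inner ℝ (u k) (e k)
  swap
  · filter_upwards [h2.isOpen_compl.mem_nhds hu2] with y hy hy'
    exact hy hy'.2.1
  obtain ⟨k, v, hv, hlt⟩ : ∃ k, ∃ v ∈ feasible u k, H k q (u k) < H k q v := by
    by_contra hcon
    push Not at hcon
    exact hx ⟨hu1, hu2, hcon⟩
  let π : Q × (Fin d → 𝔼) → 𝔼 := fun y => v - ∑ l with l < k, (inner ℝ v (y.2 l) : ℝ) • y.2 l
  have hπ : Continuous π := by fun_prop
  have hπ0 : π (q, u) = v := by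
    simp only [π, sub_eq_self]
    refine Finset.sum_eq_zero fun l hl => ?_
    rw [hv.2 l (Finset.mem_filter.1 hl).2, zero_smul]
  let ν : Q × (Fin d → 𝔼) → 𝔼 := fun y => (‖π y‖⁻¹ : ℝ) • π y
  have hν0 : ν (q, u) = v := by simp only [ν, hπ0, hv.1]; simp
  have hπne : ‖π (q, u)‖ ≠ 0 := by rw [hπ0, hv.1]; exact one_ne_zero
  have hν : ContinuousAt ν (q, u) := (hπ.norm.continuousAt.inv₀ hπne).smul hπ.continuousAt
  have hHν : ContinuousAt (fun y => H k y.1 (ν y)) (q, u) :=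
    (hH k).continuousAt.comp (f := fun y : Q × (Fin d → 𝔼) => (y.1, ν y))
      (continuousAt_fst.prodMk hν)
  have hHu : Continuous fun y : Q × (Fin d → 𝔼) => H k y.1 (y.2 k) :=
    (hH k).comp (f := fun y : Q × (Fin d → 𝔼) => (y.1, y.2 k)) (by fun_prop)
  have hlt' : H k q (u k) < H k q (ν (q, u)) := by rwa [hν0]
  filter_upwards [hHu.continuousAt.eventually_lt hHν hlt',
    hπ.norm.continuousAt.eventually_ne hπne] with y hy hyne hy'
  refine (hy'.2.2 k (ν y) ⟨?_, fun l hl => ?_⟩).not_gt hy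
  · simp only [ν]
    rw [norm_smul, norm_inv, norm_norm, inv_mul_cancel₀ hyne]
  · simp only [ν, π]
    rw [inner_smul_left, inner_sub_left, sum_inner,
      Finset.sum_eq_single (f := fun i => inner ℝ ((inner ℝ v (y.2 i) : ℝ) • y.2 i) (y.2 l)) l]
    · rw [inner_smul_left, real_inner_self_eq_norm_sq, hy'.1.1 l]
      simp
    · intro j _ hjl
      rw [inner_smul_left, hy'.1.2 hjl, mul_zero]
    · intro h; exact absurd (Finset.mem_filter.2 ⟨Finset.mem_univ l, hl⟩) h

/-- Measurable sequential maximizers, continuous where the sequential maximizer is unique. -/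
theorem exists_measurable_seqArgmax {Q : Type*} [TopologicalSpace Q] [MeasurableSpace Q]
    [OpensMeasurableSpace Q] (hd : d ≤ p) (e : Fin d → 𝔼) {H : Fin d → Q → 𝔼 → ℝ}
    (hH : ∀ k, Continuous fun x : Q × 𝔼 => H k x.1 x.2) (heven : ∀ k q v, H k q (-v) = H k q v) :
    ∃ s : Q → Fin d → 𝔼, Measurable s ∧ (∀ q, s q ∈ seqArgmax e fun k => H k q) ∧
      ∀ q₀ u₀, seqArgmax e (fun k => H k q₀) ⊆ {u₀} → Tendsto s (𝓝 q₀) (𝓝 u₀) := by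
  let K : Set (Fin d → 𝔼) := {u | Orthonormal ℝ u}
  have : CompactSpace K := isCompact_iff_compactSpace.1 isCompact_setOf_orthonormal
  have hne : ∀ q, (seqArgmax e fun k => H k q).Nonempty := fun q =>
    seqArgmax_nonempty hd e (fun k => (hH k).comp (f := fun v : 𝔼 => (q, v)) (by fun_prop)) fun k => heven k q
  let Γ : Set (Q × K) := {x | (x.2 : Fin d → 𝔼) ∈ seqArgmax e fun k => H k x.1}
  have hΓ : IsClosed Γ := (isClosed_seqArgmax_graph e hH).preimage
    (f := fun x : Q × K => (x.1, (x.2 : Fin d → 𝔼))) (by fun_prop)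
  rcases isEmpty_or_nonempty Q with hQ | ⟨⟨q₁⟩⟩
  · exact ⟨fun q => (hQ.false q).elim, measurable_of_empty _, fun q => (hQ.false q).elim,
      fun q => (hQ.false q).elim⟩
  have : Nonempty K := ⟨⟨(hne q₁).some, (hne q₁).some_mem.1⟩⟩
  obtain ⟨s, hsm, hs⟩ := exists_measurable_selection hΓ
    fun q => ⟨⟨(hne q).some, (hne q).some_mem.1⟩, (hne q).some_mem⟩
  refine ⟨fun q => s q, hsm.subtype_val, hs, fun q₀ u₀ h => ?_⟩
  have hu₀ : (s q₀ : Fin d → 𝔼) = u₀ := h (hs q₀)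
  have := tendsto_selection hΓ hs (q₀ := q₀) (u₀ := s q₀) fun u hu =>
    Subtype.ext ((h hu : (u : Fin d → 𝔼) = u₀).trans hu₀.symm)
  rw [← hu₀]
  exact (continuous_subtype_val.tendsto _).comp this

end Sequential

end SignalSeparation

namespace SignalSeparation

/-! ### The population index and its sequential maximizers. -/

section Population

variable {d p : ℕ}

/-- The projection index of independent standardized components with skewnesses `γ` and excess
kurtoses `κ`, as a function of the unit vector `v`. -/
noncomputable def popIndex (α : ℝ) (γ κ : Fin p → ℝ) (v : EuclideanSpace ℝ (Fin p)) : ℝ :=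
  α * (∑ a, v a ^ 3 * γ a) ^ 2 + (1 - α) * (∑ a, v a ^ 4 * κ a) ^ 2

theorem sum_sq_eq_one {v : EuclideanSpace ℝ (Fin p)} (hv : ‖v‖ = 1) : ∑ a, v a ^ 2 = 1 := by
  have := EuclideanSpace.norm_sq_eq v
  simpa [hv] using this.symm

theorem inner_single_one (v : EuclideanSpace ℝ (Fin p)) (k : Fin p) :
    inner ℝ v (EuclideanSpace.single k 1) = v k := by
  rw [EuclideanSpace.inner_single_right]; simp

/-- Cauchy-Schwarz with one factor v_a split off, whose squares sum to one. For the kurtosis this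
leaves v_a⁶, which is reduced to v_a⁴ by v_a² ≤ 1. -/
theorem popIndex_le {α : ℝ} (hα : α ∈ Set.Icc (0 : ℝ) 1) (γ κ : Fin p → ℝ)
    {v : EuclideanSpace ℝ (Fin p)} (hv : ‖v‖ = 1) :
    popIndex α γ κ v ≤ ∑ a, v a ^ 4 * (α * γ a ^ 2 + (1 - α) * κ a ^ 2) := by
  have hs := sum_sq_eq_one hv
  have hle : ∀ a, v a ^ 2 ≤ 1 := fun a => by
    rw [← hs]; exact Finset.single_le_sum (f := fun a => v a ^ 2) (fun i _ => sq_nonneg _)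
      (Finset.mem_univ a)
  have h3 : (∑ a, v a ^ 3 * γ a) ^ 2 ≤ ∑ a, v a ^ 4 * γ a ^ 2 := by
    have := Finset.sum_mul_sq_le_sq_mul_sq Finset.univ (fun a => v a) (fun a => v a ^ 2 * γ a)
    rw [hs, one_mul] at this
    calc _ = (∑ a, v a * (v a ^ 2 * γ a)) ^ 2 := by congr 1; exact Finset.sum_congr rfl fun _ _ => by ring
      _ ≤ _ := this
      _ = _ := Finset.sum_congr rfl fun _ _ => by ring
  have h4 : (∑ a, v a ^ 4 * κ a) ^ 2 ≤ ∑ a, v a ^ 4 * κ a ^ 2 := by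
    have := Finset.sum_mul_sq_le_sq_mul_sq Finset.univ (fun a => v a) (fun a => v a ^ 3 * κ a)
    rw [hs, one_mul] at this
    calc _ = (∑ a, v a * (v a ^ 3 * κ a)) ^ 2 := by congr 1; exact Finset.sum_congr rfl fun _ _ => by ring
      _ ≤ _ := this
      _ ≤ _ := Finset.sum_le_sum fun a _ => by
        have : (v a ^ 3 * κ a) ^ 2 = v a ^ 2 * (v a ^ 4 * κ a ^ 2) := by ring
        rw [this]
        exact mul_le_of_le_one_left (by positivity) (hle a)
  calc _ ≤ α * (∑ a, v a ^ 4 * γ a ^ 2) + (1 - α) * (∑ a, v a ^ 4 * κ a ^ 2) :=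
        add_le_add (mul_le_mul_of_nonneg_left h3 hα.1)
          (mul_le_mul_of_nonneg_left h4 (sub_nonneg.2 hα.2))
    _ = _ := by
        rw [Finset.mul_sum, Finset.mul_sum, ← Finset.sum_add_distrib]
        exact Finset.sum_congr rfl fun _ _ => by ring

theorem popIndex_single (α : ℝ) (γ κ : Fin p → ℝ) (k : Fin p) :
    popIndex α γ κ (EuclideanSpace.single k 1) = α * γ k ^ 2 + (1 - α) * κ k ^ 2 := by
  simp [popIndex, ite_pow]

/-- For strictly ordered index values the population index has its maximum over the unit vectors
orthogonal to the first coordinate vectors at the next coordinate vector only. -/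
theorem popIndex_lt_of_ordered {α : ℝ} (hα : α ∈ Set.Icc (0 : ℝ) 1) (γ κ : Fin p → ℝ)
    (k : Fin p) (hk : ∀ a, k < a → α * γ a ^ 2 + (1 - α) * κ a ^ 2 <
      α * γ k ^ 2 + (1 - α) * κ k ^ 2)
    {v : EuclideanSpace ℝ (Fin p)} (hv : ‖v‖ = 1) (hvl : ∀ l, l < k → v l = 0)
    (hvk : v k ^ 2 ≠ 1) :
    popIndex α γ κ v < α * γ k ^ 2 + (1 - α) * κ k ^ 2 := by
  have hs := sum_sq_eq_one hv
  have hle : ∀ a, v a ^ 2 ≤ 1 := fun a => by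
    rw [← hs]; exact Finset.single_le_sum (f := fun a => v a ^ 2) (fun i _ => sq_nonneg _)
      (Finset.mem_univ a)
  set V : Fin p → ℝ := fun a => α * γ a ^ 2 + (1 - α) * κ a ^ 2 with hV
  have hV0 : ∀ a, 0 ≤ V a := fun a =>
    add_nonneg (mul_nonneg hα.1 (sq_nonneg _)) (mul_nonneg (sub_nonneg.2 hα.2) (sq_nonneg _))
  have hterm : ∀ a, v a ^ 4 * V a ≤ v a ^ 2 * V a := fun a => by
    have : v a ^ 4 * V a = v a ^ 2 * (v a ^ 2 * V a) := by ring
    rw [this]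
    exact mul_le_of_le_one_left (mul_nonneg (sq_nonneg _) (hV0 a)) (hle a)
  have hterm2 : ∀ a, v a ^ 2 * V a ≤ v a ^ 2 * V k := fun a => by
    rcases lt_trichotomy a k with h | rfl | h
    · simp [hvl a h]
    · exact le_rfl
    · exact mul_le_mul_of_nonneg_left (hk a h).le (sq_nonneg _)
  obtain ⟨b, hbk, hb⟩ : ∃ b, b ≠ k ∧ v b ≠ 0 := by
    by_contra hcon
    push Not at hcon
    rw [Finset.sum_eq_single k (fun b _ hb => by simp [hcon b hb]) (by simp)] at hs
    exact hvk hs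
  have hkb : k < b := (lt_or_gt_of_ne hbk).resolve_left fun h => hb (hvl b h)
  calc popIndex α γ κ v ≤ ∑ a, v a ^ 4 * V a := popIndex_le hα γ κ hv
    _ < ∑ a, v a ^ 2 * V k := Finset.sum_lt_sum (fun a _ => (hterm a).trans (hterm2 a))
        ⟨b, Finset.mem_univ b, (hterm b).trans_lt
          (mul_lt_mul_of_pos_left (hk b hkb) (by positivity))⟩
    _ = V k := by rw [← Finset.sum_mul, hs, one_mul]

/-- With a penalty that vanishes near the `k`-th coordinate axis, the population index has its
maximum over the unit vectors on this axis only. -/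
theorem popIndex_sub_penalty_lt {α : ℝ} (hα : α ∈ Set.Icc (0 : ℝ) 1) (γ κ : Fin p → ℝ)
    (k : Fin p) (hk : 0 < α * γ k ^ 2 + (1 - α) * κ k ^ 2) {B : ℝ}
    (hB : ∀ a, α * γ a ^ 2 + (1 - α) * κ a ^ 2 ≤ B)
    {v : EuclideanSpace ℝ (Fin p)} (hv : ‖v‖ = 1) (hvk : v k ^ 2 ≠ 1) :
    popIndex α γ κ v - (α * γ k ^ 2 + (1 - α) * κ k ^ 2 + B) *
      max 0 (1 - v k ^ 2 - (α * γ k ^ 2 + (1 - α) * κ k ^ 2) /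
        (α * γ k ^ 2 + (1 - α) * κ k ^ 2 + B)) <
      α * γ k ^ 2 + (1 - α) * κ k ^ 2 := by
  have hs := sum_sq_eq_one hv
  set V : Fin p → ℝ := fun a => α * γ a ^ 2 + (1 - α) * κ a ^ 2 with hV
  change popIndex α γ κ v - (V k + B) * max 0 (1 - v k ^ 2 - V k / (V k + B)) < V k
  change 0 < V k at hk
  change ∀ a, V a ≤ B at hB
  have hVk := hB k
  have hsplit : v k ^ 2 + ∑ a ∈ Finset.univ.erase k, v a ^ 2 = 1 := by
    rw [Finset.add_sum_erase _ (fun a => v a ^ 2) (Finset.mem_univ k), hs]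
  set s := 1 - v k ^ 2 with hsdef
  have hs1 : ∑ a ∈ Finset.univ.erase k, v a ^ 2 = s := by linarith
  have hs0 : 0 ≤ s := hs1 ▸ Finset.sum_nonneg fun a _ => sq_nonneg _
  have hspos : 0 < s := lt_of_le_of_ne hs0 fun h => hvk (by linarith)
  have hsle : s ≤ 1 := by nlinarith [sq_nonneg (v k)]
  -- The bound is V_k - 2 s V_k + s² (V_k + B). For s ≤ t, where s (V_k + B) ≤ V_k, it is at most
  -- V_k - s V_k. For s ≥ t, subtracting the penalty s (V_k + B) - V_k gives again at most V_k - s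
  -- V_k, because V_k ≤ s (V_k + B). The threshold t is where the linear penalty starts.
  have h1 : popIndex α γ κ v ≤ (1 - s) ^ 2 * V k + s ^ 2 * B := by
    refine (popIndex_le hα γ κ hv).trans ?_
    rw [← Finset.add_sum_erase _ _ (Finset.mem_univ k)]
    refine add_le_add (le_of_eq ?_) ?_
    · have : v k ^ 2 = 1 - s := by linarith
      rw [← this]; ring
    · calc ∑ a ∈ Finset.univ.erase k, v a ^ 4 * V a
          ≤ ∑ a ∈ Finset.univ.erase k, v a ^ 2 * (s * B) := by
            refine Finset.sum_le_sum fun a ha => ?_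
            have hva : v a ^ 2 ≤ s := hs1 ▸
              Finset.single_le_sum (f := fun a => v a ^ 2) (fun i _ => sq_nonneg _) ha
            have : v a ^ 4 * V a = v a ^ 2 * (v a ^ 2 * V a) := by ring
            rw [this]
            refine mul_le_mul_of_nonneg_left ?_ (sq_nonneg _)
            calc v a ^ 2 * V a ≤ v a ^ 2 * B := mul_le_mul_of_nonneg_left (hB a) (sq_nonneg _)
              _ ≤ s * B := mul_le_mul_of_nonneg_right hva (by linarith)
        _ = s ^ 2 * B := by rw [← Finset.sum_mul, hs1]; ring
  have hMpos : 0 < V k + B := by linarith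
  set t := V k / (V k + B) with ht
  have htm : t * (V k + B) = V k := by rw [ht]; field_simp
  rcases le_total s t with hst | hst
  · have hpen : 0 ≤ (V k + B) * max 0 (s - t) := mul_nonneg hMpos.le (le_max_left _ _)
    have h2 : s * (V k + B) ≤ V k :=
      (mul_le_mul_of_nonneg_right hst hMpos.le).trans_eq htm
    nlinarith [mul_le_mul_of_nonneg_left h2 hs0, mul_pos hspos hk]
  · rw [max_eq_right (sub_nonneg.2 hst)]
    have h3 : (V k + B) * (s - t) = (V k + B) * s - V k := by rw [mul_sub, mul_comm _ t, htm]
    rw [h3]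
    have h4 : 0 ≤ s * (1 - s) := mul_nonneg hs0 (by linarith)
    have h5 : V k ≤ s * (V k + B) :=
      htm.symm.trans_le (mul_le_mul_of_nonneg_right hst hMpos.le)
    nlinarith [mul_nonneg h4 hMpos.le, mul_pos hspos hk]

/-- By strong induction the earlier vectors are coordinate vectors, so feasibility says that the
earlier coordinates vanish. Since e_k itself is feasible, strict inequality forces the k-th
coordinate to be ±1, and the sign convention excludes -1. -/
theorem seqArgmax_subset_singleton (hd : d ≤ p) {H : Fin d → EuclideanSpace ℝ (Fin p) → ℝ}
    (h : ∀ (k : Fin d) (v : EuclideanSpace ℝ (Fin p)), ‖v‖ = 1 →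
      (∀ l, l < Fin.castLE hd k → v l = 0) → v (Fin.castLE hd k) ^ 2 ≠ 1 →
      H k v < H k (EuclideanSpace.single (Fin.castLE hd k) 1)) :
    seqArgmax (fun k => EuclideanSpace.single (Fin.castLE hd k) 1) H ⊆
      {fun k => EuclideanSpace.single (Fin.castLE hd k) 1} := by
  rintro u ⟨hu1, hu2, hu3⟩
  rw [Set.mem_singleton_iff]
  funext k
  induction k using WellFoundedLT.induction with
  | _ k ih => ?_
  have hort : ∀ l, l < Fin.castLE hd k → u k l = 0 := fun l hl => by
    have hl' : (l : ℕ) < d := lt_trans (Fin.lt_def.1 hl) k.2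
    have hlk : (⟨l, hl'⟩ : Fin d) < k := Fin.lt_def.2 (Fin.lt_def.1 hl)
    have : inner ℝ (u k) (u ⟨l, hl'⟩) = 0 := hu1.2 hlk.ne'
    rwa [ih _ hlk, inner_single_one] at this
  have hfeas : EuclideanSpace.single (Fin.castLE hd k) (1 : ℝ) ∈ feasible u k := by
    refine ⟨by simp, fun l hl => ?_⟩
    rw [ih l hl, inner_single_one]
    simp [hl.ne]
  have hsq : u k (Fin.castLE hd k) ^ 2 = 1 := by
    by_contra hcon
    exact (h k (u k) (hu1.1 k) hort hcon).not_ge (hu3 k _ hfeas)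
  have hone : u k (Fin.castLE hd k) = 1 := by
    have h0 : 0 ≤ inner ℝ (u k) (EuclideanSpace.single (Fin.castLE hd k) 1) := hu2 k
    rw [inner_single_one] at h0
    nlinarith
  refine (inner_eq_one_iff_of_norm_eq_one (𝕜 := ℝ) (hu1.1 k) (by simp)).1 ?_
  rw [inner_single_one, hone]

/-- Measurable solutions of the sequential maximization problems for a family of objectives that
depends continuously on a parameter, near a parameter with the population index as objective. -/
theorem exists_measurable_solution {Q : Type*} [TopologicalSpace Q] [MeasurableSpace Q]
    [OpensMeasurableSpace Q] (hd : d ≤ p) {α : ℝ} (hα : α ∈ Set.Icc (0 : ℝ) 1) (γ κ : Fin p → ℝ)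
    (hpos : ∀ j : Fin d, 0 < α * γ (Fin.castLE hd j) ^ 2 + (1 - α) * κ (Fin.castLE hd j) ^ 2)
    (hnoise : ∀ a : Fin p, d ≤ (a : ℕ) → α * γ a ^ 2 + (1 - α) * κ a ^ 2 = 0)
    {G : Q → EuclideanSpace ℝ (Fin p) → ℝ} (hG : Continuous fun x : Q × _ => G x.1 x.2)
    (heven : ∀ q v, G q (-v) = G q v) (q₀ : Q)
    (hG₀ : ∀ v, ‖v‖ = 1 → G q₀ v = popIndex α γ κ v) :
    ∃ s : Q → Fin d → EuclideanSpace ℝ (Fin p), Measurable s ∧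
      (∀ q, Orthonormal ℝ (s q) ∧ ∀ k, IsLocalMaxOn (G q) (feasible (s q) k) (s q k)) ∧
      ((∀ j j' : Fin d, j < j' →
          α * γ (Fin.castLE hd j') ^ 2 + (1 - α) * κ (Fin.castLE hd j') ^ 2 <
            α * γ (Fin.castLE hd j) ^ 2 + (1 - α) * κ (Fin.castLE hd j) ^ 2) →
        ∀ q k, IsMaxOn (G q) (feasible (s q) k) (s q k)) ∧
      Tendsto s (𝓝 q₀) (𝓝 fun k => EuclideanSpace.single (Fin.castLE hd k) 1) := by
  let e : Fin d → EuclideanSpace ℝ (Fin p) := fun k => EuclideanSpace.single (Fin.castLE hd k) 1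
  obtain ⟨s₁, hs₁m, hs₁, hs₁t⟩ := exists_measurable_seqArgmax hd e (H := fun _ => G)
    (fun _ => hG) (fun _ => heven)
  by_cases hord : ∀ j j' : Fin d, j < j' →
      α * γ (Fin.castLE hd j') ^ 2 + (1 - α) * κ (Fin.castLE hd j') ^ 2 <
        α * γ (Fin.castLE hd j) ^ 2 + (1 - α) * κ (Fin.castLE hd j) ^ 2
  -- Strictly ordered values: the plain sequential maximizer is global for every parameter and
  -- unique at `q₀`.
  · have hmax : ∀ q k, IsMaxOn (G q) (feasible (s₁ q) k) (s₁ q k) :=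
      fun q k v hv => (hs₁ q).2.2 k v hv
    refine ⟨s₁, hs₁m, fun q => ⟨(hs₁ q).1, fun k => (hmax q k).localize⟩, fun _ => hmax,
      hs₁t q₀ e (seqArgmax_subset_singleton hd fun k v hv hvl hvk => ?_)⟩
    rw [hG₀ v hv, hG₀ _ (by simp), popIndex_single]
    refine popIndex_lt_of_ordered hα γ κ _ (fun a ha => ?_) hv hvl hvk
    by_cases had : (a : ℕ) < d
    · exact hord k ⟨a, had⟩ (Fin.lt_def.2 (Fin.lt_def.1 ha))
    · rw [hnoise a (not_lt.1 had)]; exact hpos k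
  -- Without strict order, plain maximizers may approach the wrong axes. The k-th objective is
  -- therefore penalized, with slope `M k` and threshold `t k` as in `popIndex_sub_penalty_lt`.
  · let V : Fin p → ℝ := fun a => α * γ a ^ 2 + (1 - α) * κ a ^ 2
    have hV0 : ∀ a, 0 ≤ V a := fun a =>
      add_nonneg (mul_nonneg hα.1 (sq_nonneg _)) (mul_nonneg (sub_nonneg.2 hα.2) (sq_nonneg _))
    let B : ℝ := ∑ a, V a
    have hB : ∀ a, V a ≤ B := fun a =>
      Finset.single_le_sum (fun i _ => hV0 i) (Finset.mem_univ a)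
    let M : Fin d → ℝ := fun k => V (Fin.castLE hd k) + B
    let t : Fin d → ℝ := fun k => V (Fin.castLE hd k) / M k
    have ht : ∀ k, 0 < t k := fun k =>
      div_pos (hpos k) (add_pos_of_pos_of_nonneg (hpos k) ((hV0 (Fin.castLE hd k)).trans (hB _)))
    let H : Fin d → Q → EuclideanSpace ℝ (Fin p) → ℝ := fun k q v =>
      G q v - M k * max 0 (1 - v (Fin.castLE hd k) ^ 2 - t k)
    obtain ⟨s₂, hs₂m, hs₂, hs₂t⟩ := exists_measurable_seqArgmax hd e (H := H)
      (fun k => hG.sub (by fun_prop)) (fun k q v => by simp [H, heven])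
    have hs₂e : Tendsto s₂ (𝓝 q₀) (𝓝 e) := by
      refine hs₂t q₀ e (seqArgmax_subset_singleton hd fun k v hv _ hvk => ?_)
      have h1 := popIndex_sub_penalty_lt hα γ κ (Fin.castLE hd k) (hpos k) hB hv hvk
      have h2 : H k q₀ (EuclideanSpace.single (Fin.castLE hd k) 1) = V (Fin.castLE hd k) := by
        simp only [H]
        rw [hG₀ _ (by simp), popIndex_single]
        simp [(ht k).le, V]
      rw [h2]
      simp only [H]
      rw [hG₀ v hv]
      exact h1
    -- On `T` every chosen vector lies strictly inside the region without penalty, so it is a local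
    -- maximizer of `G` itself. Off `T` the plain maximizers `s₁` serve. As `T` is a neighbourhood
    -- of `q₀`, this does not affect the limit.
    let T : Set Q := {q | ∀ k, 1 - s₂ q k (Fin.castLE hd k) ^ 2 < t k}
    have hTm : MeasurableSet T := by
      simp only [T, Set.ofPred_forall]
      refine MeasurableSet.iInter fun k => measurableSet_lt ?_ measurable_const
      have : Continuous fun u : Fin d → EuclideanSpace ℝ (Fin p) =>
        1 - u k (Fin.castLE hd k) ^ 2 := by fun_prop
      exact this.measurable.comp hs₂m
    have hT : T ∈ 𝓝 q₀ := by
      have : ∀ k, ∀ᶠ q in 𝓝 q₀, 1 - s₂ q k (Fin.castLE hd k) ^ 2 < t k := fun k => by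
        have hc : Continuous fun u : Fin d → EuclideanSpace ℝ (Fin p) =>
          1 - u k (Fin.castLE hd k) ^ 2 := by fun_prop
        refine ((hc.tendsto e).comp hs₂e).eventually_lt_const ?_
        simpa [e] using ht k
      filter_upwards [eventually_all.2 this] with q hq using hq
    classical
    refine ⟨T.piecewise s₂ s₁, hs₂m.piecewise hTm hs₁m, fun q => ?_, fun h => absurd h hord, ?_⟩
    · by_cases hq : q ∈ T
      · rw [Set.piecewise_eq_of_mem _ _ _ hq]
        refine ⟨(hs₂ q).1, fun k => ?_⟩
        have hc : Continuous fun v : EuclideanSpace ℝ (Fin p) =>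
          1 - v (Fin.castLE hd k) ^ 2 := by fun_prop
        have hnear : ∀ᶠ v in 𝓝[feasible (s₂ q) k] (s₂ q k), 1 - v (Fin.castLE hd k) ^ 2 < t k :=
          (hc.continuousWithinAt.tendsto).eventually_lt_const (hq k)
        filter_upwards [hnear, self_mem_nhdsWithin] with v hv hvf
        have := (hs₂ q).2.2 k v hvf
        simp only [H] at this
        rw [max_eq_left (by linarith), max_eq_left (by linarith [hq k])] at this
        simpa using this
      · rw [Set.piecewise_eq_of_notMem _ _ _ hq]
        exact ⟨(hs₁ q).1, fun k =>
          IsMaxOn.localize (f := G q) (s := feasible (s₁ q) k) fun v hv => (hs₁ q).2.2 k v hv⟩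
    · refine hs₂e.congr' ?_
      filter_upwards [hT] with q hq
      rw [Set.piecewise_eq_of_mem _ _ _ hq]

end Population

end SignalSeparation

namespace SignalSeparation

/-! ### Continuity of the symmetric inverse square root. -/

section InvSqrt

variable {p : ℕ} {S : Matrix (Fin p) (Fin p) ℝ}

open scoped MatrixOrder

theorem sqrt_mul_sqrt (hS : S.PosSemidef) : CFC.sqrt S * CFC.sqrt S = S :=
  CFC.sqrt_mul_sqrt_self S hS.nonneg

theorem transpose_sqrt (S : Matrix (Fin p) (Fin p) ℝ) : (CFC.sqrt S).transpose = CFC.sqrt S := by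
  have := (Matrix.nonneg_iff_posSemidef.1 (CFC.sqrt_nonneg S)).isHermitian
  simpa [Matrix.IsHermitian, Matrix.conjTranspose_eq_transpose_of_trivial] using this

theorem isUnit_det_sqrt (hS : S.PosDef) : IsUnit (CFC.sqrt S).det := by
  have h : (CFC.sqrt S).det * (CFC.sqrt S).det = S.det := by
    rw [← Matrix.det_mul, sqrt_mul_sqrt hS.posSemidef]
  have h2 : IsUnit S.det := isUnit_iff_ne_zero.2 hS.det_pos.ne'
  rw [← h] at h2
  exact isUnit_of_mul_isUnit_left h2

theorem transpose_invSqrt (S : Matrix (Fin p) (Fin p) ℝ) : (invSqrt S).transpose = invSqrt S := by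
  rw [invSqrt, Matrix.transpose_nonsing_inv, transpose_sqrt]

theorem sqrt_mul_invSqrt (hS : S.PosDef) : CFC.sqrt S * invSqrt S = 1 :=
  Matrix.mul_nonsing_inv _ (isUnit_det_sqrt hS)

theorem invSqrt_mul_sqrt (hS : S.PosDef) : invSqrt S * CFC.sqrt S = 1 :=
  Matrix.nonsing_inv_mul _ (isUnit_det_sqrt hS)

theorem invSqrt_mul_mul_invSqrt (hS : S.PosDef) : invSqrt S * S * invSqrt S = 1 := by
  nth_rewrite 2 [← sqrt_mul_sqrt hS.posSemidef]
  rw [← mul_assoc, invSqrt_mul_sqrt hS, one_mul, sqrt_mul_invSqrt hS]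

theorem mul_invSqrt (hS : S.PosDef) : S * invSqrt S = CFC.sqrt S := by
  nth_rewrite 1 [← sqrt_mul_sqrt hS.posSemidef]
  rw [mul_assoc, sqrt_mul_invSqrt hS, mul_one]

theorem invSqrt_one : invSqrt (1 : Matrix (Fin p) (Fin p) ℝ) = 1 := by
  rw [invSqrt, CFC.sqrt_one]; simp

theorem isClosed_setOf_posSemidef : IsClosed {S : Matrix (Fin p) (Fin p) ℝ | S.PosSemidef} := by
  simp only [Matrix.posSemidef_iff_dotProduct_mulVec, Matrix.IsHermitian, Set.ofPred_and,
    Set.ofPred_forall]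
  refine IsClosed.inter (isClosed_eq (by fun_prop) continuous_id) (isClosed_iInter fun x => ?_)
  exact isClosed_le continuous_const (by fun_prop)

/-- Compactness and uniqueness: the squared entries in a row of the root sum to a diagonal entry of
the matrix, so roots of nearby matrices stay in a compact box. Any limit along an ultrafilter is
positive semidefinite with square S, hence is the root of S. -/
theorem continuousOn_sqrt :
    ContinuousOn (fun S : Matrix (Fin p) (Fin p) ℝ => CFC.sqrt S) {S | S.PosSemidef} := by
  intro S hS
  rw [ContinuousWithinAt, tendsto_iff_ultrafilter]
  intro F hF
  have hFS : (F : Filter (Matrix (Fin p) (Fin p) ℝ)) ≤ 𝓝 S := hF.trans nhdsWithin_le_nhds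
  have hFP : ∀ᶠ T in (F : Filter (Matrix (Fin p) (Fin p) ℝ)), T.PosSemidef :=
    hF (self_mem_nhdsWithin : {S : Matrix (Fin p) (Fin p) ℝ | S.PosSemidef} ∈ _)
  let C : Set (Matrix (Fin p) (Fin p) ℝ) :=
    Set.univ.pi fun a => Set.univ.pi fun _ => Set.Icc (-(S a a + 2)) (S a a + 2)
  have hC : IsCompact C := isCompact_univ_pi fun a => isCompact_univ_pi fun _ => isCompact_Icc
  have hdiag : ∀ᶠ T in (F : Filter (Matrix (Fin p) (Fin p) ℝ)), ∀ a, T a a < S a a + 1 := by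
    refine eventually_all.2 fun a => hFS ?_
    have : Continuous fun T : Matrix (Fin p) (Fin p) ℝ => T a a := by fun_prop
    exact (this.tendsto S).eventually_lt_const (lt_add_one _)
  have hmem : ∀ᶠ T in (F : Filter (Matrix (Fin p) (Fin p) ℝ)), CFC.sqrt T ∈ C := by
    filter_upwards [hFP, hdiag] with T hT hTd
    refine Set.mem_univ_pi.2 fun a => Set.mem_univ_pi.2 fun b => ?_
    have h1 : ∑ c, CFC.sqrt T a c ^ 2 = T a a := by
      conv_rhs => rw [← sqrt_mul_sqrt hT]
      rw [Matrix.mul_apply]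
      refine Finset.sum_congr rfl fun c _ => ?_
      rw [sq]
      congr 1
      exact congrFun (congrFun (transpose_sqrt T) c) a
    have h2 : CFC.sqrt T a b ^ 2 ≤ T a a := h1 ▸
      Finset.single_le_sum (f := fun c => CFC.sqrt T a c ^ 2) (fun i _ => sq_nonneg _)
        (Finset.mem_univ b)
    have h3 := hTd a
    have h4 : 0 ≤ T a a := (sq_nonneg _).trans h2
    -- An entry r with r² below `S a a + 1` satisfies |r| ≤ (r² + 1)/2, which is within the box.
    constructor <;> nlinarith [sq_nonneg (CFC.sqrt T a b - 1), sq_nonneg (CFC.sqrt T a b + 1)]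
  obtain ⟨R, -, hR⟩ := hC.ultrafilter_le_nhds' (F.map fun T => CFC.sqrt T) hmem
  have hRp : R.PosSemidef := isClosed_setOf_posSemidef.mem_of_tendsto
    (show Tendsto (fun T => CFC.sqrt T) F (𝓝 R) from hR)
    (Eventually.of_forall fun T => Matrix.nonneg_iff_posSemidef.1 (CFC.sqrt_nonneg T))
  have hRR : R * R = S := by
    have h1 : Tendsto (fun T => CFC.sqrt T * CFC.sqrt T) F (𝓝 (R * R)) :=
      (show Tendsto (fun T => CFC.sqrt T) F (𝓝 R) from hR).mul hR
    have h2 : Tendsto (fun T => CFC.sqrt T * CFC.sqrt T) F (𝓝 S) :=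
      (tendsto_id.mono_left hFS).congr' (hFP.mono fun T hT => (sqrt_mul_sqrt hT).symm)
    exact tendsto_nhds_unique h1 h2
  rw [CFC.sqrt_unique hRR hRp.nonneg]
  exact hR

theorem continuousOn_invSqrt :
    ContinuousOn (fun S : Matrix (Fin p) (Fin p) ℝ => invSqrt S) {S | S.PosDef} := by
  have h := (continuousOn_sqrt (p := p)).mono fun S (hS : S.PosDef) => hS.posSemidef
  intro S hS
  have h1 : ContinuousWithinAt (fun S : Matrix (Fin p) (Fin p) ℝ => (CFC.sqrt S)⁻¹)
      {S | S.PosDef} S := by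
    simp only [Matrix.inv_def, Ring.inverse_eq_inv']
    have h2 := h S hS
    have h3 : ContinuousWithinAt (fun S : Matrix (Fin p) (Fin p) ℝ => (CFC.sqrt S).det)
        {S | S.PosDef} S := (continuous_id.matrix_det).continuousAt.comp_continuousWithinAt h2
    have h4 : ContinuousWithinAt (fun S : Matrix (Fin p) (Fin p) ℝ => (CFC.sqrt S).adjugate)
        {S | S.PosDef} S := (continuous_id.matrix_adjugate).continuousAt.comp_continuousWithinAt h2
    exact (h3.inv₀ (isUnit_iff_ne_zero.1 (isUnit_det_sqrt hS))).smul h4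
  exact h1

theorem setOf_posDef_eq : {S : Matrix (Fin p) (Fin p) ℝ | S.PosDef} =
    {S | S.PosSemidef} ∩ {S | S.det ≠ 0} := by
  ext S
  exact ⟨fun h => ⟨h.posSemidef, h.det_pos.ne'⟩, fun h =>
    (Matrix.PosSemidef.posDef_iff_det_ne_zero h.1).2 h.2⟩

/-- Symmetric matrices near the identity are positive definite. -/
theorem eventually_posDef : ∀ᶠ S in 𝓝[{S | S.transpose = S}] (1 : Matrix (Fin p) (Fin p) ℝ),
    S.PosDef := by
  -- Entrywise distance below 1/(p + 1) changes the quadratic form by at most (∑ |x_a|)²/(p + 1) ≤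
  -- p/(p + 1) ∑ x_a², which is less than ∑ x_a².
  have hε : (0 : ℝ) < 1 / (p + 1) := by positivity
  have hnear : ∀ᶠ S in 𝓝 (1 : Matrix (Fin p) (Fin p) ℝ), ∀ a b,
      |S a b - (1 : Matrix (Fin p) (Fin p) ℝ) a b| < 1 / (p + 1) := by
    refine eventually_all.2 fun a => eventually_all.2 fun b => ?_
    have : Continuous fun T : Matrix (Fin p) (Fin p) ℝ =>
      |T a b - (1 : Matrix (Fin p) (Fin p) ℝ) a b| := by fun_prop
    refine (this.tendsto 1).eventually_lt_const ?_
    simpa using hε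
  filter_upwards [nhdsWithin_le_nhds hnear, self_mem_nhdsWithin] with S hS hsym
  refine Matrix.PosDef.of_dotProduct_mulVec_pos ?_ fun x hx => ?_
  · simpa [Matrix.IsHermitian, Matrix.conjTranspose_eq_transpose_of_trivial] using hsym
  have hx2 : 0 < ∑ a, x a ^ 2 := by
    obtain ⟨a, ha⟩ := Function.ne_iff.1 hx
    have ha' : x a ≠ 0 := ha
    exact Finset.sum_pos' (fun _ _ => sq_nonneg _) ⟨a, Finset.mem_univ a, by positivity⟩
  have hcs : (∑ a, |x a|) ^ 2 ≤ p * ∑ a, x a ^ 2 := by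
    simpa using sq_sum_le_card_mul_sum_sq (s := Finset.univ) (f := fun a => |x a|)
  have hexp : star x ⬝ᵥ S.mulVec x = ∑ a, x a ^ 2 +
      ∑ a, ∑ b, (S a b - (1 : Matrix (Fin p) (Fin p) ℝ) a b) * (x a * x b) := by
    have h1 : ∑ a, x a ^ 2 = ∑ a, ∑ b, (1 : Matrix (Fin p) (Fin p) ℝ) a b * (x a * x b) := by
      simp [Matrix.one_apply, sq]
    rw [h1, ← Finset.sum_add_distrib]
    simp only [dotProduct, Matrix.mulVec, Pi.star_apply, star_trivial, Finset.mul_sum,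
      ← Finset.sum_add_distrib]
    exact Finset.sum_congr rfl fun a _ => Finset.sum_congr rfl fun b _ => by ring
  have hbound : -(1 / (p + 1) * (∑ a, |x a|) ^ 2) ≤
      ∑ a, ∑ b, (S a b - (1 : Matrix (Fin p) (Fin p) ℝ) a b) * (x a * x b) := by
    rw [sq, Finset.sum_mul_sum, Finset.mul_sum, ← Finset.sum_neg_distrib]
    refine Finset.sum_le_sum fun a _ => ?_
    rw [Finset.mul_sum, ← Finset.sum_neg_distrib]
    refine Finset.sum_le_sum fun b _ => ?_
    rw [← abs_mul]
    refine (neg_le_neg ?_).trans (neg_abs_le _)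
    rw [abs_mul]
    exact mul_le_mul_of_nonneg_right (hS a b).le (abs_nonneg _)
  rw [hexp]
  have h5 : 1 / ((p : ℝ) + 1) * (∑ a, |x a|) ^ 2 < ∑ a, x a ^ 2 := by
    rw [one_div, inv_mul_lt_iff₀ (by positivity)]
    linarith
  linarith

end InvSqrt

end SignalSeparation

namespace SignalSeparation

noncomputable section

/-! ### Moments up to order four -/

section Moments

variable {p : ℕ}

/-- Homogeneous coordinates `(1, z)`. -/
def homCoord (z : EuclideanSpace ℝ (Fin p)) (o : Option (Fin p)) : ℝ := o.elim 1 z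

/-- Raw moments up to order four, indexed by quadruples of homogeneous coordinates. -/
abbrev RawMoments (p : ℕ) : Type :=
  Option (Fin p) × Option (Fin p) × Option (Fin p) × Option (Fin p) → ℝ

/-- The monomials of degree at most four. -/
def monomials (z : EuclideanSpace ℝ (Fin p)) : RawMoments p := fun i =>
  homCoord z i.1 * homCoord z i.2.1 * homCoord z i.2.2.1 * homCoord z i.2.2.2

namespace RawMoments

variable (r : RawMoments p)

def m1 (a : Fin p) : ℝ := r (some a, none, none, none)
def m2 (a b : Fin p) : ℝ := r (some a, some b, none, none)
def m3 (a b c : Fin p) : ℝ := r (some a, some b, some c, none)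
def m4 (a b c e : Fin p) : ℝ := r (some a, some b, some c, some e)

/-- Central second moments. -/
def central2 (a b : Fin p) : ℝ := r.m2 a b - r.m1 a * r.m1 b

/-- Central third moments. -/
def central3 (a b c : Fin p) : ℝ :=
  r.m3 a b c - r.m1 a * r.m2 b c - r.m1 b * r.m2 a c - r.m1 c * r.m2 a b
    + 2 * (r.m1 a * r.m1 b * r.m1 c)

/-- Central fourth moments. -/
def central4 (a b c e : Fin p) : ℝ :=
  r.m4 a b c e - r.m1 a * r.m3 b c e - r.m1 b * r.m3 a c e - r.m1 c * r.m3 a b e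
    - r.m1 e * r.m3 a b c
    + r.m1 a * r.m1 b * r.m2 c e + r.m1 a * r.m1 c * r.m2 b e + r.m1 a * r.m1 e * r.m2 b c
    + r.m1 b * r.m1 c * r.m2 a e + r.m1 b * r.m1 e * r.m2 a c + r.m1 c * r.m1 e * r.m2 a b
    - 3 * (r.m1 a * r.m1 b * r.m1 c * r.m1 e)

end RawMoments

/-- The bilinear form with coefficients `S`. -/
def form2 (S : Fin p → Fin p → ℝ) (u v : Fin p → ℝ) : ℝ := ∑ a, ∑ b, S a b * u a * v b

/-- The trilinear form with coefficients `A`. -/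
def form3 (A : Fin p → Fin p → Fin p → ℝ) (u v w : Fin p → ℝ) : ℝ :=
  ∑ a, ∑ b, ∑ c, A a b c * u a * v b * w c

/-- The quadrilinear form with coefficients `B`. -/
def form4 (B : Fin p → Fin p → Fin p → Fin p → ℝ) (u v w x : Fin p → ℝ) : ℝ :=
  ∑ a, ∑ b, ∑ c, ∑ e, B a b c e * u a * v b * w c * x e

/-- The projection index as a function of central third and fourth moments and of the direction. -/
def momentIndex (α : ℝ) (A : Fin p → Fin p → Fin p → ℝ) (B : Fin p → Fin p → Fin p → Fin p → ℝ)
    (w : Fin p → ℝ) : ℝ :=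
  α * form3 A w w w ^ 2 + (1 - α) * (form4 B w w w w - 3) ^ 2

/-- Arithmetic mean of the first `n` terms. -/
def mean (n : ℕ) : (ℕ → ℝ) →ₗ[ℝ] ℝ := (n : ℝ)⁻¹ • ∑ i ∈ Finset.range n, LinearMap.proj i

theorem mean_apply (n : ℕ) (f : ℕ → ℝ) : mean n f = (n : ℝ)⁻¹ * ∑ i ∈ Finset.range n, f i := by
  simp [mean]

theorem mean_const {n : ℕ} (hn : n ≠ 0) (c : ℝ) : mean n (fun _ => c) = c := by
  rw [mean_apply]
  simp
  field_simp

theorem mean_mul_const (n : ℕ) (f : ℕ → ℝ) (c : ℝ) : mean n (fun i => f i * c) = mean n f * c := by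
  rw [mean_apply, mean_apply, ← Finset.sum_mul, mul_assoc]

theorem mean_sum {ι : Type*} (n : ℕ) (s : Finset ι) (f : ι → ℕ → ℝ) :
    mean n (fun i => ∑ j ∈ s, f j i) = ∑ j ∈ s, mean n (f j) := by
  rw [← map_sum]; congr 1; ext i; simp

/-- Sample moments. -/
def sampleMoments (n : ℕ) (z : ℕ → EuclideanSpace ℝ (Fin p)) : RawMoments p := fun i =>
  mean n fun j => monomials (z j) i

/-- Observations centered at their mean. -/
def centered (n : ℕ) (x : ℕ → EuclideanSpace ℝ (Fin p)) (i : ℕ) (a : Fin p) : ℝ :=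
  x i a - mean n fun j => x j a

/-- Shift invariance allows the sample moments to be taken about the true μ, where the population
moments are those of z, although the functional centers at the sample mean. -/
theorem centered_sub {n : ℕ} (hn : n ≠ 0) (x : ℕ → EuclideanSpace ℝ (Fin p))
    (μ : EuclideanSpace ℝ (Fin p)) : centered n (fun i => x i - μ) = centered n x := by
  ext i a
  have : (fun j => (x j - μ) a) = (fun j => x j a) - fun _ => μ a := by ext; simp
  simp only [centered]
  rw [this, map_sub, mean_const hn]
  simp

theorem central2_sampleMoments {n : ℕ} (hn : n ≠ 0) (z : ℕ → EuclideanSpace ℝ (Fin p))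
    (a b : Fin p) :
    (sampleMoments n z).central2 a b = mean n fun i => centered n z i a * centered n z i b := by
  simp only [RawMoments.central2, RawMoments.m1, RawMoments.m2, sampleMoments, monomials,
    homCoord, Option.elim_some, Option.elim_none, mul_one, centered]
  set ma := mean n fun j => z j a
  set mb := mean n fun j => z j b
  -- The product is written as a linear combination of sequences with coefficients free of i, so
  -- that linearity of `mean` applies. The higher orders are treated alike.
  have : (fun i => (z i a - ma) * (z i b - mb)) =
      (fun i => z i a * z i b) - ma • (fun i => z i b) - mb • (fun i => z i a) +
        fun _ => ma * mb := by
    ext i; simp; ring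
  rw [this, map_add, map_sub, map_sub, map_smul, map_smul, mean_const hn]
  simp only [smul_eq_mul]
  ring

theorem central3_sampleMoments {n : ℕ} (hn : n ≠ 0) (z : ℕ → EuclideanSpace ℝ (Fin p))
    (a b c : Fin p) :
    (sampleMoments n z).central3 a b c =
      mean n fun i => centered n z i a * centered n z i b * centered n z i c := by
  simp only [RawMoments.central3, RawMoments.m1, RawMoments.m2, RawMoments.m3, sampleMoments,
    monomials, homCoord, Option.elim_some, Option.elim_none, mul_one, centered]
  set ma := mean n fun j => z j a
  set mb := mean n fun j => z j b
  set mc := mean n fun j => z j c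
  have : (fun i => (z i a - ma) * (z i b - mb) * (z i c - mc)) =
      (fun i => z i a * z i b * z i c) - ma • (fun i => z i b * z i c)
        - mb • (fun i => z i a * z i c) - mc • (fun i => z i a * z i b)
        + (mb * mc) • (fun i => z i a) + (ma * mc) • (fun i => z i b)
        + (ma * mb) • (fun i => z i c) - fun _ => ma * mb * mc := by
    ext i; simp; ring
  rw [this]
  simp only [map_add, map_sub, map_smul]
  rw [mean_const hn]
  simp only [smul_eq_mul]
  ring

theorem central4_sampleMoments {n : ℕ} (hn : n ≠ 0) (z : ℕ → EuclideanSpace ℝ (Fin p))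
    (a b c e : Fin p) :
    (sampleMoments n z).central4 a b c e = mean n fun i =>
      centered n z i a * centered n z i b * centered n z i c * centered n z i e := by
  simp only [RawMoments.central4, RawMoments.m1, RawMoments.m2, RawMoments.m3, RawMoments.m4,
    sampleMoments, monomials, homCoord, Option.elim_some, Option.elim_none, mul_one, centered]
  set ma := mean n fun j => z j a
  set mb := mean n fun j => z j b
  set mc := mean n fun j => z j c
  set me := mean n fun j => z j e
  have : (fun i => (z i a - ma) * (z i b - mb) * (z i c - mc) * (z i e - me)) =
      (fun i => z i a * z i b * z i c * z i e) - ma • (fun i => z i b * z i c * z i e)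
        - mb • (fun i => z i a * z i c * z i e) - mc • (fun i => z i a * z i b * z i e)
        - me • (fun i => z i a * z i b * z i c)
        + (ma * mb) • (fun i => z i c * z i e) + (ma * mc) • (fun i => z i b * z i e)
        + (ma * me) • (fun i => z i b * z i c) + (mb * mc) • (fun i => z i a * z i e)
        + (mb * me) • (fun i => z i a * z i c) + (mc * me) • (fun i => z i a * z i b)
        - (mb * mc * me) • (fun i => z i a) - (ma * mc * me) • (fun i => z i b)
        - (ma * mb * me) • (fun i => z i c) - (ma * mb * mc) • (fun i => z i e)
        + fun _ => ma * mb * mc * me := by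
    ext i; simp; ring
  rw [this]
  simp only [map_add, map_sub, map_smul]
  rw [mean_const hn]
  simp only [smul_eq_mul]
  ring

theorem sum_pow_two {ι : Type*} (s : Finset ι) (f : ι → ℝ) :
    (∑ a ∈ s, f a) ^ 2 = ∑ a ∈ s, ∑ b ∈ s, f a * f b := by
  simp only [← Finset.mul_sum, ← Finset.sum_mul]; ring

theorem sum_pow_three {ι : Type*} (s : Finset ι) (f : ι → ℝ) :
    (∑ a ∈ s, f a) ^ 3 = ∑ a ∈ s, ∑ b ∈ s, ∑ c ∈ s, f a * f b * f c := by
  simp only [← Finset.mul_sum, ← Finset.sum_mul]; ring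

theorem sum_pow_four {ι : Type*} (s : Finset ι) (f : ι → ℝ) :
    (∑ a ∈ s, f a) ^ 4 = ∑ a ∈ s, ∑ b ∈ s, ∑ c ∈ s, ∑ e ∈ s, f a * f b * f c * f e := by
  simp only [← Finset.mul_sum, ← Finset.sum_mul]; ring

theorem form2_central2 {n : ℕ} (hn : n ≠ 0) (z : ℕ → EuclideanSpace ℝ (Fin p))
    (w : Fin p → ℝ) : form2 (sampleMoments n z).central2 w w =
      mean n fun i => (∑ a, w a * centered n z i a) ^ 2 := by
  simp only [form2, central2_sampleMoments hn, ← mean_mul_const, ← mean_sum, sum_pow_two]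
  congr 1
  ext i
  exact Finset.sum_congr rfl fun a _ => Finset.sum_congr rfl fun b _ => by ring

theorem form3_central3 {n : ℕ} (hn : n ≠ 0) (z : ℕ → EuclideanSpace ℝ (Fin p))
    (w : Fin p → ℝ) : form3 (sampleMoments n z).central3 w w w =
      mean n fun i => (∑ a, w a * centered n z i a) ^ 3 := by
  simp only [form3, central3_sampleMoments hn, ← mean_mul_const, ← mean_sum, sum_pow_three]
  congr 1
  ext i
  exact Finset.sum_congr rfl fun a _ => Finset.sum_congr rfl fun b _ =>
    Finset.sum_congr rfl fun c _ => by ring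

theorem form4_central4 {n : ℕ} (hn : n ≠ 0) (z : ℕ → EuclideanSpace ℝ (Fin p))
    (w : Fin p → ℝ) : form4 (sampleMoments n z).central4 w w w w =
      mean n fun i => (∑ a, w a * centered n z i a) ^ 4 := by
  simp only [form4, central4_sampleMoments hn, ← mean_mul_const, ← mean_sum, sum_pow_four]
  congr 1
  ext i
  exact Finset.sum_congr rfl fun a _ => Finset.sum_congr rfl fun b _ =>
    Finset.sum_congr rfl fun c _ => Finset.sum_congr rfl fun e _ => by ring

/-! ### The functional at an empirical distribution -/

theorem integral_empirical {F : Type*} [NormedAddCommGroup F] [NormedSpace ℝ F] [CompleteSpace F]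
    (x : ℕ → EuclideanSpace ℝ (Fin p)) (n : ℕ) (f : EuclideanSpace ℝ (Fin p) → F) :
    ∫ y, f y ∂(empirical x n) = (n : ℝ)⁻¹ • ∑ i ∈ Finset.range n, f (x i) := by
  rw [empirical, integral_smul_measure, integral_finsetSum_measure]
  · simp
  · intro i _
    exact integrable_dirac (by simp)

theorem integral_empirical_eq_mean (x : ℕ → EuclideanSpace ℝ (Fin p)) (n : ℕ)
    (f : EuclideanSpace ℝ (Fin p) → ℝ) :
    ∫ y, f y ∂(empirical x n) = mean n fun i => f (x i) := by
  rw [integral_empirical, mean_apply, smul_eq_mul]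

theorem integral_empirical_apply (x : ℕ → EuclideanSpace ℝ (Fin p)) (n : ℕ) (a : Fin p) :
    (∫ y, y ∂(empirical x n)) a = mean n fun i => x i a := by
  rw [integral_empirical, mean_apply]
  simp

theorem covMatrix_empirical {n : ℕ} (hn : n ≠ 0) (x : ℕ → EuclideanSpace ℝ (Fin p))
    (μ : EuclideanSpace ℝ (Fin p)) :
    covMatrix (empirical x n) = Matrix.of (sampleMoments n fun i => x i - μ).central2 := by
  ext a b
  simp only [covMatrix, Matrix.of_apply, covariance, integral_empirical_eq_mean,
    central2_sampleMoments hn, centered_sub hn]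
  rfl

theorem covMatrix_empirical_zero (x : ℕ → EuclideanSpace ℝ (Fin p)) :
    covMatrix (empirical x 0) = 0 := by
  ext a b
  simp [covMatrix, covariance, integral_empirical_eq_mean, mean_apply]

theorem inner_standardize (x : ℕ → EuclideanSpace ℝ (Fin p)) (n i : ℕ)
    (u : EuclideanSpace ℝ (Fin p)) :
    inner ℝ u (standardize (empirical x n) (x i)) =
      ∑ a, (invSqrt (covMatrix (empirical x n))).mulVec u a * centered n x i a := by
  rw [standardize]
  set R := invSqrt (covMatrix (empirical x n)) with hR
  have hRt : R.transpose = R := transpose_invSqrt _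
  rw [Matrix.inner_toEuclideanCLM, Matrix.dotProduct_mulVec]
  nth_rewrite 1 [← hRt]
  rw [Matrix.vecMul_transpose]
  simp only [dotProduct, PiLp.sub_apply, integral_empirical_apply, centered]

/-- For a unit vector u the projected standardized sample already has mean 0 and variance 1, because
R S R = 1 for R = S^{-1/2}. The second standardization inside skewness and kurtosis then does
nothing, and the projection has coefficient vector w = R u on the centered data. -/
theorem projIndex_empirical {n : ℕ} (hn : n ≠ 0) (α : ℝ) (x : ℕ → EuclideanSpace ℝ (Fin p))
    (μ : EuclideanSpace ℝ (Fin p)) (hS : (covMatrix (empirical x n)).PosDef)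
    {u : EuclideanSpace ℝ (Fin p)} (hu : ‖u‖ = 1) :
    projIndex α (empirical x n) u =
      momentIndex α (sampleMoments n fun i => x i - μ).central3
        (sampleMoments n fun i => x i - μ).central4
        ((invSqrt (covMatrix (empirical x n))).mulVec u) := by
  set R := invSqrt (covMatrix (empirical x n)) with hR
  have hRt : R.transpose = R := transpose_invSqrt _
  set w := R.mulVec u with hw
  have hmean : ∫ y, inner ℝ u (standardize (empirical x n) y) ∂(empirical x n) = 0 := by
    rw [integral_empirical_eq_mean]
    simp only [inner_standardize]
    rw [mean_sum]
    refine Finset.sum_eq_zero fun a _ => ?_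
    have : (fun i => w a * centered n x i a) =
        w a • ((fun i => x i a) - fun _ => mean n fun j => x j a) := by
      ext i; simp [centered]
    rw [this, map_smul, map_sub, mean_const hn, sub_self, smul_zero]
  have hvar : Var[fun y => inner ℝ u (standardize (empirical x n) y); empirical x n] = 1 := by
    have hmeas : Measurable fun y => inner ℝ u (standardize (empirical x n) y) := by
      unfold standardize; fun_prop
    rw [variance_of_integral_eq_zero hmeas.aemeasurable hmean, integral_empirical_eq_mean]
    simp only [inner_standardize]
    rw [← centered_sub hn x μ, ← form2_central2 hn, ← hR, ← hw]
    have h1 : form2 (sampleMoments n fun i => x i - μ).central2 w w =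
        w ⬝ᵥ (covMatrix (empirical x n)).mulVec w := by
      rw [covMatrix_empirical hn x μ]
      simp only [form2, dotProduct, Matrix.mulVec, Matrix.of_apply, Finset.mul_sum]
      exact Finset.sum_congr rfl fun a _ => Finset.sum_congr rfl fun b _ => by ring
    have h2 : R * (covMatrix (empirical x n)) * R = 1 := invSqrt_mul_mul_invSqrt hS
    have hw' : w = Matrix.vecMul u R := by rw [hw, ← Matrix.vecMul_transpose, hRt]
    rw [h1]
    nth_rewrite 1 [hw']
    rw [← Matrix.dotProduct_mulVec, hw, Matrix.mulVec_mulVec, Matrix.mulVec_mulVec,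
      h2, Matrix.one_mulVec]
    simpa [dotProduct, sq] using sum_sq_eq_one hu
  have hst : ∀ i, standardizedVar (fun y => inner ℝ u (standardize (empirical x n) y))
      (empirical x n) (x i) = ∑ a, w a * centered n x i a := by
    intro i
    rw [standardizedVar, hmean, hvar, inner_standardize, ← hR, ← hw]
    simp
  simp only [projIndex, skewness, excessKurtosis, integral_empirical_eq_mean, hst, momentIndex,
    form3_central3 hn, form4_central4 hn, centered_sub hn]

end Moments

end

end SignalSeparation

namespace SignalSeparation

noncomputable section

/-! ### First-order conditions -/

section FirstOrder

variable {d p : ℕ}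

theorem hasDerivAt_form2 {S : ℝ → Fin p → Fin p → ℝ} {S' : Fin p → Fin p → ℝ}
    {u v : ℝ → Fin p → ℝ} {u' v' : Fin p → ℝ} {t : ℝ}
    (hS : ∀ a b, HasDerivAt (fun t => S t a b) (S' a b) t)
    (hu : ∀ a, HasDerivAt (fun t => u t a) (u' a) t)
    (hv : ∀ a, HasDerivAt (fun t => v t a) (v' a) t) :
    HasDerivAt (fun t => form2 (S t) (u t) (v t))
      (form2 S' (u t) (v t) + form2 (S t) u' (v t) + form2 (S t) (u t) v') t := by
  simp only [form2, ← Finset.sum_add_distrib]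
  refine HasDerivAt.fun_sum fun a _ => HasDerivAt.fun_sum fun b _ => ?_
  exact (((hS a b).mul (hu a)).mul (hv b)).congr_deriv (by simp; ring)

theorem hasDerivAt_form3 {A : ℝ → Fin p → Fin p → Fin p → ℝ} {A' : Fin p → Fin p → Fin p → ℝ}
    {u v w : ℝ → Fin p → ℝ} {u' v' w' : Fin p → ℝ} {t : ℝ}
    (hA : ∀ a b c, HasDerivAt (fun t => A t a b c) (A' a b c) t)
    (hu : ∀ a, HasDerivAt (fun t => u t a) (u' a) t)
    (hv : ∀ a, HasDerivAt (fun t => v t a) (v' a) t)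
    (hw : ∀ a, HasDerivAt (fun t => w t a) (w' a) t) :
    HasDerivAt (fun t => form3 (A t) (u t) (v t) (w t))
      (form3 A' (u t) (v t) (w t) + form3 (A t) u' (v t) (w t) + form3 (A t) (u t) v' (w t)
        + form3 (A t) (u t) (v t) w') t := by
  simp only [form3, ← Finset.sum_add_distrib]
  refine HasDerivAt.fun_sum fun a _ => HasDerivAt.fun_sum fun b _ =>
    HasDerivAt.fun_sum fun c _ => ?_
  exact ((((hA a b c).mul (hu a)).mul (hv b)).mul (hw c)).congr_deriv (by simp; ring)

theorem hasDerivAt_form4 {B : ℝ → Fin p → Fin p → Fin p → Fin p → ℝ}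
    {B' : Fin p → Fin p → Fin p → Fin p → ℝ}
    {u v w x : ℝ → Fin p → ℝ} {u' v' w' x' : Fin p → ℝ} {t : ℝ}
    (hB : ∀ a b c e, HasDerivAt (fun t => B t a b c e) (B' a b c e) t)
    (hu : ∀ a, HasDerivAt (fun t => u t a) (u' a) t)
    (hv : ∀ a, HasDerivAt (fun t => v t a) (v' a) t)
    (hw : ∀ a, HasDerivAt (fun t => w t a) (w' a) t)
    (hx : ∀ a, HasDerivAt (fun t => x t a) (x' a) t) :
    HasDerivAt (fun t => form4 (B t) (u t) (v t) (w t) (x t))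
      (form4 B' (u t) (v t) (w t) (x t) + form4 (B t) u' (v t) (w t) (x t)
        + form4 (B t) (u t) v' (w t) (x t) + form4 (B t) (u t) (v t) w' (x t)
        + form4 (B t) (u t) (v t) (w t) x') t := by
  simp only [form4, ← Finset.sum_add_distrib]
  refine HasDerivAt.fun_sum fun a _ => HasDerivAt.fun_sum fun b _ =>
    HasDerivAt.fun_sum fun c _ => HasDerivAt.fun_sum fun e _ => ?_
  exact (((((hB a b c e).mul (hu a)).mul (hv b)).mul (hw c)).mul (hx e)).congr_deriv
    (by simp; ring)

/-- The derivative of `w ↦ form3 A w w w` in the direction `h`. -/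
def diag3 (A : Fin p → Fin p → Fin p → ℝ) (w h : Fin p → ℝ) : ℝ :=
  form3 A h w w + form3 A w h w + form3 A w w h

/-- The derivative of `w ↦ form4 B w w w w` in the direction `h`. -/
def diag4 (B : Fin p → Fin p → Fin p → Fin p → ℝ) (w h : Fin p → ℝ) : ℝ :=
  form4 B h w w w + form4 B w h w w + form4 B w w h w + form4 B w w w h

/-- Half the derivative of the projection index at `w` in the direction `h`. -/
def halfGrad (α : ℝ) (A : Fin p → Fin p → Fin p → ℝ) (B : Fin p → Fin p → Fin p → Fin p → ℝ)
    (w h : Fin p → ℝ) : ℝ :=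
  α * form3 A w w w * diag3 A w h + (1 - α) * (form4 B w w w w - 3) * diag4 B w h

theorem isLinearMap_diag3 (A : Fin p → Fin p → Fin p → ℝ) (w : Fin p → ℝ) :
    IsLinearMap ℝ (diag3 A w) where
  map_add x y := by
    simp only [diag3, form3, Pi.add_apply, mul_add, add_mul, Finset.sum_add_distrib]; ring
  map_smul c x := by
    simp only [diag3, form3, Pi.smul_apply, smul_eq_mul, mul_add, Finset.mul_sum]
    congr 1; congr 1
    all_goals exact Finset.sum_congr rfl fun a _ => Finset.sum_congr rfl fun b _ =>
      Finset.sum_congr rfl fun c _ => by ring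

theorem isLinearMap_diag4 (B : Fin p → Fin p → Fin p → Fin p → ℝ) (w : Fin p → ℝ) :
    IsLinearMap ℝ (diag4 B w) where
  map_add x y := by
    simp only [diag4, form4, Pi.add_apply, mul_add, add_mul, Finset.sum_add_distrib]; ring
  map_smul c x := by
    have h1 : form4 B (c • x) w w w = c * form4 B x w w w := by
      simp only [form4, Pi.smul_apply, smul_eq_mul, Finset.mul_sum]
      exact Finset.sum_congr rfl fun _ _ => Finset.sum_congr rfl fun _ _ =>
        Finset.sum_congr rfl fun _ _ => Finset.sum_congr rfl fun _ _ => by ring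
    have h2 : form4 B w (c • x) w w = c * form4 B w x w w := by
      simp only [form4, Pi.smul_apply, smul_eq_mul, Finset.mul_sum]
      exact Finset.sum_congr rfl fun _ _ => Finset.sum_congr rfl fun _ _ =>
        Finset.sum_congr rfl fun _ _ => Finset.sum_congr rfl fun _ _ => by ring
    have h3 : form4 B w w (c • x) w = c * form4 B w w x w := by
      simp only [form4, Pi.smul_apply, smul_eq_mul, Finset.mul_sum]
      exact Finset.sum_congr rfl fun _ _ => Finset.sum_congr rfl fun _ _ =>
        Finset.sum_congr rfl fun _ _ => Finset.sum_congr rfl fun _ _ => by ring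
    have h4 : form4 B w w w (c • x) = c * form4 B w w w x := by
      simp only [form4, Pi.smul_apply, smul_eq_mul, Finset.mul_sum]
      exact Finset.sum_congr rfl fun _ _ => Finset.sum_congr rfl fun _ _ =>
        Finset.sum_congr rfl fun _ _ => Finset.sum_congr rfl fun _ _ => by ring
    rw [diag4, h1, h2, h3, h4, diag4, smul_eq_mul]
    ring

theorem isLinearMap_halfGrad (α : ℝ) (A : Fin p → Fin p → Fin p → ℝ)
    (B : Fin p → Fin p → Fin p → Fin p → ℝ) (w : Fin p → ℝ) :
    IsLinearMap ℝ (halfGrad α A B w) where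
  map_add x y := by
    simp only [halfGrad, (isLinearMap_diag3 A w).map_add, (isLinearMap_diag4 B w).map_add]; ring
  map_smul c x := by
    simp only [halfGrad, (isLinearMap_diag3 A w).map_smul, (isLinearMap_diag4 B w).map_smul,
      smul_eq_mul]
    ring

theorem hasDerivAt_momentIndex (α : ℝ) (A : Fin p → Fin p → Fin p → ℝ)
    (B : Fin p → Fin p → Fin p → Fin p → ℝ) {w : ℝ → Fin p → ℝ} {h : Fin p → ℝ} {t : ℝ}
    (hw : ∀ a, HasDerivAt (fun t => w t a) (h a) t) :
    HasDerivAt (fun t => momentIndex α A B (w t)) (2 * halfGrad α A B (w t) h) t := by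
  have h3 := hasDerivAt_form3 (A := fun _ => A) (A' := 0)
    (fun a b c => hasDerivAt_const t (A a b c)) hw hw hw
  have h4 := hasDerivAt_form4 (B := fun _ => B) (B' := 0)
    (fun a b c e => hasDerivAt_const t (B a b c e)) hw hw hw hw
  refine (((h3.pow 2).const_mul α).add (((h4.sub_const 3).pow 2).const_mul (1 - α))).congr_deriv ?_
  have z3 : form3 (0 : Fin p → Fin p → Fin p → ℝ) (w t) (w t) (w t) = 0 := by simp [form3]
  have z4 : form4 (0 : Fin p → Fin p → Fin p → Fin p → ℝ) (w t) (w t) (w t) (w t) = 0 := by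
    simp [form4]
  rw [z3, z4, halfGrad, diag3, diag4]
  push_cast
  ring

/-- At a local maximizer over the feasible set the derivative vanishes in feasible directions. -/
theorem halfGrad_eq_zero (α : ℝ) (A : Fin p → Fin p → Fin p → ℝ)
    (B : Fin p → Fin p → Fin p → Fin p → ℝ) (R : Matrix (Fin p) (Fin p) ℝ)
    {u : Fin d → EuclideanSpace ℝ (Fin p)} (hu : Orthonormal ℝ u) (k : Fin d)
    (hmax : IsLocalMaxOn (fun v : EuclideanSpace ℝ (Fin p) => momentIndex α A B (R.mulVec v))
      (feasible u k) (u k))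
    {h : EuclideanSpace ℝ (Fin p)} (hh : ∀ j, j ≤ k → inner ℝ h (u j) = 0) :
    halfGrad α A B (R.mulVec (u k)) (R.mulVec h) = 0 := by
  have key : ∀ g : EuclideanSpace ℝ (Fin p), ‖g‖ = 1 → (∀ j, j ≤ k → inner ℝ g (u j) = 0) →
      halfGrad α A B (R.mulVec (u k)) (R.mulVec g) = 0 := by
    intro g hg hgu
    -- A great circle through u_k in a direction orthogonal to u_1, ..., u_k stays feasible, so the
    -- one-variable criterion for a local maximum applies along it.
    let v : ℝ → EuclideanSpace ℝ (Fin p) := fun t => Real.cos t • u k + Real.sin t • g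
    have hv0 : v 0 = u k := by simp [v]
    have hvc : Continuous v := by fun_prop
    have hvf : ∀ t, v t ∈ feasible u k := by
      intro t
      refine ⟨?_, fun l hl => ?_⟩
      · have : ‖v t‖ ^ 2 = 1 := by
          simp only [v]
          rw [norm_add_sq_real, norm_smul, norm_smul, hu.1 k, hg, inner_smul_left,
            inner_smul_right, real_inner_comm, hgu k le_rfl]
          simp [Real.cos_sq_add_sin_sq]
        have h0 := norm_nonneg (v t)
        nlinarith
      · simp only [v]
        rw [inner_add_left, inner_smul_left, inner_smul_left, hgu l hl.le, hu.2 hl.ne']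
        simp
    have hderiv : ∀ a, HasDerivAt (fun t => R.mulVec (v t) a) (R.mulVec g a) 0 := by
      intro a
      have hrw : (fun t => R.mulVec (v t) a) =
          fun t => Real.cos t * R.mulVec (u k) a + Real.sin t * R.mulVec g a := by
        ext t
        simp [v, Matrix.mulVec_add, Matrix.mulVec_smul]
      rw [hrw]
      refine (((Real.hasDerivAt_cos 0).mul_const _).add
        ((Real.hasDerivAt_sin 0).mul_const _)).congr_deriv ?_
      simp
    have hd := hasDerivAt_momentIndex α A B (w := fun t => R.mulVec (v t)) hderiv
    have hloc : IsLocalMax (fun t => momentIndex α A B (R.mulVec (v t))) 0 := by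
      have htend : Tendsto v (𝓝 0) (𝓝[feasible u k] (u k)) := by
        refine tendsto_nhdsWithin_iff.2 ⟨?_, Eventually.of_forall hvf⟩
        rw [← hv0]; exact hvc.tendsto 0
      have := htend.eventually hmax
      rw [IsLocalMax, IsMaxFilter]
      simpa only [hv0] using this
    have := hloc.hasDerivAt_eq_zero hd
    rw [hv0] at this
    linarith
  rcases eq_or_ne h 0 with rfl | hne
  · have := (isLinearMap_halfGrad α A B (R.mulVec (u k))).map_zero
    simpa using this
  · have h1 := key ((‖h‖⁻¹ : ℝ) • h)
      (by rw [norm_smul, norm_inv, norm_norm, inv_mul_cancel₀ (norm_ne_zero_iff.2 hne)])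
      (fun j hj => by rw [inner_smul_left, hh j hj, mul_zero])
    rw [WithLp.ofLp_smul, Matrix.mulVec_smul,
      (isLinearMap_halfGrad α A B (R.mulVec (u k))).map_smul] at h1
    exact (smul_eq_zero.1 h1).resolve_left (inv_ne_zero (norm_ne_zero_iff.2 hne))

theorem form2_eq_dotProduct (S : Matrix (Fin p) (Fin p) ℝ) (u v : Fin p → ℝ) :
    form2 S u v = u ⬝ᵥ S.mulVec v := by
  simp only [form2, dotProduct, Matrix.mulVec, Finset.mul_sum]
  exact Finset.sum_congr rfl fun a _ => Finset.sum_congr rfl fun b _ => by ring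

theorem mulVec_dotProduct_of_transpose {R : Matrix (Fin p) (Fin p) ℝ} (hR : R.transpose = R)
    (u v : Fin p → ℝ) : R.mulVec u ⬝ᵥ v = u ⬝ᵥ R.mulVec v := by
  rw [Matrix.dotProduct_mulVec, ← Matrix.vecMul_transpose, hR]

theorem form2_mulVec_invSqrt {S : Matrix (Fin p) (Fin p) ℝ} (hS : S.PosDef)
    {u : Fin d → EuclideanSpace ℝ (Fin p)} (hu : Orthonormal ℝ u) (k j : Fin d) :
    form2 S ((invSqrt S).mulVec (u k)) ((invSqrt S).mulVec (u j)) = if k = j then 1 else 0 := by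
  rw [form2_eq_dotProduct, mulVec_dotProduct_of_transpose (transpose_invSqrt S),
    Matrix.mulVec_mulVec, Matrix.mulVec_mulVec, invSqrt_mul_mul_invSqrt hS, Matrix.one_mulVec]
  have := orthonormal_iff_ite.1 hu k j
  rw [← this, EuclideanSpace.inner_eq_star_dotProduct, dotProduct_comm]
  simp

/-- The first-order condition of the `k`-th maximization problem in the original coordinates. -/
theorem halfGrad_eq_sum (α : ℝ) (A : Fin p → Fin p → Fin p → ℝ)
    (B : Fin p → Fin p → Fin p → Fin p → ℝ) {S : Matrix (Fin p) (Fin p) ℝ} (hS : S.PosDef)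
    {u : Fin d → EuclideanSpace ℝ (Fin p)} (hu : Orthonormal ℝ u) (k : Fin d)
    (hmax : IsLocalMaxOn
      (fun v : EuclideanSpace ℝ (Fin p) => momentIndex α A B ((invSqrt S).mulVec v))
      (feasible u k) (u k)) (h : Fin p → ℝ) :
    halfGrad α A B ((invSqrt S).mulVec (u k)) h =
      ∑ j with j ≤ k, form2 S h ((invSqrt S).mulVec (u j)) *
        halfGrad α A B ((invSqrt S).mulVec (u k)) ((invSqrt S).mulVec (u j)) := by
  open scoped MatrixOrder in
  set R := invSqrt S with hR
  -- The vector √S h is mapped to h by S^{-1/2}. Removing its components along u_1, ..., u_k makes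
  -- it a feasible direction, and these components are the coefficients of the Lagrange condition.
  let g₀ : EuclideanSpace ℝ (Fin p) := WithLp.toLp 2 ((CFC.sqrt S).mulVec h)
  have hinner : ∀ j, inner ℝ g₀ (u j) = form2 S h (R.mulVec (u j)) := by
    intro j
    rw [form2_eq_dotProduct, Matrix.mulVec_mulVec, mul_invSqrt hS,
      ← mulVec_dotProduct_of_transpose (transpose_sqrt S),
      EuclideanSpace.inner_eq_star_dotProduct, dotProduct_comm]
    simp [g₀]
  let g : EuclideanSpace ℝ (Fin p) := g₀ - ∑ j with j ≤ k, (inner ℝ g₀ (u j) : ℝ) • u j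
  have hg : ∀ j, j ≤ k → inner ℝ g (u j) = 0 := by
    intro j hj
    simp only [g]
    rw [inner_sub_left, sum_inner,
      Finset.sum_eq_single (f := fun i => inner ℝ ((inner ℝ g₀ (u i) : ℝ) • u i) (u j)) j]
    · rw [inner_smul_left, real_inner_self_eq_norm_sq, hu.1 j]; simp
    · intro i _ hij
      rw [inner_smul_left, hu.2 hij, mul_zero]
    · intro hn; exact absurd (Finset.mem_filter.2 ⟨Finset.mem_univ j, hj⟩) hn
  have hz := halfGrad_eq_zero α A B R hu k hmax hg
  have hRg : R.mulVec g = h - ∑ j with j ≤ k, form2 S h (R.mulVec (u j)) • R.mulVec (u j) := by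
    have h1 : R.mulVec g₀ = h := by
      simp only [g₀]
      rw [Matrix.mulVec_mulVec, invSqrt_mul_sqrt hS, Matrix.one_mulVec]
    simp only [g]
    rw [WithLp.ofLp_sub, Matrix.mulVec_sub, h1, WithLp.ofLp_sum, Matrix.mulVec_sum]
    congr 1
    refine Finset.sum_congr rfl fun j _ => ?_
    rw [WithLp.ofLp_smul, Matrix.mulVec_smul, hinner]
  let L := (isLinearMap_halfGrad α A B (R.mulVec (u k))).mk' _
  have hL : ∀ x, halfGrad α A B (R.mulVec (u k)) x = L x := fun _ => rfl
  rw [hRg, hL, map_sub, map_sum, sub_eq_zero] at hz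
  rw [hL, hz]
  exact Finset.sum_congr rfl fun j _ => by rw [map_smul, smul_eq_mul, hL]

end FirstOrder

end

end SignalSeparation

namespace SignalSeparation

/-! ### First-order expansion of solutions of smooth equations. -/

noncomputable section

open Asymptotics in
/-- A solution `y = f x` of smooth equations `F i (x, y) = 0` that is continuous at `x₀` has the
derivative given by linearizing the equations, if the linearized equations determine `y`. -/
theorem isLittleO_of_implicit {X Y ι : Type*} [NormedAddCommGroup X] [NormedSpace ℝ X]
    [NormedAddCommGroup Y] [NormedSpace ℝ Y] [FiniteDimensional ℝ Y] [Fintype ι]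
    {F : ι → X × Y → ℝ} {D : ι → X → Y → ℝ} {x₀ : X} {y₀ : Y}
    (hF : ∀ i, DifferentiableAt ℝ (F i) (x₀, y₀))
    (hD : ∀ i δ h, HasDerivAt (fun t : ℝ => F i (x₀ + t • δ, y₀ + t • h)) (D i δ h) 0)
    (L : X →L[ℝ] Y) (hL : ∀ i δ, D i δ (L δ) = 0) (hinj : ∀ h, (∀ i, D i 0 h = 0) → h = 0)
    {f : X → Y} {l : Filter X} (hl : l ≤ 𝓝 x₀) (hf : Tendsto f l (𝓝 y₀))
    (hF₀ : ∀ i, F i (x₀, y₀) = 0) (hFf : ∀ i, ∀ᶠ x in l, F i (x, f x) = 0) :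
    (fun x => f x - y₀ - L (x - x₀)) =o[l] fun x => x - x₀ := by
  let F' : ι → X × Y →L[ℝ] ℝ := fun i => fderiv ℝ (F i) (x₀, y₀)
  have hF' : ∀ i, HasFDerivAt (F i) (F' i) (x₀, y₀) := fun i => (hF i).hasFDerivAt
  have hFD : ∀ i δ h, F' i (δ, h) = D i δ h := by
    intro i δ h
    have hline : HasDerivAt (fun t : ℝ => (x₀ + t • δ, y₀ + t • h)) (δ, h) 0 := by
      have h1 : HasDerivAt (fun t : ℝ => x₀ + t • δ) δ 0 := by
        simpa using ((hasDerivAt_id (0 : ℝ)).smul_const δ).const_add x₀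
      have h2 : HasDerivAt (fun t : ℝ => y₀ + t • h) h 0 := by
        simpa using ((hasDerivAt_id (0 : ℝ)).smul_const h).const_add y₀
      exact h1.prodMk h2
    have hF'' : HasFDerivAt (F i) (F' i) ((fun t : ℝ => (x₀ + t • δ, y₀ + t • h)) 0) := by
      simpa using hF' i
    exact (hF''.comp_hasDerivAt 0 hline).unique (hD i δ h)
  -- The partial derivative in y. Injectivity in finite dimension gives a lower bound for its norm,
  -- which suffices here; it need not be surjective.
  let B : Y →ₗ[ℝ] ι → ℝ := LinearMap.pi fun i => (F' i).toLinearMap ∘ₗ LinearMap.inr ℝ X Y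
  have hBapp : ∀ h i, B h i = F' i (0, h) := fun h i => rfl
  have hBker : LinearMap.ker B = ⊥ := by
    refine LinearMap.ker_eq_bot'.2 fun h hh => hinj h fun i => ?_
    rw [← hFD, ← hBapp, hh]; rfl
  obtain ⟨K, -, hK⟩ := B.exists_antilipschitzWith hBker
  let ρ : X → X × Y := fun x => (x - x₀, f x - y₀)
  have hpair : Tendsto (fun x => (x, f x)) l (𝓝 (x₀, y₀)) :=
    (show Tendsto (fun x => x) l (𝓝 x₀) from hl).prodMk_nhds hf
  let E : X → Y := fun x => f x - y₀ - L (x - x₀)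
  -- Both values of F are zero and the derivative vanishes on (δ, L δ), so only the image of the
  -- error `E` under `B` remains against the differentiability remainder.
  have hBE : (fun x => B (E x)) =o[l] ρ := by
    refine isLittleO_pi.2 fun i => ?_
    have h1 := (hF' i).isLittleO.comp_tendsto hpair
    have h2 : (fun x => B (E x) i) =ᶠ[l]
        fun x => -(F i (x, f x) - F i (x₀, y₀) - F' i ((x, f x) - (x₀, y₀))) := by
      filter_upwards [hFf i] with x hx
      have h3 : F' i (x - x₀, f x - y₀) = F' i (x - x₀, L (x - x₀)) + F' i (0, E x) := by
        rw [← map_add]; simp [E]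
      have h4 : F' i (x - x₀, L (x - x₀)) = 0 := by rw [hFD, hL]
      rw [hBapp, hx, hF₀, Prod.mk_sub_mk, h3, h4]
      ring
    exact h2.trans_isLittleO h1.neg_left
  have hE : E =o[l] ρ := by
    refine IsBigO.trans_isLittleO (IsBigO.of_bound K (Eventually.of_forall fun x => ?_)) hBE
    simpa using hK.le_mul_dist (E x) 0
  -- The error is at most half of ρ, so the part of ρ that comes from f x - y₀ can be absorbed,
  -- which leaves a multiple of x - x₀.
  have hρ : ρ =O[l] fun x => x - x₀ := by
    refine IsBigO.of_bound (2 * (1 + ‖L‖)) ?_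
    filter_upwards [hE.bound (half_pos one_pos)] with x hx
    have h1 : ‖ρ x‖ ≤ ‖x - x₀‖ + ‖f x - y₀‖ :=
      max_le (le_add_of_nonneg_right (norm_nonneg _)) (le_add_of_nonneg_left (norm_nonneg _))
    have h2 : ‖f x - y₀‖ ≤ ‖E x‖ + ‖L‖ * ‖x - x₀‖ := by
      calc ‖f x - y₀‖ = ‖E x + L (x - x₀)‖ := by simp [E]
        _ ≤ ‖E x‖ + ‖L (x - x₀)‖ := norm_add_le _ _
        _ ≤ _ := add_le_add le_rfl (L.le_opNorm _)
    linarith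
  exact hE.trans_isBigO hρ

/-! ### Derivatives of central moments at independent components. -/

section Linearization

variable {d p : ℕ}

/-- Third moments of independent standardized components with skewnesses `γ`. -/
def indepMoment3 (γ : Fin p → ℝ) (a b c : Fin p) : ℝ := if a = b ∧ b = c then γ a else 0

/-- Fourth moments of independent standardized components with excess kurtoses `κ`. -/
def indepMoment4 (κ : Fin p → ℝ) (a b c e : Fin p) : ℝ :=
  (if a = b ∧ c = e then 1 else 0) + (if a = c ∧ b = e then 1 else 0)
    + (if a = e ∧ b = c then 1 else 0) + if a = b ∧ b = c ∧ c = e then κ a else 0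

/-- The moments up to order four are those of independent standardized components with skewnesses
`γ` and excess kurtoses `κ`. -/
structure RawMoments.IsIndep (r : RawMoments p) (γ κ : Fin p → ℝ) : Prop where
  m1 : ∀ a, r.m1 a = 0
  m2 : ∀ a b, r.m2 a b = if a = b then 1 else 0
  m3 : ∀ a b c, r.m3 a b c = indepMoment3 γ a b c
  m4 : ∀ a b c e, r.m4 a b c e = indepMoment4 κ a b c e

/-- The derivative of the central third moments at moments of independent components. -/
def dcentral3 (δ : RawMoments p) (a b c : Fin p) : ℝ :=
  δ.m3 a b c - δ.m1 a * (if b = c then 1 else 0) - δ.m1 b * (if a = c then 1 else 0)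
    - δ.m1 c * (if a = b then 1 else 0)

/-- The derivative of the central fourth moments at moments of independent components. -/
def dcentral4 (γ : Fin p → ℝ) (δ : RawMoments p) (a b c e : Fin p) : ℝ :=
  δ.m4 a b c e - δ.m1 a * indepMoment3 γ b c e - δ.m1 b * indepMoment3 γ a c e
    - δ.m1 c * indepMoment3 γ a b e - δ.m1 e * indepMoment3 γ a b c

variable {r : RawMoments p} {γ κ : Fin p → ℝ}

theorem RawMoments.IsIndep.central2 (hr : r.IsIndep γ κ) (a b : Fin p) :
    r.central2 a b = if a = b then 1 else 0 := by
  simp [RawMoments.central2, hr.m1, hr.m2]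

theorem RawMoments.IsIndep.central3 (hr : r.IsIndep γ κ) :
    r.central3 = indepMoment3 γ := by
  ext a b c; simp [RawMoments.central3, hr.m1, hr.m3]

theorem RawMoments.IsIndep.central4 (hr : r.IsIndep γ κ) :
    r.central4 = indepMoment4 κ := by
  ext a b c e; simp [RawMoments.central4, hr.m1, hr.m4]

theorem hasDerivAt_line {ι : Type*} (x δ : ι → ℝ) (i : ι) :
    HasDerivAt (fun t : ℝ => (x + t • δ) i) (δ i) 0 := by
  simpa using ((hasDerivAt_id (0 : ℝ)).mul_const (δ i)).const_add (x i)

theorem hasDerivAt_central2 (hr : r.IsIndep γ κ) (δ : RawMoments p) (a b : Fin p) :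
    HasDerivAt (fun t : ℝ => RawMoments.central2 (r + t • δ) a b) (δ.m2 a b) 0 := by
  have h := hasDerivAt_line r δ
  refine ((h (some a, some b, none, none)).sub ((h (some a, none, none, none)).mul
    (h (some b, none, none, none)))).congr_deriv ?_
  have h1 := hr.m1
  simp only [RawMoments.m1] at h1
  simp [h1, RawMoments.m2]

theorem hasDerivAt_central3 (hr : r.IsIndep γ κ) (δ : RawMoments p) (a b c : Fin p) :
    HasDerivAt (fun t : ℝ => RawMoments.central3 (r + t • δ) a b c) (dcentral3 δ a b c) 0 := by
  have h := hasDerivAt_line r δ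
  have h1 : ∀ a, HasDerivAt (fun t : ℝ => RawMoments.m1 (r + t • δ) a) (δ.m1 a) 0 :=
    fun a => h _
  have h2 : ∀ a b, HasDerivAt (fun t : ℝ => RawMoments.m2 (r + t • δ) a b) (δ.m2 a b) 0 :=
    fun a b => h _
  have h3 : HasDerivAt (fun t : ℝ => RawMoments.m3 (r + t • δ) a b c) (δ.m3 a b c) 0 := h _
  refine ((((h3.sub ((h1 a).mul (h2 b c))).sub ((h1 b).mul (h2 a c))).sub
    ((h1 c).mul (h2 a b))).add ((((h1 a).mul (h1 b)).mul (h1 c)).const_mul 2)).congr_deriv ?_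
  simp [hr.m1, hr.m2, dcentral3]

theorem hasDerivAt_central4 (hr : r.IsIndep γ κ) (δ : RawMoments p) (a b c e : Fin p) :
    HasDerivAt (fun t : ℝ => RawMoments.central4 (r + t • δ) a b c e)
      (dcentral4 γ δ a b c e) 0 := by
  have h := hasDerivAt_line r δ
  have h1 : ∀ a, HasDerivAt (fun t : ℝ => RawMoments.m1 (r + t • δ) a) (δ.m1 a) 0 :=
    fun a => h _
  have h2 : ∀ a b, HasDerivAt (fun t : ℝ => RawMoments.m2 (r + t • δ) a b) (δ.m2 a b) 0 :=
    fun a b => h _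
  have h3 : ∀ a b c, HasDerivAt (fun t : ℝ => RawMoments.m3 (r + t • δ) a b c) (δ.m3 a b c) 0 :=
    fun a b c => h _
  have h4 : HasDerivAt (fun t : ℝ => RawMoments.m4 (r + t • δ) a b c e) (δ.m4 a b c e) 0 := h _
  -- First moments vanish at the base point, so every product with at least two of them has
  -- derivative zero.
  have h112 : ∀ a b c e, HasDerivAt (fun t : ℝ => RawMoments.m1 (r + t • δ) a *
      RawMoments.m1 (r + t • δ) b * RawMoments.m2 (r + t • δ) c e) 0 0 := fun a b c e =>
    (((h1 a).mul (h1 b)).mul (h2 c e)).congr_deriv (by simp [hr.m1])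
  have h1111 : HasDerivAt (fun t : ℝ => RawMoments.m1 (r + t • δ) a *
      RawMoments.m1 (r + t • δ) b * RawMoments.m1 (r + t • δ) c * RawMoments.m1 (r + t • δ) e)
      0 0 := ((((h1 a).mul (h1 b)).mul (h1 c)).mul (h1 e)).congr_deriv (by simp [hr.m1])
  refine (((((((((((h4.sub ((h1 a).mul (h3 b c e))).sub ((h1 b).mul (h3 a c e))).sub
    ((h1 c).mul (h3 a b e))).sub ((h1 e).mul (h3 a b c))).add (h112 a b c e)).add
    (h112 a c b e)).add (h112 a e b c)).add (h112 b c a e)).add (h112 b e a c)).add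
    (h112 c e a b)).sub (h1111.const_mul 3)).congr_deriv ?_
  simp [hr.m1, hr.m3, dcentral4]

theorem form2_single_left (S : Fin p → Fin p → ℝ) (u : Fin p → ℝ) (a : Fin p) :
    form2 S (Pi.single a 1) u = ∑ b, S a b * u b := by
  simp [form2, Pi.single_apply]

theorem form2_single_right (S : Fin p → Fin p → ℝ) (u : Fin p → ℝ) (b : Fin p) :
    form2 S u (Pi.single b 1) = ∑ a, S a b * u a := by
  simp [form2, Pi.single_apply]

theorem form2_single (S : Fin p → Fin p → ℝ) (a b : Fin p) :
    form2 S (Pi.single a 1) (Pi.single b 1) = S a b := by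
  simp [form2, Pi.single_apply]

theorem form3_single (A : Fin p → Fin p → Fin p → ℝ) (a b c : Fin p) :
    form3 A (Pi.single a 1) (Pi.single b 1) (Pi.single c 1) = A a b c := by
  simp [form3, Pi.single_apply]

theorem form3_single₂₃ (A : Fin p → Fin p → Fin p → ℝ) (u : Fin p → ℝ) (b c : Fin p) :
    form3 A u (Pi.single b 1) (Pi.single c 1) = ∑ a, A a b c * u a := by
  simp [form3, Pi.single_apply]

theorem form3_single₁₃ (A : Fin p → Fin p → Fin p → ℝ) (u : Fin p → ℝ) (a c : Fin p) :
    form3 A (Pi.single a 1) u (Pi.single c 1) = ∑ b, A a b c * u b := by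
  simp [form3, Pi.single_apply]

theorem form3_single₁₂ (A : Fin p → Fin p → Fin p → ℝ) (u : Fin p → ℝ) (a b : Fin p) :
    form3 A (Pi.single a 1) (Pi.single b 1) u = ∑ c, A a b c * u c := by
  simp [form3, Pi.single_apply]

theorem form4_single (B : Fin p → Fin p → Fin p → Fin p → ℝ) (a b c e : Fin p) :
    form4 B (Pi.single a 1) (Pi.single b 1) (Pi.single c 1) (Pi.single e 1) = B a b c e := by
  simp [form4, Pi.single_apply]

theorem form4_single₂₃₄ (B : Fin p → Fin p → Fin p → Fin p → ℝ) (u : Fin p → ℝ) (b c e : Fin p) :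
    form4 B u (Pi.single b 1) (Pi.single c 1) (Pi.single e 1) = ∑ a, B a b c e * u a := by
  simp [form4, Pi.single_apply]

theorem form4_single₁₃₄ (B : Fin p → Fin p → Fin p → Fin p → ℝ) (u : Fin p → ℝ) (a c e : Fin p) :
    form4 B (Pi.single a 1) u (Pi.single c 1) (Pi.single e 1) = ∑ b, B a b c e * u b := by
  simp [form4, Pi.single_apply]

theorem form4_single₁₂₄ (B : Fin p → Fin p → Fin p → Fin p → ℝ) (u : Fin p → ℝ) (a b e : Fin p) :
    form4 B (Pi.single a 1) (Pi.single b 1) u (Pi.single e 1) = ∑ c, B a b c e * u c := by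
  simp [form4, Pi.single_apply]

theorem form4_single₁₂₃ (B : Fin p → Fin p → Fin p → Fin p → ℝ) (u : Fin p → ℝ) (a b c : Fin p) :
    form4 B (Pi.single a 1) (Pi.single b 1) (Pi.single c 1) u = ∑ e, B a b c e * u e := by
  simp [form4, Pi.single_apply]

end Linearization

end

end SignalSeparation

namespace SignalSeparation

noncomputable section

/-! ### The estimating equations and their linearization. -/

section Equations

variable {d p : ℕ}

/-- The derivative of `w ↦ diag3 A w h` in the direction `x`. -/
def cross3 (A : Fin p → Fin p → Fin p → ℝ) (w x h : Fin p → ℝ) : ℝ :=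
  form3 A h x w + form3 A h w x + form3 A x h w + form3 A w h x + form3 A x w h + form3 A w x h

/-- The derivative of `w ↦ diag4 B w h` in the direction `x`. -/
def cross4 (B : Fin p → Fin p → Fin p → Fin p → ℝ) (w x h : Fin p → ℝ) : ℝ :=
  (form4 B h x w w + form4 B h w x w + form4 B h w w x)
    + (form4 B x h w w + form4 B w h x w + form4 B w h w x)
    + (form4 B x w h w + form4 B w x h w + form4 B w w h x)
    + (form4 B x w w h + form4 B w x w h + form4 B w w x h)

theorem hasDerivAt_diag3 {A : ℝ → Fin p → Fin p → Fin p → ℝ} {A' : Fin p → Fin p → Fin p → ℝ}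
    {w : ℝ → Fin p → ℝ} {w' : Fin p → ℝ} {t : ℝ} (h : Fin p → ℝ)
    (hA : ∀ a b c, HasDerivAt (fun t => A t a b c) (A' a b c) t)
    (hw : ∀ a, HasDerivAt (fun t => w t a) (w' a) t) :
    HasDerivAt (fun t => diag3 (A t) (w t) h) (diag3 A' (w t) h + cross3 (A t) (w t) w' h) t := by
  have hh : ∀ a, HasDerivAt (fun _ : ℝ => h a) ((0 : Fin p → ℝ) a) t :=
    fun a => hasDerivAt_const t (h a)
  refine (((hasDerivAt_form3 hA hh hw hw).add (hasDerivAt_form3 hA hw hh hw)).add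
    (hasDerivAt_form3 hA hw hw hh)).congr_deriv ?_
  have h1 : ∀ u v : Fin p → ℝ, form3 (A t) 0 u v = 0 := fun u v => by simp [form3]
  have h2 : ∀ u v : Fin p → ℝ, form3 (A t) u 0 v = 0 := fun u v => by simp [form3]
  have h3 : ∀ u v : Fin p → ℝ, form3 (A t) u v 0 = 0 := fun u v => by simp [form3]
  rw [h1, h2, h3, diag3, cross3]
  ring

theorem hasDerivAt_diag4 {B : ℝ → Fin p → Fin p → Fin p → Fin p → ℝ}
    {B' : Fin p → Fin p → Fin p → Fin p → ℝ}
    {w : ℝ → Fin p → ℝ} {w' : Fin p → ℝ} {t : ℝ} (h : Fin p → ℝ)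
    (hB : ∀ a b c e, HasDerivAt (fun t => B t a b c e) (B' a b c e) t)
    (hw : ∀ a, HasDerivAt (fun t => w t a) (w' a) t) :
    HasDerivAt (fun t => diag4 (B t) (w t) h) (diag4 B' (w t) h + cross4 (B t) (w t) w' h) t := by
  have hh : ∀ a, HasDerivAt (fun _ : ℝ => h a) ((0 : Fin p → ℝ) a) t :=
    fun a => hasDerivAt_const t (h a)
  refine ((((hasDerivAt_form4 hB hh hw hw hw).add (hasDerivAt_form4 hB hw hh hw hw)).add
    (hasDerivAt_form4 hB hw hw hh hw)).add (hasDerivAt_form4 hB hw hw hw hh)).congr_deriv ?_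
  have h1 : ∀ u v w : Fin p → ℝ, form4 (B t) 0 u v w = 0 := fun u v w => by simp [form4]
  have h2 : ∀ u v w : Fin p → ℝ, form4 (B t) u 0 v w = 0 := fun u v w => by simp [form4]
  have h3 : ∀ u v w : Fin p → ℝ, form4 (B t) u v 0 w = 0 := fun u v w => by simp [form4]
  have h4 : ∀ u v w : Fin p → ℝ, form4 (B t) u v w 0 = 0 := fun u v w => by simp [form4]
  rw [h1, h2, h3, h4, diag4, cross4]
  ring

theorem diag3_indepMoment3 (γ : Fin p → ℝ) (k l : Fin p) :
    diag3 (indepMoment3 γ) (Pi.single k 1) (Pi.single l 1) = if l = k then 3 * γ k else 0 := by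
  simp only [diag3, form3_single, indepMoment3]
  by_cases h : l = k
  · subst h; simp; ring
  · simp [h, Ne.symm h]

theorem diag4_indepMoment4 (κ : Fin p → ℝ) (k l : Fin p) :
    diag4 (indepMoment4 κ) (Pi.single k 1) (Pi.single l 1) =
      if l = k then 4 * (κ k + 3) else 0 := by
  simp only [diag4, form4_single, indepMoment4]
  by_cases h : l = k
  · subst h; simp; ring
  · simp [h, Ne.symm h]

/-- Each term contains both e_k and e_l, while third moments of independent components vanish unless
all indices agree. -/
theorem cross3_indepMoment3 (γ : Fin p → ℝ) {k l : Fin p} (h : l ≠ k) (x : Fin p → ℝ) :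
    cross3 (indepMoment3 γ) (Pi.single k 1) x (Pi.single l 1) = 0 := by
  simp only [cross3, form3_single₂₃, form3_single₁₃, form3_single₁₂, indepMoment3]
  have h1 : ∀ a, ¬ (l = a ∧ a = k) := fun a ⟨h1, h2⟩ => h (h1.trans h2)
  have h2 : ∀ a, ¬ (k = a ∧ a = l) := fun a ⟨h1, h2⟩ => h (h1.trans h2).symm
  simp [h, h.symm, h1, h2]

/-- In each of the twelve terms only one pairing survives: the two copies of e_k with each other,
and x with e_l. -/
theorem cross4_indepMoment4 (κ : Fin p → ℝ) {k l : Fin p} (h : l ≠ k) (x : Fin p → ℝ) :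
    cross4 (indepMoment4 κ) (Pi.single k 1) x (Pi.single l 1) = 12 * x l := by
  have h1 : ∀ a, ¬ (l = a ∧ a = k) := fun a ⟨h1, h2⟩ => h (h1.trans h2)
  have h2 : ∀ a, ¬ (k = a ∧ a = l) := fun a ⟨h1, h2⟩ => h (h1.trans h2).symm
  simp only [cross4, form4_single₂₃₄, form4_single₁₃₄, form4_single₁₂₄, form4_single₁₂₃, indepMoment4]
  simp [h, h.symm, h1, h2]
  ring

/-- The orthonormality and first-order conditions as equations in the moments and in the rows of
the matrix. -/
def equations (hd : d ≤ p) (α : ℝ) :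
    (Fin d × Fin d) ⊕ (Fin d × Fin p) → RawMoments p × (Fin d → Fin p → ℝ) → ℝ
  | Sum.inl (k, j), x =>
    if j ≤ k then form2 x.1.central2 (x.2 k) (x.2 j) - (if k = j then 1 else 0) else 0
  | Sum.inr (k, l), x =>
    if Fin.castLE hd k < l then
      halfGrad α x.1.central3 x.1.central4 (x.2 k) (Pi.single l 1) -
        ∑ j with j ≤ k, form2 x.1.central2 (Pi.single l 1) (x.2 j) *
          halfGrad α x.1.central3 x.1.central4 (x.2 k) (x.2 j)
    else 0

/-- The first coordinate vectors. -/
def coordRows (hd : d ≤ p) : Fin d → Fin p → ℝ := fun k => Pi.single (Fin.castLE hd k) 1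

theorem coordRows_eq_idZero (hd : d ≤ p) : Matrix.of (coordRows hd) = idZero d p := by
  ext k l
  simp [coordRows, idZero, Pi.single_apply, Fin.ext_iff]

/-- The linearized equations at moments of independent components. -/
def linearized (hd : d ≤ p) (α : ℝ) (γ κ : Fin p → ℝ) :
    (Fin d × Fin d) ⊕ (Fin d × Fin p) → RawMoments p → (Fin d → Fin p → ℝ) → ℝ
  | Sum.inl (k, j), δ, h =>
    if j ≤ k then δ.m2 (Fin.castLE hd k) (Fin.castLE hd j) + h k (Fin.castLE hd j) +
      h j (Fin.castLE hd k) else 0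
  | Sum.inr (k, l), δ, h =>
    let K := Fin.castLE hd k
    if K < l then
      α * γ K * diag3 (dcentral3 δ) (Pi.single K 1) (Pi.single l 1) +
        (1 - α) * κ K * (diag4 (dcentral4 γ δ) (Pi.single K 1) (Pi.single l 1) + 12 * h k l) -
        (δ.m2 l K + h k l) * (3 * α * γ K ^ 2 + 4 * (1 - α) * κ K * (κ K + 3))
    else 0

variable {r : RawMoments p} {γ κ : Fin p → ℝ}

theorem differentiable_form3 {X : Type*} [NormedAddCommGroup X] [NormedSpace ℝ X]
    {A : X → Fin p → Fin p → Fin p → ℝ} {u v w : X → Fin p → ℝ}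
    (hA : ∀ a b c, Differentiable ℝ fun x => A x a b c)
    (hu : ∀ a, Differentiable ℝ fun x => u x a) (hv : ∀ a, Differentiable ℝ fun x => v x a)
    (hw : ∀ a, Differentiable ℝ fun x => w x a) :
    Differentiable ℝ fun x => form3 (A x) (u x) (v x) (w x) :=
  Differentiable.fun_sum fun a _ => Differentiable.fun_sum fun b _ =>
    Differentiable.fun_sum fun c _ => (((hA a b c).mul (hu a)).mul (hv b)).mul (hw c)

theorem differentiable_form4 {X : Type*} [NormedAddCommGroup X] [NormedSpace ℝ X]
    {B : X → Fin p → Fin p → Fin p → Fin p → ℝ} {u v w y : X → Fin p → ℝ}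
    (hB : ∀ a b c e, Differentiable ℝ fun x => B x a b c e)
    (hu : ∀ a, Differentiable ℝ fun x => u x a) (hv : ∀ a, Differentiable ℝ fun x => v x a)
    (hw : ∀ a, Differentiable ℝ fun x => w x a) (hy : ∀ a, Differentiable ℝ fun x => y x a) :
    Differentiable ℝ fun x => form4 (B x) (u x) (v x) (w x) (y x) :=
  Differentiable.fun_sum fun a _ => Differentiable.fun_sum fun b _ =>
    Differentiable.fun_sum fun c _ => Differentiable.fun_sum fun e _ =>
      ((((hB a b c e).mul (hu a)).mul (hv b)).mul (hw c)).mul (hy e)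

theorem differentiable_halfGrad {X : Type*} [NormedAddCommGroup X] [NormedSpace ℝ X] {α : ℝ}
    {A : X → Fin p → Fin p → Fin p → ℝ} {B : X → Fin p → Fin p → Fin p → Fin p → ℝ}
    {w h : X → Fin p → ℝ}
    (hA : ∀ a b c, Differentiable ℝ fun x => A x a b c)
    (hB : ∀ a b c e, Differentiable ℝ fun x => B x a b c e)
    (hw : ∀ a, Differentiable ℝ fun x => w x a) (hh : ∀ a, Differentiable ℝ fun x => h x a) :
    Differentiable ℝ fun x => halfGrad α (A x) (B x) (w x) (h x) := by
  have h3 : Differentiable ℝ fun x => form3 (A x) (w x) (w x) (w x) :=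
    differentiable_form3 hA hw hw hw
  have h4 : Differentiable ℝ fun x => form4 (B x) (w x) (w x) (w x) (w x) :=
    differentiable_form4 hB hw hw hw hw
  have d3 : Differentiable ℝ fun x => diag3 (A x) (w x) (h x) :=
    ((differentiable_form3 hA hh hw hw).add (differentiable_form3 hA hw hh hw)).add
      (differentiable_form3 hA hw hw hh)
  have d4 : Differentiable ℝ fun x => diag4 (B x) (w x) (h x) :=
    (((differentiable_form4 hB hh hw hw hw).add (differentiable_form4 hB hw hh hw hw)).add
      (differentiable_form4 hB hw hw hh hw)).add (differentiable_form4 hB hw hw hw hh)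
  unfold halfGrad
  fun_prop

theorem differentiable_central4 {a b c e : Fin p} :
    Differentiable ℝ fun r : RawMoments p => r.central4 a b c e := by
  have m : ∀ i, Differentiable ℝ fun r : RawMoments p => r i := fun i => by fun_prop
  have m1 : ∀ a, Differentiable ℝ fun r : RawMoments p => r.m1 a := fun a => m _
  have m2 : ∀ a b, Differentiable ℝ fun r : RawMoments p => r.m2 a b := fun a b => m _
  have m3 : ∀ a b c, Differentiable ℝ fun r : RawMoments p => r.m3 a b c := fun a b c => m _
  have m4 : ∀ a b c e, Differentiable ℝ fun r : RawMoments p => r.m4 a b c e :=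
    fun a b c e => m _
  have p1 : ∀ a b c e, Differentiable ℝ fun r : RawMoments p => r.m1 a * r.m3 b c e :=
    fun a b c e => (m1 a).mul (m3 b c e)
  have p2 : ∀ a b c e, Differentiable ℝ fun r : RawMoments p => r.m1 a * r.m1 b * r.m2 c e :=
    fun a b c e => ((m1 a).mul (m1 b)).mul (m2 c e)
  have p3 : Differentiable ℝ fun r : RawMoments p => r.m1 a * r.m1 b * r.m1 c * r.m1 e :=
    (((m1 a).mul (m1 b)).mul (m1 c)).mul (m1 e)
  unfold RawMoments.central4
  exact (((((((((((m4 a b c e).fun_sub (p1 a b c e)).fun_sub (p1 b a c e)).fun_sub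
    (p1 c a b e)).fun_sub (p1 e a b c)).fun_add (p2 a b c e)).fun_add (p2 a c b e)).fun_add
    (p2 a e b c)).fun_add (p2 b c a e)).fun_add (p2 b e a c)).fun_add (p2 c e a b)).fun_sub
    (p3.const_mul 3)

theorem differentiable_equations (hd : d ≤ p) (α : ℝ) (i : (Fin d × Fin d) ⊕ (Fin d × Fin p)) :
    Differentiable ℝ (equations hd α i) := by
  have m : ∀ i, Differentiable ℝ fun x : RawMoments p × (Fin d → Fin p → ℝ) => x.1 i :=
    fun i => by fun_prop
  have m1 : ∀ a, Differentiable ℝ fun x : RawMoments p × (Fin d → Fin p → ℝ) => x.1.m1 a :=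
    fun a => m _
  have m2 : ∀ a b, Differentiable ℝ fun x : RawMoments p × (Fin d → Fin p → ℝ) => x.1.m2 a b :=
    fun a b => m _
  have m3 : ∀ a b c, Differentiable ℝ fun x : RawMoments p × (Fin d → Fin p → ℝ) =>
      x.1.m3 a b c := fun a b c => m _
  have m4 : ∀ a b c e, Differentiable ℝ fun x : RawMoments p × (Fin d → Fin p → ℝ) =>
      x.1.m4 a b c e := fun a b c e => m _
  have h2 : ∀ a b, Differentiable ℝ fun x : RawMoments p × (Fin d → Fin p → ℝ) =>
      x.1.central2 a b := fun a b => by unfold RawMoments.central2; fun_prop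
  have h3 : ∀ a b c, Differentiable ℝ fun x : RawMoments p × (Fin d → Fin p → ℝ) =>
      x.1.central3 a b c := fun a b c => by unfold RawMoments.central3; fun_prop
  have h4 : ∀ a b c e, Differentiable ℝ fun x : RawMoments p × (Fin d → Fin p → ℝ) =>
      x.1.central4 a b c e := fun a b c e => differentiable_central4.comp differentiable_fst
  have hw : ∀ k a, Differentiable ℝ fun x : RawMoments p × (Fin d → Fin p → ℝ) => x.2 k a :=
    fun k a => by fun_prop
  have hg : ∀ (k : Fin d) (h : RawMoments p × (Fin d → Fin p → ℝ) → Fin p → ℝ),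
      (∀ a, Differentiable ℝ fun x => h x a) → Differentiable ℝ
        fun x : RawMoments p × (Fin d → Fin p → ℝ) =>
          halfGrad α x.1.central3 x.1.central4 (x.2 k) (h x) := fun k h hh => by
    exact differentiable_halfGrad h3 h4 (hw k) hh
  have hf : ∀ (j : Fin d) (h : RawMoments p × (Fin d → Fin p → ℝ) → Fin p → ℝ),
      (∀ a, Differentiable ℝ fun x => h x a) → Differentiable ℝ
        fun x : RawMoments p × (Fin d → Fin p → ℝ) =>
          form2 x.1.central2 (h x) (x.2 j) := fun k h hh => by
    unfold form2; fun_prop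
  rcases i with ⟨k, j⟩ | ⟨k, l⟩
  · by_cases hjk : j ≤ k
    · have h1 := (hf j (fun x => x.2 k) (hw k)).fun_sub (differentiable_const (if k = j then 1 else 0))
      have h2 : equations hd α (Sum.inl (k, j)) = fun x =>
          form2 x.1.central2 (x.2 k) (x.2 j) - (if k = j then 1 else 0) := by
        ext x; simp only [equations, if_pos hjk]
      rw [h2]
      exact h1
    · have h1 : equations hd α (Sum.inl (k, j)) = fun _ => 0 := by
        ext x; simp only [equations, if_neg hjk]
      rw [h1]
      exact differentiable_const _
  · by_cases hkl : Fin.castLE hd k < l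
    · have h1 : equations hd α (Sum.inr (k, l)) = fun x =>
          halfGrad α x.1.central3 x.1.central4 (x.2 k) (Pi.single l 1) -
            ∑ j with j ≤ k, form2 x.1.central2 (Pi.single l 1) (x.2 j) *
              halfGrad α x.1.central3 x.1.central4 (x.2 k) (x.2 j) := by
        ext x; simp only [equations, if_pos hkl]
      have h2 := hg k (fun _ => Pi.single l 1) fun a => differentiable_const _
      have h3 := fun j => (hf j (fun _ => Pi.single l 1) fun a => differentiable_const _).fun_mul
        (hg k (fun x => x.2 j) (hw j))
      rw [h1]
      exact h2.fun_sub (Differentiable.fun_sum fun j _ => h3 j)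
    · have h1 : equations hd α (Sum.inr (k, l)) = fun _ => 0 := by
        ext x; simp only [equations, if_neg hkl]
      rw [h1]
      exact differentiable_const _

theorem hasDerivAt_equations (hd : d ≤ p) (α : ℝ) (hr : r.IsIndep γ κ)
    (i : (Fin d × Fin d) ⊕ (Fin d × Fin p)) (δ : RawMoments p) (h : Fin d → Fin p → ℝ) :
    HasDerivAt (fun t : ℝ => equations hd α i (r + t • δ, coordRows hd + t • h))
      (linearized hd α γ κ i δ h) 0 := by
  have hw : ∀ k a, HasDerivAt (fun t : ℝ => (coordRows hd + t • h) k a) (h k a) 0 := fun k a => by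
    simpa using ((hasDerivAt_id (0 : ℝ)).mul_const (h k a)).const_add (coordRows hd k a)
  have h2 := hasDerivAt_central2 hr δ
  have h3 := hasDerivAt_central3 hr δ
  have h4 := hasDerivAt_central4 hr δ
  have e2 : r.central2 = fun a b => if a = b then 1 else 0 := by ext a b; exact hr.central2 a b
  rcases i with ⟨k, j⟩ | ⟨k, l⟩
  · simp only [equations, linearized]
    by_cases hjk : j ≤ k
    · simp only [if_pos hjk]
      refine ((hasDerivAt_form2 h2 (hw k) (hw j)).sub_const _).congr_deriv ?_
      simp only [zero_smul, add_zero, coordRows, form2_single_left, form2_single_right, e2]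
      simp [Pi.single_apply]
    · simp only [if_neg hjk]; exact hasDerivAt_const _ _
  · simp only [equations, linearized]
    by_cases hkl : Fin.castLE hd k < l
    · simp only [if_pos hkl]
      set K := Fin.castLE hd k with hK
      have hlK : l ≠ K := hkl.ne'
      have i3 : indepMoment3 γ K K K = γ K := by simp [indepMoment3]
      have i4 : indepMoment4 κ K K K K = 3 + κ K := by simp [indepMoment4]; ring
      have c3 := hasDerivAt_form3 h3 (hw k) (hw k) (hw k)
      have c4 := (hasDerivAt_form4 h4 (hw k) (hw k) (hw k) (hw k)).sub_const 3
      have d3 := hasDerivAt_diag3 (Pi.single l 1) h3 (hw k)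
      have d4 := hasDerivAt_diag4 (Pi.single l 1) h4 (hw k)
      have hN : HasDerivAt (fun t : ℝ => halfGrad α (RawMoments.central3 (r + t • δ))
          (RawMoments.central4 (r + t • δ)) ((coordRows hd + t • h) k) (Pi.single l 1))
          (α * γ K * diag3 (dcentral3 δ) (Pi.single K 1) (Pi.single l 1) +
        (1 - α) * κ K * (diag4 (dcentral4 γ δ) (Pi.single K 1) (Pi.single l 1) + 12 * h k l))
          0 := by
        refine (((c3.const_mul α).mul d3).add ((c4.const_mul (1 - α)).mul d4)).congr_deriv ?_
        simp only [zero_smul, add_zero, coordRows, ← hK, hr.central3, hr.central4,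
          diag3_indepMoment3, diag4_indepMoment4, cross3_indepMoment3 γ hlK,
          cross4_indepMoment4 κ hlK, if_neg hlK, mul_zero, zero_add,
          form3_single, form4_single, i3, i4]
        ring
      have hprod : ∀ j ∈ Finset.univ.filter (· ≤ k), HasDerivAt (fun t : ℝ =>
          form2 (RawMoments.central2 (r + t • δ)) (Pi.single l 1) ((coordRows hd + t • h) j) *
          halfGrad α (RawMoments.central3 (r + t • δ))
          (RawMoments.central4 (r + t • δ)) ((coordRows hd + t • h) k) ((coordRows hd + t • h) j))
          (if j = k then (δ.m2 l K + h k l) *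
            (3 * α * γ K ^ 2 + 4 * (1 - α) * κ K * (κ K + 3)) else 0) 0 := by
        intro j hj
        have hjk : j ≤ k := (Finset.mem_filter.1 hj).2
        have hlJ : l ≠ Fin.castLE hd j := fun he => by
          rw [he] at hkl
          exact absurd (Fin.lt_def.1 hkl) (not_lt.2 (Fin.le_def.1 hjk))
        have f1 := hasDerivAt_form2 (u := fun _ => Pi.single l 1) (u' := 0) h2
          (fun a => hasDerivAt_const _ _) (hw j)
        -- The value of this derivative is irrelevant: in the product rule it is multiplied by the
        -- covariance of e_l and e_j, which is zero since j ≤ k < l.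
        obtain ⟨g', hg'⟩ : ∃ g', HasDerivAt
            (fun t : ℝ => halfGrad α (RawMoments.central3 (r + t • δ))
              (RawMoments.central4 (r + t • δ)) ((coordRows hd + t • h) k)
              ((coordRows hd + t • h) j)) g' 0 := by
          have q3 := ((hasDerivAt_form3 h3 (hw j) (hw k) (hw k)).add
            (hasDerivAt_form3 h3 (hw k) (hw j) (hw k))).add
            (hasDerivAt_form3 h3 (hw k) (hw k) (hw j))
          have q4 := (((hasDerivAt_form4 h4 (hw j) (hw k) (hw k) (hw k)).add
            (hasDerivAt_form4 h4 (hw k) (hw j) (hw k) (hw k))).add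
            (hasDerivAt_form4 h4 (hw k) (hw k) (hw j) (hw k))).add
            (hasDerivAt_form4 h4 (hw k) (hw k) (hw k) (hw j))
          exact ⟨_, ((c3.const_mul α).mul q3).add ((c4.const_mul (1 - α)).mul q4)⟩
        refine (f1.mul hg').congr_deriv ?_
        have z : form2 r.central2 (0 : Fin p → ℝ) (Pi.single (Fin.castLE hd j) 1) = 0 := by
          simp [form2]
        have z1 : form2 r.central2 (Pi.single l 1) (Pi.single (Fin.castLE hd j) 1) = 0 := by
          rw [form2_single, e2]; exact if_neg hlJ
        have z2 : form2 r.central2 (Pi.single l 1) (h j) = h j l := by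
          rw [form2_single_left, e2]; simp
        simp only [zero_smul, add_zero, coordRows, z, z1, z2, zero_mul, form2_single, hr.central3,
          hr.central4, halfGrad, diag3_indepMoment3, diag4_indepMoment4, form3_single,
          form4_single, ← hK, i3, i4]
        -- At the coordinate vectors the multipliers with j ≠ k vanish, and the one with j = k is
        -- the constant 3 α γ² + 4 (1 - α) κ (κ + 3).
        by_cases hjk' : j = k
        · subst hjk'
          rw [if_pos rfl, if_pos rfl, if_pos rfl]
          ring
        · have : Fin.castLE hd j ≠ K := fun he => hjk' (Fin.castLE_injective hd he)
          rw [if_neg this, if_neg this, if_neg hjk']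
          ring
      refine (hN.sub (HasDerivAt.fun_sum hprod)).congr_deriv ?_
      simp
    · simp only [if_neg hkl]; exact hasDerivAt_const _ _

end Equations

end

end SignalSeparation

namespace SignalSeparation

noncomputable section

/-! ### The solution of the linearized equations. -/

section Influence

variable {d p : ℕ}

/-- The constant `3 α γ² + 4 (1 - α) κ²`. -/
def curvature (α : ℝ) (γ κ : Fin p → ℝ) (k : Fin p) : ℝ :=
  3 * α * γ k ^ 2 + 4 * (1 - α) * κ k ^ 2

theorem curvature_ne_zero {α : ℝ} (hα : α ∈ Set.Icc (0 : ℝ) 1) {γ κ : Fin p → ℝ} {k : Fin p}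
    (h : 0 < α * γ k ^ 2 + (1 - α) * κ k ^ 2) : curvature α γ κ k ≠ 0 := by
  have h2 := mul_nonneg (sub_nonneg.2 hα.2) (sq_nonneg (κ k))
  refine ne_of_gt ?_
  simp only [curvature]
  linarith

/-- The derivative of the elements above the diagonal. -/
def upperDeriv (α : ℝ) (γ κ : Fin p → ℝ) (δ : RawMoments p) (k l : Fin p) : ℝ :=
  (curvature α γ κ k)⁻¹ *
    (α * γ k * diag3 (dcentral3 δ) (Pi.single k 1) (Pi.single l 1) +
      (1 - α) * κ k * diag4 (dcentral4 γ δ) (Pi.single k 1) (Pi.single l 1) -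
      (3 * α * γ k ^ 2 + 4 * (1 - α) * κ k * (κ k + 3)) * δ.m2 l k)

theorem upperDeriv_add (α : ℝ) (γ κ : Fin p → ℝ) (δ ε : RawMoments p) (k l : Fin p) :
    upperDeriv α γ κ (δ + ε) k l = upperDeriv α γ κ δ k l + upperDeriv α γ κ ε k l := by
  simp only [upperDeriv, diag3, diag4, form3_single, form4_single, dcentral3, dcentral4,
    RawMoments.m1, RawMoments.m2, RawMoments.m3, RawMoments.m4, Pi.add_apply]
  ring

theorem upperDeriv_smul (α : ℝ) (γ κ : Fin p → ℝ) (c : ℝ) (δ : RawMoments p) (k l : Fin p) :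
    upperDeriv α γ κ (c • δ) k l = c * upperDeriv α γ κ δ k l := by
  simp only [upperDeriv, diag3, diag4, form3_single, form4_single, dcentral3, dcentral4,
    RawMoments.m1, RawMoments.m2, RawMoments.m3, RawMoments.m4, Pi.smul_apply, smul_eq_mul]
  ring

/-- The element `(k, l)` of the derivative of the functional. -/
def entryDeriv (α : ℝ) (γ κ : Fin p → ℝ) (δ : RawMoments p) (k l : Fin p) : ℝ :=
  if k < l then upperDeriv α γ κ δ k l
  else if l = k then -(δ.m2 k k / 2)
  else -upperDeriv α γ κ δ l k - δ.m2 k l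

/-- The derivative of the functional as a function of the moments. -/
def rowsDeriv (hd : d ≤ p) (α : ℝ) (γ κ : Fin p → ℝ) :
    RawMoments p →L[ℝ] (Fin d → Fin p → ℝ) :=
  LinearMap.toContinuousLinearMap
    { toFun := fun δ k l => entryDeriv α γ κ δ (Fin.castLE hd k) l
      map_add' := fun δ ε => by
        ext k l
        simp only [entryDeriv, Pi.add_apply, upperDeriv_add, RawMoments.m2]
        split_ifs <;> ring
      map_smul' := fun c δ => by
        ext k l
        simp only [entryDeriv, Pi.smul_apply, upperDeriv_smul, RawMoments.m2, smul_eq_mul,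
          RingHom.id_apply]
        split_ifs <;> ring }

theorem rowsDeriv_apply (hd : d ≤ p) (α : ℝ) (γ κ : Fin p → ℝ) (δ : RawMoments p) (k : Fin d)
    (l : Fin p) : rowsDeriv hd α γ κ δ k l = entryDeriv α γ κ δ (Fin.castLE hd k) l := rfl

theorem linearized_rowsDeriv (hd : d ≤ p) {α : ℝ} {γ κ : Fin p → ℝ}
    (hc : ∀ k : Fin d, curvature α γ κ (Fin.castLE hd k) ≠ 0)
    (i : (Fin d × Fin d) ⊕ (Fin d × Fin p)) (δ : RawMoments p) :
    linearized hd α γ κ i δ (rowsDeriv hd α γ κ δ) = 0 := by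
  rcases i with ⟨k, j⟩ | ⟨k, l⟩
  · simp only [linearized, rowsDeriv_apply]
    split_ifs with hjk
    · rcases hjk.lt_or_eq with h | rfl
      · have h1 : Fin.castLE hd j < Fin.castLE hd k := h
        simp only [entryDeriv, if_pos h1, if_neg h1.not_gt, if_neg h1.ne]
        ring
      · simp only [entryDeriv, lt_irrefl, if_false, if_true]
        ring
    · rfl
  · simp only [linearized, rowsDeriv_apply]
    split_ifs with hkl
    · simp only [entryDeriv, if_pos hkl, upperDeriv]
      have := hc k
      field_simp
      simp only [curvature]
      ring
    · rfl

theorem diag3_zero_left (w h : Fin p → ℝ) : diag3 (dcentral3 (0 : RawMoments p)) w h = 0 := by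
  simp [diag3, form3, dcentral3, RawMoments.m1, RawMoments.m3]

theorem diag4_zero_left (γ : Fin p → ℝ) (w h : Fin p → ℝ) :
    diag4 (dcentral4 γ (0 : RawMoments p)) w h = 0 := by
  simp [diag4, form4, dcentral4, RawMoments.m1, RawMoments.m4]

/-- The system is triangular. The Lagrange equations determine the entries above the diagonal, the
normalization those on it, and orthogonality expresses each entry below the diagonal by its mirror
image above. -/
theorem eq_zero_of_linearized (hd : d ≤ p) {α : ℝ} {γ κ : Fin p → ℝ}
    (hc : ∀ k : Fin d, curvature α γ κ (Fin.castLE hd k) ≠ 0) {h : Fin d → Fin p → ℝ}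
    (hh : ∀ i, linearized hd α γ κ i 0 h = 0) : h = 0 := by
  have hup : ∀ k l, Fin.castLE hd k < l → h k l = 0 := by
    intro k l hkl
    have h1 := hh (Sum.inr (k, l))
    simp only [linearized, if_pos hkl, diag3_zero_left, diag4_zero_left, RawMoments.m2,
      Pi.zero_apply] at h1
    -- The contribution 12 (1 - α) κ of the second derivative cancels against 4 (1 - α) κ · 3 from
    -- the multiplier, which leaves minus the curvature.
    have h2 : curvature α γ κ (Fin.castLE hd k) * h k l = 0 := by
      simp only [curvature]; linear_combination -h1
    exact (mul_eq_zero.1 h2).resolve_left (hc k)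
  ext k l
  rcases lt_trichotomy (Fin.castLE hd k) l with hkl | hkl | hkl
  · exact hup k l hkl
  · have h1 := hh (Sum.inl (k, k))
    simp only [linearized, le_refl, if_true, RawMoments.m2, Pi.zero_apply] at h1
    rw [← hkl]
    simpa using (by linarith : h k (Fin.castLE hd k) = 0)
  · let j : Fin d := ⟨l, (Fin.lt_def.1 hkl).trans k.2⟩
    have hj : Fin.castLE hd j = l := rfl
    have hjk : j ≤ k := (show (j : ℕ) < k from hkl).le
    have h1 := hh (Sum.inl (k, j))
    simp only [linearized, if_pos hjk, RawMoments.m2, Pi.zero_apply, hj] at h1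
    rw [hup j _ (by rw [hj]; exact hkl)] at h1
    simpa using h1

end Influence

/-! ### The estimator as a function of the moments. -/

section Functional

variable {d p : ℕ}

theorem form3_indepMoment3 (γ v : Fin p → ℝ) :
    form3 (indepMoment3 γ) v v v = ∑ a, v a ^ 3 * γ a := by
  simp only [form3, indepMoment3]
  refine Finset.sum_congr rfl fun a _ => ?_
  rw [Finset.sum_eq_single a, Finset.sum_eq_single a]
  · simp; ring
  · intro b _ hb; simp [hb.symm]
  · simp
  · intro b _ hb; simp [hb.symm]
  · simp

/-- Each of the three pairings gives (∑ v_a²)². On unit vectors their sum is the Gaussian value 3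
that the excess kurtosis subtracts. -/
theorem form4_indepMoment4 (κ v : Fin p → ℝ) :
    form4 (indepMoment4 κ) v v v v = 3 * (∑ a, v a ^ 2) ^ 2 + ∑ a, v a ^ 4 * κ a := by
  have h0 : (∑ a, v a ^ 2) ^ 2 = ∑ a, ∑ b, v a ^ 2 * v b ^ 2 := sum_pow_two _ _
  have h1 : ∑ a, ∑ b, ∑ c, ∑ e, (if a = b ∧ c = e then (1 : ℝ) else 0) * v a * v b * v c * v e =
      ∑ a, ∑ b, v a ^ 2 * v b ^ 2 := by
    refine Finset.sum_congr rfl fun a _ => ?_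
    rw [Finset.sum_eq_single a]
    · refine Finset.sum_congr rfl fun c _ => ?_
      rw [Finset.sum_eq_single c]
      · simp; ring
      · intro b _ hb; simp [hb.symm]
      · simp
    · intro b _ hb; simp [hb.symm]
    · simp
  have h2 : ∑ a, ∑ b, ∑ c, ∑ e, (if a = c ∧ b = e then (1 : ℝ) else 0) * v a * v b * v c * v e =
      ∑ a, ∑ b, v a ^ 2 * v b ^ 2 := by
    refine Finset.sum_congr rfl fun a _ => Finset.sum_congr rfl fun b _ => ?_
    rw [Finset.sum_eq_single a, Finset.sum_eq_single b]
    · simp; ring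
    · intro b _ hb; simp [hb.symm]
    · simp
    · intro b _ hb; simp [hb.symm]
    · simp
  have h3 : ∑ a, ∑ b, ∑ c, ∑ e, (if a = e ∧ b = c then (1 : ℝ) else 0) * v a * v b * v c * v e =
      ∑ a, ∑ b, v a ^ 2 * v b ^ 2 := by
    refine Finset.sum_congr rfl fun a _ => Finset.sum_congr rfl fun b _ => ?_
    rw [Finset.sum_eq_single b, Finset.sum_eq_single a]
    · simp; ring
    · intro b _ hb; simp [hb.symm]
    · simp
    · intro b _ hb; simp [hb.symm]
    · simp
  have h4 : ∑ a, ∑ b, ∑ c, ∑ e, (if a = b ∧ b = c ∧ c = e then κ a else 0) *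
      v a * v b * v c * v e = ∑ a, v a ^ 4 * κ a := by
    refine Finset.sum_congr rfl fun a _ => ?_
    rw [Finset.sum_eq_single a, Finset.sum_eq_single a, Finset.sum_eq_single a]
    · simp; ring
    all_goals first
      | (intro b _ hb; simp [hb.symm])
      | simp
  simp only [form4, indepMoment4, add_mul, Finset.sum_add_distrib]
  rw [h1, h2, h3, h4, h0]
  ring

theorem momentIndex_indepMoment (α : ℝ) (γ κ : Fin p → ℝ) {v : EuclideanSpace ℝ (Fin p)}
    (hv : ‖v‖ = 1) :
    momentIndex α (indepMoment3 γ) (indepMoment4 κ) v = popIndex α γ κ v := by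
  rw [momentIndex, form3_indepMoment3, form4_indepMoment4, sum_sq_eq_one hv, popIndex]
  ring

theorem momentIndex_neg (α : ℝ) (A : Fin p → Fin p → Fin p → ℝ)
    (B : Fin p → Fin p → Fin p → Fin p → ℝ) (w : Fin p → ℝ) :
    momentIndex α A B (-w) = momentIndex α A B w := by
  have h3 : form3 A (-w) (-w) (-w) = -form3 A w w w := by simp [form3]
  have h4 : form4 B (-w) (-w) (-w) (-w) = form4 B w w w w := by simp [form4]
  rw [momentIndex, momentIndex, h3, h4, neg_sq]

theorem continuous_momentIndex {X : Type*} [TopologicalSpace X] (α : ℝ)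
    {A : X → Fin p → Fin p → Fin p → ℝ} {B : X → Fin p → Fin p → Fin p → Fin p → ℝ}
    {w : X → Fin p → ℝ} (hA : ∀ a b c, Continuous fun x => A x a b c)
    (hB : ∀ a b c e, Continuous fun x => B x a b c e) (hw : ∀ a, Continuous fun x => w x a) :
    Continuous fun x => momentIndex α (A x) (B x) (w x) := by
  have h3 : Continuous fun x => form3 (A x) (w x) (w x) (w x) :=
    continuous_finsetSum _ fun a _ => continuous_finsetSum _ fun b _ =>
      continuous_finsetSum _ fun c _ => (((hA a b c).mul (hw a)).mul (hw b)).mul (hw c)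
  have h4 : Continuous fun x => form4 (B x) (w x) (w x) (w x) (w x) :=
    continuous_finsetSum _ fun a _ => continuous_finsetSum _ fun b _ =>
      continuous_finsetSum _ fun c _ => continuous_finsetSum _ fun e _ =>
        ((((hB a b c e).mul (hw a)).mul (hw b)).mul (hw c)).mul (hw e)
  unfold momentIndex
  fun_prop

/-- The inverse square root of a positive definite matrix, and zero for other matrices. -/
def posInvSqrt (S : Fin p → Fin p → ℝ) : Fin p → Fin p → ℝ :=
  open scoped Classical in if (Matrix.of S).PosDef then invSqrt (Matrix.of S) else 0

theorem posInvSqrt_of_posDef {S : Fin p → Fin p → ℝ} (hS : (Matrix.of S).PosDef) :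
    posInvSqrt S = invSqrt (Matrix.of S) := if_pos hS

/-- The positive definite matrices form a Borel set on which the inverse square root is continuous;
the default value 0 elsewhere avoids any question about other matrices. -/
theorem measurable_posInvSqrt : Measurable (posInvSqrt (p := p)) := by
  classical
  have hset : MeasurableSet {S : Fin p → Fin p → ℝ | (Matrix.of S).PosDef} := by
    have h1 : IsClosed {S : Fin p → Fin p → ℝ | (Matrix.of S).PosSemidef} :=
      isClosed_setOf_posSemidef
    have h2 : IsClosed {S : Fin p → Fin p → ℝ | (Matrix.of S).det = 0} :=
      isClosed_eq (Continuous.matrix_det (A := fun S : Fin p → Fin p → ℝ => Matrix.of S)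
        continuous_id) continuous_const
    have h3 : {S : Fin p → Fin p → ℝ | (Matrix.of S).PosDef} =
        {S | (Matrix.of S).PosSemidef} ∩ {S | (Matrix.of S).det = 0}ᶜ := setOf_posDef_eq
    rw [h3]
    exact h1.measurableSet.inter h2.measurableSet.compl
  have hc : ContinuousOn (fun S : Fin p → Fin p → ℝ =>
      (invSqrt (Matrix.of S) : Fin p → Fin p → ℝ)) {S | (Matrix.of S).PosDef} :=
    continuousOn_invSqrt
  have h0 : ContinuousOn (fun _ : Fin p → Fin p → ℝ => (0 : Fin p → Fin p → ℝ))
      {S | (Matrix.of S).PosDef}ᶜ := continuousOn_const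
  exact ContinuousOn.measurable_piecewise (γ := Fin p → Fin p → ℝ) hc h0 hset

theorem continuous_central2 : Continuous (RawMoments.central2 (p := p)) := by
  unfold RawMoments.central2 RawMoments.m1 RawMoments.m2
  fun_prop

theorem continuous_central3 : Continuous (RawMoments.central3 (p := p)) := by
  unfold RawMoments.central3 RawMoments.m1 RawMoments.m2 RawMoments.m3
  fun_prop

theorem continuous_central4 : Continuous (RawMoments.central4 (p := p)) :=
  continuous_pi fun _ => continuous_pi fun _ => continuous_pi fun _ => continuous_pi fun _ =>
    differentiable_central4.continuous

theorem equations_rows (hd : d ≤ p) (α : ℝ) {r : RawMoments p}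
    (hS : (Matrix.of r.central2).PosDef) {u : Fin d → EuclideanSpace ℝ (Fin p)}
    (hu : Orthonormal ℝ u)
    (hmax : ∀ k, IsLocalMaxOn (fun v : EuclideanSpace ℝ (Fin p) =>
      momentIndex α r.central3 r.central4 ((invSqrt (Matrix.of r.central2)).mulVec v))
      (feasible u k) (u k)) (i : (Fin d × Fin d) ⊕ (Fin d × Fin p)) :
    equations hd α i (r, fun k => (invSqrt (Matrix.of r.central2)).mulVec (u k)) = 0 := by
  rcases i with ⟨k, j⟩ | ⟨k, l⟩
  · simp only [equations]
    split_ifs with h1 h2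
    · have := form2_mulVec_invSqrt hS hu k j
      rw [if_pos h2] at this
      exact sub_eq_zero.2 this
    · have := form2_mulVec_invSqrt hS hu k j
      rw [if_neg h2] at this
      exact sub_eq_zero.2 this
    · rfl
  · simp only [equations]
    split_ifs
    · exact sub_eq_zero.2 (halfGrad_eq_sum α _ _ hS hu k (hmax k) _)
    · rfl

/-- Central third and fourth moments and a matrix that standardizes. -/
abbrev IndexData (p : ℕ) : Type :=
  (Fin p → Fin p → Fin p → ℝ) × (Fin p → Fin p → Fin p → Fin p → ℝ) × (Fin p → Fin p → ℝ)

instance : BorelSpace (Fin p → Fin p → Fin p → Fin p → ℝ) :=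
  have : BorelSpace (Fin p → Fin p → Fin p → ℝ) := inferInstance
  Pi.borelSpace

instance : OpensMeasurableSpace (IndexData p) := by
  have h1 : SecondCountableTopology (Fin p → Fin p → Fin p → ℝ) := inferInstance
  have h2 : SecondCountableTopology (Fin p → Fin p → Fin p → Fin p → ℝ) := inferInstance
  have h3 : BorelSpace (Fin p → Fin p → Fin p → ℝ) := inferInstance
  infer_instance

open Asymptotics in
/-- The rows of a solution as a measurable function of the moments, and its derivative at moments
of independent components. -/
theorem exists_solution_functional (hd : d ≤ p) {α : ℝ} (hα : α ∈ Set.Icc (0 : ℝ) 1)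
    {γ κ : Fin p → ℝ}
    (hpos : ∀ j : Fin d, 0 < α * γ (Fin.castLE hd j) ^ 2 + (1 - α) * κ (Fin.castLE hd j) ^ 2)
    (hnoise : ∀ a : Fin p, d ≤ (a : ℕ) → α * γ a ^ 2 + (1 - α) * κ a ^ 2 = 0)
    {r₀ : RawMoments p} (hr : r₀.IsIndep γ κ) :
    ∃ f : RawMoments p → Fin d → Fin p → ℝ, Measurable f ∧
      (∀ r, (Matrix.of r.central2).PosDef → ∃ u : Fin d → EuclideanSpace ℝ (Fin p),
        Orthonormal ℝ u ∧
        (∀ k, IsLocalMaxOn (fun v : EuclideanSpace ℝ (Fin p) =>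
          momentIndex α r.central3 r.central4 ((invSqrt (Matrix.of r.central2)).mulVec v))
          (feasible u k) (u k)) ∧
        ((∀ j j' : Fin d, j < j' →
          α * γ (Fin.castLE hd j') ^ 2 + (1 - α) * κ (Fin.castLE hd j') ^ 2 <
            α * γ (Fin.castLE hd j) ^ 2 + (1 - α) * κ (Fin.castLE hd j) ^ 2) →
          ∀ k, IsMaxOn (fun v : EuclideanSpace ℝ (Fin p) =>
          momentIndex α r.central3 r.central4 ((invSqrt (Matrix.of r.central2)).mulVec v))
          (feasible u k) (u k)) ∧
        f r = fun k => (invSqrt (Matrix.of r.central2)).mulVec (u k)) ∧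
      (fun r => f r - coordRows hd - rowsDeriv hd α γ κ (r - r₀))
        =o[𝓝[{r | (Matrix.of r.central2).transpose = Matrix.of r.central2}] r₀]
        fun r => r - r₀ := by
  -- The standardizing matrix is a free parameter here, so `G` is continuous on the whole parameter
  -- space. The root, which is only known to be measurable, enters afterwards through `q`.
  let G : IndexData p → EuclideanSpace ℝ (Fin p) → ℝ := fun q v =>
    momentIndex α q.1 q.2.1 ((Matrix.of q.2.2).mulVec v)
  have hG : Continuous fun x : IndexData p × EuclideanSpace ℝ (Fin p) => G x.1 x.2 := by
    refine continuous_momentIndex α (fun a b c => by fun_prop) (fun a b c e => by fun_prop)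
      fun a => ?_
    simp only [Matrix.mulVec, dotProduct, Matrix.of_apply]
    fun_prop
  let q₀ : IndexData p := (indepMoment3 γ, indepMoment4 κ, (1 : Matrix (Fin p) (Fin p) ℝ))
  have hG₀ : ∀ v, ‖v‖ = 1 → G q₀ v = popIndex α γ κ v := fun v hv => by
    have : (Matrix.of q₀.2.2).mulVec v = v.ofLp := Matrix.one_mulVec _
    simp only [G, this, q₀]
    exact momentIndex_indepMoment α γ κ hv
  obtain ⟨s, hsm, hs, hso, hst⟩ := exists_measurable_solution hd hα γ κ hpos hnoise hG
    (fun q v => by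
      simp only [G, WithLp.ofLp_neg, Matrix.mulVec_neg, momentIndex_neg]) q₀ hG₀
  let q : RawMoments p → IndexData p := fun r => (r.central3, r.central4, posInvSqrt r.central2)
  have hR : Measurable fun r : RawMoments p => posInvSqrt r.central2 :=
    measurable_posInvSqrt.comp continuous_central2.measurable
  have hq : Measurable q :=
    continuous_central3.measurable.prodMk (continuous_central4.measurable.prodMk hR)
  let f : RawMoments p → Fin d → Fin p → ℝ := fun r k =>
    (Matrix.of (posInvSqrt r.central2)).mulVec (s (q r) k)
  have hfm : Measurable f := by
    refine measurable_pi_lambda _ fun k => measurable_pi_lambda _ fun l => ?_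
    have h1 : ∀ a, Measurable fun r : RawMoments p => s (q r) k a := fun a =>
      (by fun_prop : Measurable fun v : EuclideanSpace ℝ (Fin p) => v a).comp
        ((measurable_pi_apply k).comp (hsm.comp hq))
    have h2 : ∀ a b, Measurable fun r : RawMoments p => posInvSqrt r.central2 a b :=
      fun a b => (measurable_pi_apply b).comp ((measurable_pi_apply a).comp hR)
    simp only [f, Matrix.mulVec, dotProduct, Matrix.of_apply]
    exact Finset.measurable_sum _ fun a _ => (h2 l a).mul (h1 a)
  have hsol : ∀ r : RawMoments p, (Matrix.of r.central2).PosDef →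
      f r = fun k => (invSqrt (Matrix.of r.central2)).mulVec (s (q r) k) := fun r hS => by
    ext k
    simp only [f, posInvSqrt_of_posDef hS]
    rfl
  have hGq : ∀ r : RawMoments p, (Matrix.of r.central2).PosDef →
      G (q r) = fun v : EuclideanSpace ℝ (Fin p) =>
          momentIndex α r.central3 r.central4 ((invSqrt (Matrix.of r.central2)).mulVec v) :=
    fun r hS => by
    ext v
    simp only [G, q, posInvSqrt_of_posDef hS]
    rfl
  have hloc : ∀ r : RawMoments p, (Matrix.of r.central2).PosDef →
      ∀ k, IsLocalMaxOn (fun v : EuclideanSpace ℝ (Fin p) =>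
          momentIndex α r.central3 r.central4 ((invSqrt (Matrix.of r.central2)).mulVec v))
          (feasible (s (q r)) k) (s (q r) k) := fun r hS k => by
    rw [← hGq r hS]; exact (hs (q r)).2 k
  refine ⟨f, hfm, fun r hS => ⟨s (q r), (hs (q r)).1, hloc r hS, fun hord k => ?_, hsol r hS⟩, ?_⟩
  · rw [← hGq r hS]; exact hso hord (q r) k
  -- Arbitrary arrays near `r₀` need not have symmetric second moments. With symmetry imposed, those
  -- close to `r₀` have positive definite covariance.
  set l := 𝓝[{r : RawMoments p | (Matrix.of r.central2).transpose = Matrix.of r.central2}] r₀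
  have hl : l ≤ 𝓝 r₀ := nhdsWithin_le_nhds
  have e2 : Matrix.of r₀.central2 = (1 : Matrix (Fin p) (Fin p) ℝ) := by
    ext a b; simp [hr.central2, Matrix.one_apply]
  have hS : Tendsto (fun r : RawMoments p => Matrix.of r.central2) l
      (𝓝[{S | S.transpose = S}] (1 : Matrix (Fin p) (Fin p) ℝ)) := by
    refine tendsto_nhdsWithin_iff.2 ⟨?_, eventually_mem_nhdsWithin⟩
    rw [← e2]
    exact (continuous_central2.tendsto r₀).mono_left hl
  have hpd : ∀ᶠ r in l, (Matrix.of r.central2).PosDef := hS.eventually eventually_posDef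
  have hRt : Tendsto (fun r : RawMoments p => posInvSqrt r.central2) l
      (𝓝 (1 : Matrix (Fin p) (Fin p) ℝ)) := by
    have h1 : Tendsto (fun r : RawMoments p => Matrix.of r.central2) l
        (𝓝[{S | S.PosDef}] (1 : Matrix (Fin p) (Fin p) ℝ)) :=
      tendsto_nhdsWithin_iff.2 ⟨hS.mono_right nhdsWithin_le_nhds, hpd⟩
    have h2 := (continuousOn_invSqrt (p := p) 1 Matrix.PosDef.one).tendsto.comp h1
    rw [invSqrt_one] at h2
    refine Tendsto.congr' ?_ h2
    filter_upwards [hpd] with r hr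
    exact (posInvSqrt_of_posDef hr).symm
  have hqt : Tendsto q l (𝓝 q₀) := by
    refine Tendsto.prodMk_nhds ?_ (Tendsto.prodMk_nhds ?_ hRt)
    · have := (continuous_central3.tendsto r₀).mono_left hl
      rwa [hr.central3] at this
    · have := (continuous_central4.tendsto r₀).mono_left hl
      rwa [hr.central4] at this
  have hft : Tendsto f l (𝓝 (coordRows hd)) := by
    refine tendsto_pi_nhds.2 fun k => ?_
    have h1 := tendsto_pi_nhds.1 (hst.comp hqt) k
    have h2 : Continuous fun x : (Fin p → Fin p → ℝ) × EuclideanSpace ℝ (Fin p) =>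
        (Matrix.of x.1).mulVec x.2 :=
      Continuous.matrix_mulVec (A := fun x : (Fin p → Fin p → ℝ) × EuclideanSpace ℝ (Fin p) =>
        Matrix.of x.1) (B := fun x => x.2.ofLp) continuous_fst (by fun_prop)
    have h3 := (h2.tendsto ((1 : Matrix (Fin p) (Fin p) ℝ),
      EuclideanSpace.single (Fin.castLE hd k) 1)).comp (hRt.prodMk_nhds h1)
    have h4 : (Matrix.of (1 : Matrix (Fin p) (Fin p) ℝ)).mulVec
        (EuclideanSpace.single (Fin.castLE hd k) (1 : ℝ)).ofLp = coordRows hd k :=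
      Matrix.one_mulVec _
    simp only [h4] at h3
    exact h3
  have hc : ∀ k : Fin d, curvature α γ κ (Fin.castLE hd k) ≠ 0 := fun k =>
    curvature_ne_zero hα (hpos k)
  have hFf : ∀ i, ∀ᶠ r in l, equations hd α i (r, f r) = 0 := fun i => by
    filter_upwards [hpd] with r hS
    rw [hsol r hS]
    exact equations_rows hd α hS (hs (q r)).1 (hloc r hS) i
  -- The equations hold along `l` and `f` tends to the coordinate vectors, so they hold at the base
  -- point by continuity, without computation.
  have hF₀ : ∀ i, equations hd α i (r₀, coordRows hd) = 0 := fun i => by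
    have hcont := (differentiable_equations hd α i).continuous.tendsto (r₀, coordRows hd)
    have hne : l.NeBot := by
      refine mem_closure_iff_nhdsWithin_neBot.1 (subset_closure ?_)
      simp [e2]
    have h1 : Tendsto (fun r => equations hd α i (r, f r)) l
        (𝓝 (equations hd α i (r₀, coordRows hd))) :=
      hcont.comp ((show Tendsto (fun r => r) l (𝓝 r₀) from hl).prodMk_nhds hft)
    exact tendsto_nhds_unique (h1.congr' (hFf i)) tendsto_const_nhds
  exact isLittleO_of_implicit (fun i => (differentiable_equations hd α i) _)
    (fun i δ h => hasDerivAt_equations hd α hr i δ h) (rowsDeriv hd α γ κ)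
    (linearized_rowsDeriv hd hc) (fun h hh => eq_zero_of_linearized hd hc hh) hl hft hF₀ hFf

end Functional

end

end SignalSeparation

namespace SignalSeparation

noncomputable section

/-! ### Limit theorems for sample means and the delta method. -/

section Limit

variable {Ω Ω₀ : Type*} [MeasurableSpace Ω] [MeasurableSpace Ω₀] {P : Measure Ω} {P₀ : Measure Ω₀}
  {ι κ : Type*} [Fintype ι] [Fintype κ]


theorem memLp_sum_mul {U : Ω₀ → κ → ℝ} (hU : ∀ a, MemLp (fun ω => U ω a) 2 P₀)
    (t : κ → ℝ) : MemLp (fun ω => ∑ a, t a * U ω a) 2 P₀ :=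
  memLp_finsetSum _ fun a _ => (hU a).const_mul (t a)

theorem clm_apply_eq_sum {τ : Type*} [DecidableEq ι] (L : (ι → ℝ) →L[ℝ] EuclideanSpace ℝ τ) (x : ι → ℝ)
    (a : τ) : L x a = ∑ i, L (Pi.single i 1) a * x i := by
  conv_lhs => rw [← Finset.univ_sum_single x, map_sum]
  rw [WithLp.ofLp_sum, Finset.sum_apply]
  refine Finset.sum_congr rfl fun i _ => ?_
  have : Pi.single i (x i) = x i • (Pi.single i 1 : ι → ℝ) := by
    rw [← Pi.single_smul, smul_eq_mul, mul_one]
  rw [this, map_smul, WithLp.ofLp_smul, Pi.smul_apply, smul_eq_mul, mul_comm]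

theorem memLp_clm_apply {τ : Type*} (L : (ι → ℝ) →L[ℝ] EuclideanSpace ℝ τ) {U : Ω₀ → ι → ℝ}
    (hU : ∀ a, MemLp (fun ω => U ω a) 2 P₀) (a : τ) : MemLp (fun ω => L (U ω) a) 2 P₀ := by
  classical
  simp only [fun ω => clm_apply_eq_sum L (U ω) a]
  exact memLp_sum_mul hU _

theorem variance_sum_mul [IsFiniteMeasure P₀] {U : Ω₀ → κ → ℝ} (hU : ∀ a, MemLp (fun ω => U ω a) 2 P₀)
    (t : κ → ℝ) : Var[fun ω => ∑ a, t a * U ω a; P₀] =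
      t ⬝ᵥ (Matrix.of fun a b => cov[fun ω => U ω a, fun ω => U ω b; P₀]).mulVec t := by
  rw [← covariance_self (memLp_sum_mul hU t).aemeasurable,
    covariance_fun_sum_fun_sum (fun a => (hU a).const_mul (t a)) fun a => (hU a).const_mul (t a)]
  simp only [dotProduct, Matrix.mulVec, Matrix.of_apply, Finset.mul_sum]
  refine Finset.sum_congr rfl fun a _ => Finset.sum_congr rfl fun b _ => ?_
  rw [covariance_const_mul_left, covariance_const_mul_right]
  ring

theorem posSemidef_covariance [IsFiniteMeasure P₀] {U : Ω₀ → κ → ℝ} (hU : ∀ a, MemLp (fun ω => U ω a) 2 P₀) :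
    (Matrix.of fun a b => cov[fun ω => U ω a, fun ω => U ω b; P₀]).PosSemidef := by
  refine .of_dotProduct_mulVec_nonneg ?_ fun t => ?_
  · ext a b
    simp [covariance_comm]
  · rw [star_trivial, ← variance_sum_mul hU]
    exact variance_nonneg _ _

/-- The central limit theorem for random vectors. -/
theorem tendstoInDistribution_inv_sqrt_smul_sum [IsProbabilityMeasure P]
    [IsProbabilityMeasure P₀] [DecidableEq κ] {U : ℕ → Ω → EuclideanSpace ℝ κ}
    {U₀ : Ω₀ → EuclideanSpace ℝ κ} (hindep : iIndepFun U P)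
    (hident : ∀ i, IdentDistrib (U i) U₀ P P₀) (hU : ∀ a, MemLp (fun ω => U₀ ω a) 2 P₀)
    (h0 : ∀ a, ∫ ω, U₀ ω a ∂P₀ = 0) :
    TendstoInDistribution (fun (n : ℕ) ω => (√(n : ℝ))⁻¹ • ∑ i ∈ Finset.range n, U i ω) atTop id
      (fun _ => P) (multivariateGaussian 0
        (Matrix.of fun a b => cov[fun ω => U₀ ω a, fun ω => U₀ ω b; P₀])) where
  forall_aemeasurable n := by
    have := fun i => (hident i).aemeasurable_fst
    fun_prop
  tendsto := by
    have hm := fun i => (hident i).aemeasurable_fst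
    refine ProbabilityMeasure.tendsto_iff_tendsto_charFun.2 fun t => ?_
    have hV := posSemidef_covariance hU
    -- Cramér-Wold: the characteristic function of the vector sum at t is that of the scalar sum of
    -- the φ-images at 1, where the real central limit theorem applies.
    let φ : EuclideanSpace ℝ κ → ℝ := fun x => ∑ a, t a * x a
    have hφ : Measurable φ := by fun_prop
    have hY₀ : MemLp (φ ∘ U₀) 2 P₀ := memLp_sum_mul hU t
    have hYi : ∀ i, IdentDistrib (φ ∘ U i) (φ ∘ U₀) P P₀ := fun i => (hident i).comp hφ
    have hclt := tendstoInDistribution_inv_sqrt_mul_sum_sub (P := P)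
      (X := fun i => φ ∘ U i) (Y := id)
      (P' := gaussianReal 0 Var[φ ∘ U 0; P].toNNReal) HasLaw.id
      ((hYi 0).memLp_iff.2 hY₀) (hindep.comp (fun _ => φ) fun _ => hφ)
      fun i => (hYi i).trans (hYi 0).symm
    have hmean : P[φ ∘ U 0] = 0 := by
      rw [(hYi 0).integral_eq]
      simp only [φ, Function.comp_apply]
      rw [integral_finsetSum _ fun a _ => ((hU a).integrable one_le_two).const_mul (t a)]
      simp [integral_const_mul, h0]
    have hvar : Var[φ ∘ U 0; P] = t ⬝ᵥ (Matrix.of fun a b =>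
        cov[fun ω => U₀ ω a, fun ω => U₀ ω b; P₀]).mulVec t := by
      rw [(hYi 0).variance_eq, ← variance_sum_mul hU]; rfl
    have h1 := ProbabilityMeasure.tendsto_iff_tendsto_charFun.1 hclt.tendsto 1
    simp only [ProbabilityMeasure.coe_mk, Measure.map_id, charFun_gaussianReal, hmean] at h1 ⊢
    rw [charFun_multivariateGaussian hV]
    have hnn : (0 : ℝ) ≤ Var[φ ∘ U 0; P] := variance_nonneg _ _
    rw [Real.coe_toNNReal _ hnn, hvar] at h1
    convert h1 using 2 with n
    · have hmY : AEMeasurable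
          (fun ω => (√(n : ℝ))⁻¹ * (∑ k ∈ Finset.range n, (φ ∘ U k) ω - n * 0)) P :=
        ((Finset.aemeasurable_fun_sum _ fun i _ => (hYi i).aemeasurable_fst).sub_const _).const_mul _
      rw [charFun_apply, charFun_apply, integral_map (by fun_prop) (by fun_prop),
        integral_map hmY (by fun_prop)]
      congr 1
      ext ω
      congr 3
      rw [inner_smul_left, sum_inner]
      simp [φ, PiLp.inner_apply]
    · simp

/-- Chebyshev's inequality for the mean of a random sample. -/
theorem measureReal_mean_sub_ge_le [IsProbabilityMeasure P] {Y : ℕ → Ω → ℝ} {Y₀ : Ω₀ → ℝ}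
    (hindep : iIndepFun Y P) (hident : ∀ i, IdentDistrib (Y i) Y₀ P P₀) (hY₀ : MemLp Y₀ 2 P₀)
    {n : ℕ} (hn : n ≠ 0) {c : ℝ} (hc : 0 < c) :
    P.real {ω | c ≤ |mean n (fun j => Y j ω) - ∫ ω, Y₀ ω ∂P₀|} ≤ Var[Y₀; P₀] / (n * c ^ 2) := by
  have hY : ∀ i, MemLp (Y i) 2 P := fun i => (hident i).memLp_iff.2 hY₀
  have hn' : (n : ℝ) ≠ 0 := Nat.cast_ne_zero.2 hn
  set T : Ω → ℝ := fun ω => mean n fun j => Y j ω with hT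
  have hTe : T = fun ω => (n : ℝ)⁻¹ * (∑ i ∈ Finset.range n, Y i) ω := by
    ext ω; simp [hT, mean_apply]
  have hS : MemLp (∑ i ∈ Finset.range n, Y i) 2 P := memLp_finsetSum' _ fun i _ => hY i
  have hTm : MemLp T 2 P := by rw [hTe]; exact hS.const_mul _
  have hint : ∫ ω, T ω ∂P = ∫ ω, Y₀ ω ∂P₀ := by
    rw [hTe, integral_const_mul]
    simp only [Finset.sum_apply]
    rw [integral_finsetSum _ fun i _ => (hY i).integrable one_le_two]
    simp only [fun i => (hident i).integral_eq]
    simp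
    field_simp
  have hvar : Var[T; P] = Var[Y₀; P₀] / n := by
    rw [hTe, variance_const_mul, IndepFun.variance_sum (fun i _ => hY i)
      fun i _ j _ hij => hindep.indepFun hij]
    simp only [fun i => (hident i).variance_eq]
    simp
    field_simp
  have h := meas_ge_le_variance_div_sq hTm hc
  rw [hint, hvar] at h
  have hnn : 0 ≤ Var[Y₀; P₀] / n / c ^ 2 := by
    have := variance_nonneg Y₀ P₀
    positivity
  calc _ ≤ (ENNReal.ofReal (Var[Y₀; P₀] / n / c ^ 2)).toReal :=
        ENNReal.toReal_mono ENNReal.ofReal_ne_top h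
    _ = _ := by rw [ENNReal.toReal_ofReal hnn, div_div]

/-- Chebyshev's inequality for the mean of a random sample of vectors. -/
theorem measureReal_norm_mean_sub_ge_le [IsProbabilityMeasure P] {Y : ℕ → Ω → ι → ℝ}
    {Y₀ : Ω₀ → ι → ℝ} (hindep : iIndepFun Y P) (hident : ∀ i, IdentDistrib (Y i) Y₀ P P₀)
    (hY₀ : ∀ i, MemLp (fun ω => Y₀ ω i) 2 P₀) {n : ℕ} (hn : n ≠ 0) {c : ℝ} (hc : 0 < c) :
    P.real {ω | c ≤ ‖(fun i => mean n fun j => Y j ω i) - fun i => ∫ ω, Y₀ ω i ∂P₀‖} ≤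
      (∑ i, Var[fun ω => Y₀ ω i; P₀]) / (n * c ^ 2) := by
  have hsub : {ω | c ≤ ‖(fun i => mean n fun j => Y j ω i) - fun i => ∫ ω, Y₀ ω i ∂P₀‖} ⊆
      ⋃ i ∈ Finset.univ, {ω | c ≤ |mean n (fun j => Y j ω i) - ∫ ω, Y₀ ω i ∂P₀|} := by
    intro ω hω
    by_contra hcon
    simp only [Finset.mem_univ, Set.iUnion_true, Set.mem_iUnion, Set.mem_ofPred_eq, not_exists,
      not_le] at hcon
    exact absurd hω (not_le.2 ((pi_norm_lt_iff hc).2 fun i => hcon i))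
  calc _ ≤ _ := measureReal_mono hsub (measure_ne_top _ _)
    _ ≤ _ := measureReal_biUnion_finset_le _ _
    _ ≤ ∑ i, Var[fun ω => Y₀ ω i; P₀] / (n * c ^ 2) := Finset.sum_le_sum fun i _ =>
        measureReal_mean_sub_ge_le
          (hindep.comp (fun _ y => y i) fun _ => measurable_pi_apply i)
          (fun j => (hident j).comp (measurable_pi_apply i)) (hY₀ i) hn hc
    _ = _ := by rw [Finset.sum_div]

/-- Consistency of a function of means that is continuous at the population values. -/
theorem tendstoInMeasure_mean [IsProbabilityMeasure P]
    {Y : ℕ → Ω → ι → ℝ} {Y₀ : Ω₀ → ι → ℝ} (hindep : iIndepFun Y P)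
    (hident : ∀ i, IdentDistrib (Y i) Y₀ P P₀) (hY₀ : ∀ i, MemLp (fun ω => Y₀ ω i) 2 P₀)
    {S : Set (ι → ℝ)} (hS : ∀ n ω, (fun i => mean n fun j => Y j ω i) ∈ S)
    {F : Type*} [SeminormedAddCommGroup F] {g : (ι → ℝ) → F} {y₀ : F}
    (hg : Tendsto g (𝓝[S] fun i => ∫ ω, Y₀ ω i ∂P₀) (𝓝 y₀)) :
    TendstoInMeasure P (fun n ω => g fun i => mean n fun j => Y j ω i) atTop fun _ => y₀ := by
  set m : ι → ℝ := fun i => ∫ ω, Y₀ ω i ∂P₀ with hm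
  rw [tendstoInMeasure_iff_measureReal_norm]
  intro ε hε
  obtain ⟨δ, hδ, hδg⟩ := Metric.tendsto_nhdsWithin_nhds.1 hg ε hε
  refine squeeze_zero' (Eventually.of_forall fun n => measureReal_nonneg)
    (g := fun n : ℕ => (∑ i, Var[fun ω => Y₀ ω i; P₀]) / δ ^ 2 / n) ?_
    (tendsto_const_div_atTop_nhds_zero_nat _)
  filter_upwards [eventually_ne_atTop 0] with n hn
  have h := measureReal_norm_mean_sub_ge_le hindep hident hY₀ hn hδ
  rw [div_div, mul_comm (δ ^ 2)]
  refine le_trans (measureReal_mono fun ω hω => ?_) h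
  by_contra hcon
  have h1 := hδg (hS n ω) (by rw [dist_eq_norm]; exact not_le.1 hcon)
  rw [dist_eq_norm] at h1
  exact absurd hω (not_le.2 h1)

open Asymptotics in
/-- The remainder of a first-order expansion is negligible. -/
theorem tendstoInMeasure_sqrt_smul_remainder [IsProbabilityMeasure P]
    {Y : ℕ → Ω → ι → ℝ} {Y₀ : Ω₀ → ι → ℝ} (hindep : iIndepFun Y P)
    (hident : ∀ i, IdentDistrib (Y i) Y₀ P P₀) (hY₀ : ∀ i, MemLp (fun ω => Y₀ ω i) 2 P₀)
    {S : Set (ι → ℝ)} (hS : ∀ n ω, (fun i => mean n fun j => Y j ω i) ∈ S)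
    {F : Type*} [SeminormedAddCommGroup F]
    [NormedSpace ℝ F] {g : (ι → ℝ) → F}
    (hg : g =o[𝓝[S] fun i => ∫ ω, Y₀ ω i ∂P₀] fun r => r - fun i => ∫ ω, Y₀ ω i ∂P₀) :
    TendstoInMeasure P (fun (n : ℕ) ω => √(n : ℝ) • g fun i => mean n fun j => Y j ω i) atTop
      0 := by
  set m : ι → ℝ := fun i => ∫ ω, Y₀ ω i ∂P₀ with hm
  set C := ∑ i, Var[fun ω => Y₀ ω i; P₀] with hC
  have hC0 : 0 ≤ C := Finset.sum_nonneg fun i _ => variance_nonneg _ _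
  rw [tendstoInMeasure_iff_measureReal_norm]
  intro ε hε
  rw [Metric.tendsto_atTop]
  intro η hη
  -- Where the remainder is at most c ‖r - m‖, Chebyshev bounds the probability that √n times it
  -- reaches ε by C c²/ε², uniformly in n. The constant c is chosen first, and then n so large that
  -- the mean leaves that neighbourhood with probability below η/2.
  obtain ⟨c, hc, hcη⟩ : ∃ c : ℝ, 0 < c ∧ C * c ^ 2 / ε ^ 2 < η / 2 := by
    have h1 : Tendsto (fun c : ℝ => C * c ^ 2 / ε ^ 2) (𝓝[>] 0) (𝓝 0) := by
      have : Continuous fun c : ℝ => C * c ^ 2 / ε ^ 2 := by fun_prop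
      have := (this.tendsto 0).mono_left (nhdsWithin_le_nhds (s := Set.Ioi 0))
      simpa using this
    obtain ⟨c, h2, h3⟩ := ((h1.eventually (gt_mem_nhds (half_pos hη))).and
      self_mem_nhdsWithin).exists
    exact ⟨c, h3, h2⟩
  have hb := hg.bound hc
  rw [eventually_nhdsWithin_iff, Metric.eventually_nhds_iff] at hb
  obtain ⟨δ, hδ, hδg⟩ := hb
  have hlim : ∀ᶠ n : ℕ in atTop, C / δ ^ 2 / n < η / 2 :=
    (tendsto_const_div_atTop_nhds_zero_nat _).eventually (gt_mem_nhds (half_pos hη))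
  obtain ⟨N, hN⟩ := eventually_atTop.1 (hlim.and (eventually_ne_atTop 0))
  refine ⟨N, fun n hn => ?_⟩
  obtain ⟨hn1, hn0⟩ := hN n hn
  have hnpos : (0 : ℝ) < n := Nat.cast_pos.2 (Nat.pos_of_ne_zero hn0)
  have hsn : 0 < √(n : ℝ) := Real.sqrt_pos.2 hnpos
  have hpos : 0 < ε / (c * √(n : ℝ)) := by positivity
  have h1 := measureReal_norm_mean_sub_ge_le hindep hident hY₀ hn0 hδ
  have h2 := measureReal_norm_mean_sub_ge_le hindep hident hY₀ hn0 hpos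
  have e2 : C / (n * (ε / (c * √(n : ℝ))) ^ 2) = C * c ^ 2 / ε ^ 2 := by
    rw [div_pow, mul_pow, Real.sq_sqrt hnpos.le]
    field_simp
  rw [← hC, ← hm, e2] at h2
  rw [← hC, ← hm, mul_comm (n : ℝ), ← div_div] at h1
  have hsub : {ω | ε ≤ ‖(√(n : ℝ) • g fun i => mean n fun j => Y j ω i) - (0 : Ω → F) ω‖} ⊆
      {ω | δ ≤ ‖(fun i => mean n fun j => Y j ω i) - m‖} ∪
        {ω | ε / (c * √(n : ℝ)) ≤ ‖(fun i => mean n fun j => Y j ω i) - m‖} := by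
    intro ω hω
    by_cases hω1 : δ ≤ ‖(fun i => mean n fun j => Y j ω i) - m‖
    · exact Or.inl hω1
    · right
      have h3 := hδg (by rw [dist_eq_norm]; exact not_le.1 hω1) (hS n ω)
      simp only [Set.mem_ofPred_eq, Pi.zero_apply, sub_zero, norm_smul, Real.norm_eq_abs,
        abs_of_pos hsn] at hω
      rw [Set.mem_ofPred_eq, div_le_iff₀ (by positivity)]
      calc ε ≤ _ := hω
        _ ≤ √(n : ℝ) * (c * ‖(fun i => mean n fun j => Y j ω i) - m‖) := by gcongr
        _ = _ := by ring
  rw [Real.dist_eq, sub_zero, abs_of_nonneg measureReal_nonneg]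
  calc _ ≤ _ := measureReal_mono hsub (measure_ne_top _ _)
    _ ≤ _ := measureReal_union_le _ _
    _ < η := by linarith

open Asymptotics in
/-- The delta method. -/
theorem tendstoInDistribution_sqrt_smul_sub [IsProbabilityMeasure P]
    [IsProbabilityMeasure P₀] [DecidableEq κ]
    {Y : ℕ → Ω → ι → ℝ} {Y₀ : Ω₀ → ι → ℝ} (hindep : iIndepFun Y P)
    (hident : ∀ i, IdentDistrib (Y i) Y₀ P P₀) (hY₀ : ∀ i, MemLp (fun ω => Y₀ ω i) 2 P₀)
    {S : Set (ι → ℝ)} (hS : ∀ n ω, (fun i => mean n fun j => Y j ω i) ∈ S)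
    {g : (ι → ℝ) → EuclideanSpace ℝ κ} (hgm : Measurable g) {y₀ : EuclideanSpace ℝ κ}
    (L : (ι → ℝ) →L[ℝ] EuclideanSpace ℝ κ)
    (hg : (fun r => g r - y₀ - L (r - fun i => ∫ ω, Y₀ ω i ∂P₀))
      =o[𝓝[S] fun i => ∫ ω, Y₀ ω i ∂P₀] fun r => r - fun i => ∫ ω, Y₀ ω i ∂P₀) :
    TendstoInDistribution
      (fun (n : ℕ) ω => √(n : ℝ) • (g (fun i => mean n fun j => Y j ω i) - y₀)) atTop id
      (fun _ => P) (multivariateGaussian 0 (Matrix.of fun a b =>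
        cov[fun ω => L (Y₀ ω - fun i => ∫ ω, Y₀ ω i ∂P₀) a,
          fun ω => L (Y₀ ω - fun i => ∫ ω, Y₀ ω i ∂P₀) b; P₀])) := by
  set m : ι → ℝ := fun i => ∫ ω, Y₀ ω i ∂P₀ with hm
  let φ : (ι → ℝ) → EuclideanSpace ℝ κ := fun y => L (y - m)
  have hφ : Measurable φ := L.continuous.measurable.comp (measurable_id.sub_const m)
  have hYm := fun i => (hident i).aemeasurable_fst
  have hmc : ∀ i, MemLp (fun ω => (Y₀ ω - m) i) 2 P₀ := fun i => (hY₀ i).sub (memLp_const _)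
  have hU₀ : ∀ a, MemLp (fun ω => φ (Y₀ ω) a) 2 P₀ := fun a => memLp_clm_apply L hmc a
  have h0 : ∀ a, ∫ ω, φ (Y₀ ω) a ∂P₀ = 0 := fun a => by
    classical
    have hφa : ∀ ω, φ (Y₀ ω) a = _ := fun ω => clm_apply_eq_sum L _ a
    simp only [hφa]
    rw [integral_finsetSum _ fun i _ => ((hmc i).integrable one_le_two).const_mul _]
    refine Finset.sum_eq_zero fun i _ => ?_
    rw [integral_const_mul]
    have : ∫ ω, (Y₀ ω - m) i ∂P₀ = 0 := by
      simp only [Pi.sub_apply]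
      rw [integral_sub ((hY₀ i).integrable one_le_two) (integrable_const _)]
      simp [hm]
    rw [this, mul_zero]
  have hclt := tendstoInDistribution_inv_sqrt_smul_sum (U := fun i => φ ∘ Y i) (U₀ := φ ∘ Y₀)
    (hindep.comp (fun _ => φ) fun _ => hφ) (fun i => (hident i).comp hφ) hU₀ h0
  -- Slutsky: the scaled error and its linear part, a normalized sum of centered independent
  -- vectors, differ by √n times the remainder.
  refine tendstoInDistribution_of_tendstoInMeasure_sub _ _ hclt ?_ fun n => ?_
  · have hrem := tendstoInMeasure_sqrt_smul_remainder hindep hident hY₀ hS hg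
    refine hrem.congr_left fun n => Eventually.of_forall fun ω => ?_
    have hmeanL : (√(n : ℝ))⁻¹ • ∑ i ∈ Finset.range n, φ (Y i ω) =
        √(n : ℝ) • L ((fun i => mean n fun j => Y j ω i) - m) := by
      rcases Nat.eq_zero_or_pos n with rfl | hn
      · simp
      · have hnpos : (0 : ℝ) < n := Nat.cast_pos.2 hn
        have hsn : 0 < √(n : ℝ) := Real.sqrt_pos.2 hnpos
        have h1 : (fun i => mean n fun j => Y j ω i) - m =
            (n : ℝ)⁻¹ • ∑ j ∈ Finset.range n, (Y j ω - m) := by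
          ext i
          simp only [Pi.sub_apply, Pi.smul_apply, Finset.sum_apply, smul_eq_mul,
            Finset.sum_sub_distrib, mean_apply, Finset.sum_const, Finset.card_range, nsmul_eq_mul]
          field_simp
          simp
        rw [h1, map_smul, map_sum, smul_smul]
        congr 1
        rw [← Real.sqrt_div_self, div_eq_mul_inv]
    simp only [Pi.sub_apply, Function.comp_apply, hmeanL]
    rw [smul_sub, smul_sub]
  · have h1 : AEMeasurable (fun ω i => mean n fun j => Y j ω i) P := by
      refine aemeasurable_pi_iff.2 fun i => ?_
      simp only [mean_apply]
      exact (Finset.aemeasurable_fun_sum _ fun j _ =>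
        (measurable_pi_apply i).comp_aemeasurable (hYm j)).const_mul _
    have h2 : AEMeasurable (fun ω => g fun i => mean n fun j => Y j ω i) P :=
      hgm.comp_aemeasurable h1
    have h3 : Measurable fun y : EuclideanSpace ℝ κ => √(n : ℝ) • (y - y₀) := by fun_prop
    exact h3.comp_aemeasurable h2

end Limit

end

end SignalSeparation

namespace SignalSeparation

noncomputable section

/-! ### Third and fourth moments of the noise. -/

section GaussianMoments

/-- These derivatives of the standard normal moment generating function are its moments. Each
differentiation turns a factor q into q' + t q in front of the exponential. -/
theorem iteratedDeriv_mgf_gaussianReal_three_four :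
    iteratedDeriv 3 (fun t : ℝ => Real.exp (t ^ 2 / 2)) 0 = 0 ∧
      iteratedDeriv 4 (fun t : ℝ => Real.exp (t ^ 2 / 2)) 0 = 3 := by
  have key : ∀ (q q' : ℝ → ℝ), (∀ t, HasDerivAt q (q' t) t) →
      deriv (fun t => q t * Real.exp (t ^ 2 / 2)) =
        fun t => (q' t + t * q t) * Real.exp (t ^ 2 / 2) := by
    intro q q' hq
    ext t
    have h1 : HasDerivAt (fun t : ℝ => t ^ 2 / 2) t t := by
      have := ((hasDerivAt_id t).pow 2).div_const 2
      refine this.congr_deriv ?_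
      simp
    rw [((hq t).fun_mul h1.exp).deriv]
    ring
  have e1 : deriv (fun t : ℝ => Real.exp (t ^ 2 / 2)) = fun t => t * Real.exp (t ^ 2 / 2) := by
    have := key (fun _ => 1) (fun _ => 0) fun t => hasDerivAt_const t 1
    simpa using this
  have e2 := key (fun t => t) (fun _ => 1) fun t => hasDerivAt_id t
  have e3 := key (fun t => 1 + t * t) (fun t => 2 * t) fun t => by
    refine (((hasDerivAt_id t).mul (hasDerivAt_id t)).const_add 1).congr_deriv ?_
    simp; ring
  have e4 := key (fun t => 2 * t + t * (1 + t * t)) (fun t => 3 + 3 * t ^ 2) fun t => by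
    have h1 := ((hasDerivAt_id t).mul (hasDerivAt_id t)).const_add 1
    refine (((hasDerivAt_id t).const_mul 2).add ((hasDerivAt_id t).mul h1)).congr_deriv ?_
    simp; ring
  have i3 : iteratedDeriv 3 (fun t : ℝ => Real.exp (t ^ 2 / 2)) =
      fun t => (2 * t + t * (1 + t * t)) * Real.exp (t ^ 2 / 2) := by
    rw [iteratedDeriv_succ, iteratedDeriv_succ, iteratedDeriv_one, e1, e2, e3]
  constructor
  · rw [i3]; simp
  · rw [iteratedDeriv_succ, i3, e4]; simp

theorem integral_pow_three_gaussianReal : ∫ x, x ^ 3 ∂gaussianReal 0 1 = 0 := by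
  have h := iteratedDeriv_mgf_zero (X := fun x => x) (μ := gaussianReal 0 1) (by simp) 3
  rw [mgf_fun_id_gaussianReal] at h
  simp only [zero_mul, zero_add, NNReal.coe_one, one_mul,
    iteratedDeriv_mgf_gaussianReal_three_four.1] at h
  exact h.symm

theorem integral_pow_four_gaussianReal : ∫ x, x ^ 4 ∂gaussianReal 0 1 = 3 := by
  have h := iteratedDeriv_mgf_zero (X := fun x => x) (μ := gaussianReal 0 1) (by simp) 4
  rw [mgf_fun_id_gaussianReal] at h
  simp only [zero_mul, zero_add, NNReal.coe_one, one_mul,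
    iteratedDeriv_mgf_gaussianReal_three_four.2] at h
  exact h.symm

variable {Ω₀ : Type*} [MeasurableSpace Ω₀] {P₀ : Measure Ω₀} {X : Ω₀ → ℝ}

theorem map_eq_gaussianReal_zero_one [IsProbabilityMeasure P₀] (hX : HasGaussianLaw X P₀)
    (h0 : ∫ ω, X ω ∂P₀ = 0) (h1 : ∫ ω, X ω ^ 2 ∂P₀ = 1) : P₀.map X = gaussianReal 0 1 := by
  rw [hX.map_eq_gaussianReal, variance_of_integral_eq_zero hX.aemeasurable h0, h0]
  congr 1
  simp [h1]

theorem mGamma_of_gaussian [IsProbabilityMeasure P₀] (hX : HasGaussianLaw X P₀)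
    (h0 : ∫ ω, X ω ∂P₀ = 0) (h1 : ∫ ω, X ω ^ 2 ∂P₀ = 1) : mGamma X P₀ = 0 := by
  rw [mGamma, ← integral_pow_three_gaussianReal, ← map_eq_gaussianReal_zero_one hX h0 h1,
    integral_map hX.aemeasurable (by fun_prop)]

theorem mKappa_of_gaussian [IsProbabilityMeasure P₀] (hX : HasGaussianLaw X P₀)
    (h0 : ∫ ω, X ω ∂P₀ = 0) (h1 : ∫ ω, X ω ^ 2 ∂P₀ = 1) : mKappa X P₀ = 0 := by
  rw [mKappa, sub_eq_zero, ← integral_pow_four_gaussianReal,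
    ← map_eq_gaussianReal_zero_one hX h0 h1, integral_map hX.aemeasurable (by fun_prop)]

end GaussianMoments

/-! ### Population moments of independent components. -/

section Population

variable {Ω₀ : Type*} [MeasurableSpace Ω₀] {P₀ : Measure Ω₀} {p : ℕ}
  {z : Ω₀ → EuclideanSpace ℝ (Fin p)}

/-- Hölder's inequality applied twice, from exponent 8 to 4 and from 4 to 2. This is where eighth
moments are needed: the sample fourth moments must have finite variances. -/
theorem memLp_monomials [IsProbabilityMeasure P₀] (hmom : ∀ k, MemLp (fun ω => z ω k) 8 P₀)
    (i : Option (Fin p) × Option (Fin p) × Option (Fin p) × Option (Fin p)) :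
    MemLp (fun ω => monomials (z ω) i) 2 P₀ := by
  have h8 : ∀ o : Option (Fin p), MemLp (fun ω => homCoord (z ω) o) 8 P₀ := fun o => by
    cases o with
    | none => exact memLp_const 1
    | some a => exact hmom a
  have t1 : ENNReal.HolderTriple 8 8 4 := ⟨by
    rw [← two_mul, show (8 : ENNReal) = 2 * 4 by norm_num,
      ENNReal.mul_inv (by simp) (by simp), ← mul_assoc,
      ENNReal.mul_inv_cancel (by simp) (by simp), one_mul]⟩
  have t2 : ENNReal.HolderTriple 4 4 2 := ⟨by
    rw [← two_mul, show (4 : ENNReal) = 2 * 2 by norm_num,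
      ENNReal.mul_inv (by simp) (by simp), ← mul_assoc,
      ENNReal.mul_inv_cancel (by simp) (by simp), one_mul]⟩
  have h1 : MemLp (fun ω => homCoord (z ω) i.1 * homCoord (z ω) i.2.1) 4 P₀ :=
    (h8 i.2.1).mul (h8 i.1)
  have h2 : MemLp (fun ω => homCoord (z ω) i.2.2.1 * homCoord (z ω) i.2.2.2) 4 P₀ :=
    (h8 i.2.2.2).mul (h8 i.2.2.1)
  have h3 : MemLp (fun ω => (homCoord (z ω) i.1 * homCoord (z ω) i.2.1) *
      (homCoord (z ω) i.2.2.1 * homCoord (z ω) i.2.2.2)) 2 P₀ := h2.mul h1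
  simpa only [monomials, mul_assoc] using h3

/-- Multiplicities of the indices in a quadruple. -/
def multiplicity (i : Option (Fin p) × Option (Fin p) × Option (Fin p) × Option (Fin p))
    (b : Fin p) : ℕ :=
  (if i.1 = some b then 1 else 0) + (if i.2.1 = some b then 1 else 0) +
    (if i.2.2.1 = some b then 1 else 0) + (if i.2.2.2 = some b then 1 else 0)

theorem homCoord_eq_prod (v : EuclideanSpace ℝ (Fin p)) (o : Option (Fin p)) :
    homCoord v o = ∏ b, v b ^ (if o = some b then 1 else 0) := by
  cases o with
  | none => simp [homCoord]
  | some a => 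
    rw [Finset.prod_eq_single a]
    · simp [homCoord]
    · intro b _ hb; simp [hb.symm]
    · simp

theorem integral_monomials (hindep : iIndepFun (fun (k : Fin p) ω => z ω k) P₀)
    (hm : ∀ k, AEMeasurable (fun ω => z ω k) P₀)
    (i : Option (Fin p) × Option (Fin p) × Option (Fin p) × Option (Fin p)) :
    ∫ ω, monomials (z ω) i ∂P₀ = ∏ b, ∫ ω, z ω b ^ multiplicity i b ∂P₀ := by
  have h := hindep.integral_fun_prod_comp (f := fun b (x : ℝ) => x ^ multiplicity i b) hm
    fun b => by fun_prop
  rw [← h]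
  congr 1
  ext ω
  simp only [monomials, homCoord_eq_prod, multiplicity, pow_add, Finset.prod_mul_distrib]

/-- By independence the expectation of a monomial is a product over the components. A component that
occurs once contributes 0, one that occurs twice contributes 1, and only a single component
occurring three or four times leaves γ or κ + 3. -/
theorem isIndep_integral_monomials [IsProbabilityMeasure P₀]
    (hindep : iIndepFun (fun (k : Fin p) ω => z ω k) P₀)
    (hm : ∀ k, AEMeasurable (fun ω => z ω k) P₀)
    (h1 : ∀ k, ∫ ω, z ω k ∂P₀ = 0) (h2 : ∀ k, ∫ ω, z ω k ^ 2 ∂P₀ = 1) :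
    RawMoments.IsIndep (fun i => ∫ ω, monomials (z ω) i ∂P₀) (fun k => mGamma (fun ω => z ω k) P₀)
      (fun k => mKappa (fun ω => z ω k) P₀) := by
  have hzero : ∀ (i : Option (Fin p) × Option (Fin p) × Option (Fin p) × Option (Fin p)) (b),
      multiplicity i b = 1 → ∫ ω, monomials (z ω) i ∂P₀ = 0 := fun i b hb => by
    rw [integral_monomials hindep hm]
    refine Finset.prod_eq_zero (Finset.mem_univ b) ?_
    simp [hb, h1]
  have hone : ∀ (i : Option (Fin p) × Option (Fin p) × Option (Fin p) × Option (Fin p)),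
      (∀ b, multiplicity i b = 0 ∨ multiplicity i b = 2) →
      ∫ ω, monomials (z ω) i ∂P₀ = 1 := fun i hi => by
    rw [integral_monomials hindep hm]
    refine Finset.prod_eq_one fun b _ => ?_
    rcases hi b with h | h <;> simp [h, h2]
  have hsingle : ∀ (i : Option (Fin p) × Option (Fin p) × Option (Fin p) × Option (Fin p)) (a),
      (∀ b, b ≠ a → multiplicity i b = 0) →
      ∫ ω, monomials (z ω) i ∂P₀ = ∫ ω, z ω a ^ multiplicity i a ∂P₀ := fun i a hi => by
    rw [integral_monomials hindep hm, Finset.prod_eq_single a]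
    · intro b _ hb; simp [hi b hb]
    · simp
  refine ⟨fun a => ?_, fun a b => ?_, fun a b c => ?_, fun a b c e => ?_⟩
  · exact hzero _ a (by simp [multiplicity])
  · by_cases hab : a = b
    · subst hab
      rw [if_pos rfl]
      refine hone _ fun b => ?_
      by_cases h : a = b <;> simp [multiplicity, h]
    · rw [if_neg hab]
      exact hzero _ a (by simp [multiplicity, Ne.symm hab])
  · by_cases hab : a = b
    · subst hab
      by_cases hac : a = c
      · subst hac
        refine (hsingle _ a fun b hb => ?_).trans ?_
        · simp [multiplicity, hb.symm]
        · simp [multiplicity, indepMoment3, mGamma]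
      · rw [indepMoment3, if_neg (by simp [hac])]
        exact hzero _ c (by simp [multiplicity, hac])
    · rw [indepMoment3, if_neg (by simp [hab])]
      by_cases hac : a = c
      · subst hac
        exact hzero _ b (by simp [multiplicity, hab])
      · exact hzero _ a (by simp [multiplicity, Ne.symm hab, Ne.symm hac])
  · by_cases hab : a = b
    · subst hab
      by_cases hce : c = e
      · subst hce
        by_cases hac : a = c
        · subst hac
          refine (hsingle _ a fun b hb => ?_).trans ?_
          · simp [multiplicity, hb.symm]
          · simp only [multiplicity, indepMoment4, mKappa]
            norm_num
        · refine (hone _ fun b => ?_).trans ?_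
          · by_cases h : a = b
            · subst h
              simp [multiplicity, Ne.symm hac]
            · by_cases h' : c = b <;> simp [multiplicity, h, h']
          · simp [indepMoment4, hac]
      · by_cases hac : a = c
        · subst hac
          refine (hzero _ e ?_).trans ?_
          · simp [multiplicity, hce]
          · simp [indepMoment4, hce]
        · refine (hzero _ c ?_).trans ?_
          · simp [multiplicity, hac, Ne.symm hce]
          · simp [indepMoment4, hac, hce]
    · by_cases hac : a = c
      · subst hac
        by_cases hbe : b = e
        · subst hbe
          refine (hone _ fun c => ?_).trans ?_
          · by_cases h : a = c
            · subst h
              simp [multiplicity, Ne.symm hab]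
            · by_cases h' : b = c <;> simp [multiplicity, h, h']
          · simp [indepMoment4, hab]
        · refine (hzero _ b ?_).trans ?_
          · simp [multiplicity, hab, Ne.symm hbe]
          · simp [indepMoment4, hab, hbe, Ne.symm hab]
      · by_cases hae : a = e
        · subst hae
          by_cases hbc : b = c
          · subst hbc
            refine (hone _ fun c => ?_).trans ?_
            · by_cases h : a = c
              · subst h
                simp [multiplicity, Ne.symm hab]
              · by_cases h' : b = c <;> simp [multiplicity, h, h']
            · simp [indepMoment4, hab]
          · refine (hzero _ b ?_).trans ?_
            · simp [multiplicity, hab, Ne.symm hbc]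
            · simp [indepMoment4, hab, hbc, hac]
        · refine (hzero _ a ?_).trans ?_
          · simp [multiplicity, Ne.symm hab, Ne.symm hac, Ne.symm hae]
          · simp [indepMoment4, hab, hac, hae]

end Population

end

end SignalSeparation

namespace SignalSeparation

noncomputable section

/-! ### The influence function and the asymptotic variances. -/

section Variances

variable {p : ℕ}

/-- The score of a component in the expansion of the functional. -/
def score (α : ℝ) (γ κ : Fin p → ℝ) (k : Fin p) (t : ℝ) : ℝ :=
  (curvature α γ κ k)⁻¹ * (3 * α * γ k * (t ^ 2 - 1 - γ k * t) +
    4 * (1 - α) * κ k * (t ^ 3 - γ k - (κ k + 3) * t))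

theorem upperDeriv_monomials (α : ℝ) {γ κ : Fin p → ℝ} {r₀ : RawMoments p}
    (hr : r₀.IsIndep γ κ) (v : EuclideanSpace ℝ (Fin p)) {k l : Fin p} (h : k ≠ l) :
    upperDeriv α γ κ (monomials v - r₀) k l = score α γ κ k (v k) * v l := by
  have m1 : ∀ a, RawMoments.m1 (monomials v - r₀) a = v a := fun a => by
    have : RawMoments.m1 (monomials v - r₀) a = RawMoments.m1 (monomials v) a - r₀.m1 a := rfl
    rw [this, hr.m1]; simp [RawMoments.m1, monomials, homCoord]
  have m2 : ∀ a b, RawMoments.m2 (monomials v - r₀) a b = v a * v b - if a = b then 1 else 0 :=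
    fun a b => by
    have : RawMoments.m2 (monomials v - r₀) a b =
      RawMoments.m2 (monomials v) a b - r₀.m2 a b := rfl
    rw [this, hr.m2]; simp [RawMoments.m2, monomials, homCoord]
  have m3 : ∀ a b c, RawMoments.m3 (monomials v - r₀) a b c =
      v a * v b * v c - indepMoment3 γ a b c := fun a b c => by
    have : RawMoments.m3 (monomials v - r₀) a b c =
      RawMoments.m3 (monomials v) a b c - r₀.m3 a b c := rfl
    rw [this, hr.m3]; simp [RawMoments.m3, monomials, homCoord]
  have m4 : ∀ a b c e, RawMoments.m4 (monomials v - r₀) a b c e =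
      v a * v b * v c * v e - indepMoment4 κ a b c e := fun a b c e => by
    have : RawMoments.m4 (monomials v - r₀) a b c e =
      RawMoments.m4 (monomials v) a b c e - r₀.m4 a b c e := rfl
    rw [this, hr.m4]; simp [RawMoments.m4, monomials, homCoord]
  simp only [upperDeriv, diag3, diag4, form3_single, form4_single, dcentral3, dcentral4, m1, m2,
    m3, m4, indepMoment3, indepMoment4, score, h, h.symm, if_true, if_false, and_true,
    and_false]
  ring

/-- This is the influence function. Off the diagonal it is a function of one component times another
component, so independence applies. -/
theorem entryDeriv_monomials (α : ℝ) {γ κ : Fin p → ℝ} {r₀ : RawMoments p}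
    (hr : r₀.IsIndep γ κ) (v : EuclideanSpace ℝ (Fin p)) (k l : Fin p) :
    entryDeriv α γ κ (monomials v - r₀) k l =
      if k < l then score α γ κ k (v k) * v l
      else if l = k then -((v k ^ 2 - 1) / 2)
      else -((score α γ κ l (v l) + v l) * v k) := by
  have m2 : ∀ a b, RawMoments.m2 (monomials v - r₀) a b = v a * v b - if a = b then 1 else 0 :=
    fun a b => by
    have : RawMoments.m2 (monomials v - r₀) a b =
      RawMoments.m2 (monomials v) a b - r₀.m2 a b := rfl
    rw [this, hr.m2]; simp [RawMoments.m2, monomials, homCoord]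
  unfold entryDeriv
  split_ifs with h1 h2
  · exact upperDeriv_monomials α hr v h1.ne
  · rw [m2, if_pos rfl]; ring
  · rw [m2, if_neg (Ne.symm h2), upperDeriv_monomials α hr v h2]; ring

variable {Ω₀ : Type*} [MeasurableSpace Ω₀] {P₀ : Measure Ω₀}

theorem integrable_pow_of_memLp [IsProbabilityMeasure P₀] {X : Ω₀ → ℝ} (hX : MemLp X 8 P₀) {n : ℕ} (hn : n ≤ 8) :
    Integrable (fun ω => X ω ^ n) P₀ := by
  have h8 : Integrable (fun ω => ‖X ω‖ ^ 8) P₀ := by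
    have := hX.integrable_norm_pow (p := 8) (by norm_num)
    simpa using this
  refine (h8.add (integrable_const 1)).mono' (hX.1.pow n) (Eventually.of_forall fun ω => ?_)
  rw [norm_pow]
  change ‖X ω‖ ^ n ≤ ‖X ω‖ ^ 8 + 1
  rcases le_total ‖X ω‖ 1 with h | h
  · have := pow_le_one₀ (norm_nonneg (X ω)) h (n := n)
    have := pow_nonneg (norm_nonneg (X ω)) 8
    linarith
  · have := pow_le_pow_right₀ h hn
    linarith

theorem integral_sq_cubic [IsProbabilityMeasure P₀] {X : Ω₀ → ℝ} (hX : MemLp X 8 P₀) (a : ℕ → ℝ) :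
    ∫ ω, (∑ i ∈ Finset.range 4, a i * X ω ^ i) ^ 2 ∂P₀ =
      ∑ i ∈ Finset.range 4, ∑ j ∈ Finset.range 4, a i * a j * ∫ ω, X ω ^ (i + j) ∂P₀ := by
  have hint : ∀ i ∈ Finset.range 4, ∀ j ∈ Finset.range 4,
      Integrable (fun ω => a i * a j * X ω ^ (i + j)) P₀ := fun i hi j hj =>
    (integrable_pow_of_memLp hX (by have := Finset.mem_range.1 hi; have := Finset.mem_range.1 hj; omega)).const_mul _
  have : ∀ ω, (∑ i ∈ Finset.range 4, a i * X ω ^ i) ^ 2 =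
      ∑ i ∈ Finset.range 4, ∑ j ∈ Finset.range 4, a i * a j * X ω ^ (i + j) := fun ω => by
    rw [sum_pow_two]
    exact Finset.sum_congr rfl fun i _ => Finset.sum_congr rfl fun j _ => by ring
  simp only [this]
  rw [integral_finsetSum _ fun i hi => integrable_finsetSum _ fun j hj => hint i hi j hj]
  refine Finset.sum_congr rfl fun i hi => ?_
  rw [integral_finsetSum _ fun j hj => hint i hi j hj]
  exact Finset.sum_congr rfl fun j _ => integral_const_mul _ _

variable {X : Ω₀ → ℝ} {α : ℝ} {γ κ : Fin p → ℝ} {k : Fin p}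

/-- The second moment of the score plus a multiple of the component. -/
theorem integral_score_add_sq [IsProbabilityMeasure P₀] (hX : MemLp X 8 P₀) (h1 : ∫ ω, X ω ∂P₀ = 0)
    (h2 : ∫ ω, X ω ^ 2 ∂P₀ = 1) (hγ : γ k = mGamma X P₀) (hκ : κ k = mKappa X P₀)
    (hc : curvature α γ κ k ≠ 0) (b : ℝ) :
    ∫ ω, (score α γ κ k (X ω) + b * X ω) ^ 2 ∂P₀ = asymptA α X P₀ + b ^ 2 := by
  set c := curvature α γ κ k with hcdef
  -- Coefficients of the cubic score plus b X. The second moment has no term linear in b because the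
  -- score is uncorrelated with X: E X(X² - 1 - γ X) = 0 and E X(X³ - γ - (κ + 3) X) = 0.
  let a : ℕ → ℝ := fun i => match i with
    | 0 => c⁻¹ * (-(3 * α * γ k) - 4 * (1 - α) * κ k * γ k)
    | 1 => c⁻¹ * (-(3 * α * γ k * γ k) - 4 * (1 - α) * κ k * (κ k + 3)) + b
    | 2 => c⁻¹ * (3 * α * γ k)
    | _ => c⁻¹ * (4 * (1 - α) * κ k)
  have h : ∀ ω, score α γ κ k (X ω) + b * X ω = ∑ i ∈ Finset.range 4, a i * X ω ^ i := fun ω => by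
    simp only [Finset.sum_range_succ, Finset.sum_range_zero, a, score, ← hcdef]
    ring
  simp only [h]
  rw [integral_sq_cubic hX]
  have h0 : ∫ ω, X ω ^ 0 ∂P₀ = 1 := by simp
  have h1' : ∫ ω, X ω ^ 1 ∂P₀ = 0 := by simpa using h1
  have h3 : ∫ ω, X ω ^ 3 ∂P₀ = γ k := by rw [hγ, mGamma]
  have h4 : ∫ ω, X ω ^ 4 ∂P₀ = κ k + 3 := by rw [hκ, mKappa]; ring
  have hA : asymptA α X P₀ = ((3 * α) ^ 2 * (γ k ^ 2 * (κ k + 3 - 1 - γ k ^ 2)) +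
      2 * (3 * α) * (4 * (1 - α)) * (γ k * κ k * (∫ ω, X ω ^ 5 ∂P₀ - γ k - γ k * (κ k + 3))) +
      (4 * (1 - α)) ^ 2 * (κ k ^ 2 * (∫ ω, X ω ^ 6 ∂P₀ - γ k ^ 2 - (κ k + 3) ^ 2))) / c ^ 2 := by
    rw [asymptA, zeta3, zeta4, zeta34, mNu, mOmega, mEta, mBeta, ← hγ, ← hκ, h3, h4, hcdef,
      curvature]
  rw [hA]
  simp only [Finset.sum_range_succ, Finset.sum_range_zero, zero_add, Nat.reduceAdd, h0, h1', h2,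
    h3, h4, a]
  generalize (∫ ω, X ω ^ 5 ∂P₀) = m5
  generalize (∫ ω, X ω ^ 6 ∂P₀) = m6
  have hc' : c = 3 * α * γ k ^ 2 + 4 * (1 - α) * κ k ^ 2 := hcdef
  field_simp
  rw [hc']
  ring

theorem integral_sq_sub_one_div_two_sq [IsProbabilityMeasure P₀] (hX : MemLp X 8 P₀) (h2 : ∫ ω, X ω ^ 2 ∂P₀ = 1) :
    ∫ ω, (-((X ω ^ 2 - 1) / 2)) ^ 2 ∂P₀ = asymptD X P₀ := by
  have : ∀ ω, (-((X ω ^ 2 - 1) / 2)) ^ 2 = (1 / 4) * X ω ^ 4 - (1 / 2) * X ω ^ 2 + 1 / 4 :=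
    fun ω => by ring
  simp only [this]
  have i4 := (integrable_pow_of_memLp hX (n := 4) (by norm_num)).const_mul (1 / 4)
  have i2 := (integrable_pow_of_memLp hX (n := 2) (by norm_num)).const_mul (1 / 2)
  have i42 : Integrable (fun ω => 1 / 4 * X ω ^ 4 - 1 / 2 * X ω ^ 2) P₀ := i4.sub i2
  rw [integral_add i42 (integrable_const _), integral_sub i4 i2, integral_const_mul,
    integral_const_mul, h2, asymptD, mKappa]
  simp
  ring

/-- The centered factor V makes the product centered whatever the mean of U, which is why the full
second moment of U appears and not its variance. -/
theorem variance_mul_of_indepFun {U V : Ω₀ → ℝ} (hUV : IndepFun U V P₀)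
    (hU : AEStronglyMeasurable U P₀) (hV : AEStronglyMeasurable V P₀)
    (h1 : ∫ ω, V ω ∂P₀ = 0) (h2 : ∫ ω, V ω ^ 2 ∂P₀ = 1) :
    Var[fun ω => U ω * V ω; P₀] = ∫ ω, U ω ^ 2 ∂P₀ := by
  have e1 : ∫ ω, U ω * V ω ∂P₀ = 0 := by
    rw [hUV.integral_fun_mul_eq_mul_integral hU hV, h1, mul_zero]
  have hm : AEMeasurable (fun ω => U ω * V ω) P₀ := (hU.mul hV).aemeasurable
  rw [variance_of_integral_eq_zero hm e1]
  have h3 : IndepFun (fun ω => U ω ^ 2) (fun ω => V ω ^ 2) P₀ :=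
    hUV.comp (φ := fun x => x ^ 2) (ψ := fun x => x ^ 2) (by fun_prop) (by fun_prop)
  simp only [mul_pow]
  rw [h3.integral_fun_mul_eq_mul_integral (hU.pow 2) (hV.pow 2), h2, mul_one]

theorem measurable_score (α : ℝ) (γ κ : Fin p → ℝ) (k : Fin p) : Measurable (score α γ κ k) := by
  unfold score; fun_prop

/-- The asymptotic variances. -/
theorem variance_entryDeriv [IsProbabilityMeasure P₀] {z : Ω₀ → EuclideanSpace ℝ (Fin p)} {r₀ : RawMoments p}
    (hindep : iIndepFun (fun (k : Fin p) ω => z ω k) P₀)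
    (hmom : ∀ k, MemLp (fun ω => z ω k) 8 P₀)
    (h1 : ∀ k, ∫ ω, z ω k ∂P₀ = 0) (h2 : ∀ k, ∫ ω, z ω k ^ 2 ∂P₀ = 1)
    (hr : r₀.IsIndep (fun k => mGamma (fun ω => z ω k) P₀) (fun k => mKappa (fun ω => z ω k) P₀))
    (k l : Fin p) (hc : ∀ j ≤ k, curvature α (fun k => mGamma (fun ω => z ω k) P₀)
      (fun k => mKappa (fun ω => z ω k) P₀) j ≠ 0) :
    Var[fun ω => entryDeriv α (fun k => mGamma (fun ω => z ω k) P₀)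
      (fun k => mKappa (fun ω => z ω k) P₀) (monomials (z ω) - r₀) k l; P₀] =
      asv α z P₀ k l := by
  set γ : Fin p → ℝ := fun k => mGamma (fun ω => z ω k) P₀ with hγ
  set κ : Fin p → ℝ := fun k => mKappa (fun ω => z ω k) P₀ with hκ
  have hm : ∀ k, AEStronglyMeasurable (fun ω => z ω k) P₀ := fun k => (hmom k).1
  -- Used with b = 0 above the diagonal and with b = 1 below it, where the extra b² is the +1 in the
  -- asymptotic variance.
  have key : ∀ (b : ℝ) (j i : Fin p), j ≤ k → j ≠ i →
      Var[fun ω => (score α γ κ j (z ω j) + b * z ω j) * z ω i; P₀] =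
        asymptA α (fun ω => z ω j) P₀ + b ^ 2 := by
    intro b j i hjk hji
    have hmeas : Measurable fun t => score α γ κ j t + b * t :=
      (measurable_score α γ κ j).add (by fun_prop)
    rw [← integral_score_add_sq (hmom j) (h1 j) (h2 j) rfl rfl (hc j hjk) b]
    exact variance_mul_of_indepFun ((hindep.indepFun hji).comp hmeas measurable_id)
      (hmeas.comp_aemeasurable (hm j).aemeasurable).aestronglyMeasurable (hm i) (h1 i) (h2 i)
  simp only [entryDeriv_monomials α hr, asv]
  rcases lt_trichotomy k l with h | h | h
  · simp only [if_pos h, if_neg h.not_gt, if_neg h.ne']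
    have := key 0 k l le_rfl h.ne
    simpa using this
  · subst h
    simp only [lt_irrefl, if_false, if_true]
    have hi2 := integrable_pow_of_memLp (hmom k) (n := 2) (by norm_num)
    have e : ∫ ω, -((z ω k ^ 2 - 1) / 2) ∂P₀ = 0 := by
      rw [integral_neg, integral_div, integral_sub hi2 (integrable_const _), h2]
      simp
    rw [variance_of_integral_eq_zero (by have := (hm k).aemeasurable; fun_prop) e]
    exact integral_sq_sub_one_div_two_sq (hmom k) (h2 k)
  · simp only [if_pos h, if_neg h.not_gt, if_neg h.ne]
    have := key 1 l k h.le h.ne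
    rw [variance_fun_neg]
    simpa using this

end Variances

end

end SignalSeparation

namespace SignalSeparation

noncomputable section

/-! ### From the function of the moments to the functional at the empirical distribution. -/

section Estimator

variable {d p : ℕ}

/-- The vectorization as a continuous linear map. -/
def vecCLM (d p : ℕ) : (Fin d → Fin p → ℝ) →L[ℝ] EuclideanSpace ℝ (Fin p × Fin d) :=
  LinearMap.toContinuousLinearMap
    { toFun := fun h => vecE (Matrix.of h)
      map_add' := fun _ _ => rfl
      map_smul' := fun _ _ => rfl }

theorem vecCLM_apply (h : Fin d → Fin p → ℝ) : vecCLM d p h = vecE (Matrix.of h) := rfl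

theorem continuous_monomials : Continuous (monomials (p := p)) := by
  refine continuous_pi fun i => ?_
  have h : ∀ o : Option (Fin p), Continuous fun v : EuclideanSpace ℝ (Fin p) => homCoord v o :=
    fun o => by
    cases o with
    | none => exact continuous_const
    | some a => simp only [homCoord, Option.elim_some]; fun_prop
  exact (((h _).mul (h _)).mul (h _)).mul (h _)

/-- For every n, even n = 0, the sample moments lie in the set along which the functional is
expanded. -/
theorem transpose_central2_sampleMoments (n : ℕ) (z : ℕ → EuclideanSpace ℝ (Fin p)) :
    (Matrix.of (sampleMoments n z).central2).transpose =
      Matrix.of (sampleMoments n z).central2 := by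
  ext a b
  simp only [Matrix.transpose_apply, Matrix.of_apply, RawMoments.central2, RawMoments.m2,
    sampleMoments, monomials, homCoord, Option.elim_some, mul_comm]

theorem rowMatrix_mul_of_transpose (u : Fin d → EuclideanSpace ℝ (Fin p))
    {R : Matrix (Fin p) (Fin p) ℝ} (hR : R.transpose = R) :
    rowMatrix u * R = Matrix.of fun k => R.mulVec (u k) := by
  ext k l
  have h : ∀ b, R b l = R l b := fun b => by
    conv_lhs => rw [← hR, Matrix.transpose_apply]
  simp only [Matrix.mul_apply, rowMatrix, Matrix.of_apply, Matrix.mulVec, dotProduct, h, mul_comm]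

theorem isDeflationLocalMax_empirical {n : ℕ} (hn : n ≠ 0) {α : ℝ}
    (x : ℕ → EuclideanSpace ℝ (Fin p)) (μ : EuclideanSpace ℝ (Fin p))
    (hS : (covMatrix (empirical x n)).PosDef) {u : Fin d → EuclideanSpace ℝ (Fin p)}
    (hu : Orthonormal ℝ u)
    (hmax : ∀ k, IsLocalMaxOn (fun v : EuclideanSpace ℝ (Fin p) =>
      momentIndex α (sampleMoments n fun i => x i - μ).central3
        (sampleMoments n fun i => x i - μ).central4
        ((invSqrt (covMatrix (empirical x n))).mulVec v)) (feasible u k) (u k)) :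
    IsDeflationLocalMax α (empirical x n)
      (Matrix.of fun k => (invSqrt (covMatrix (empirical x n))).mulVec (u k)) := by
  refine ⟨u, hu, fun k => ?_, (rowMatrix_mul_of_transpose u (transpose_invSqrt _)).symm⟩
  -- The two objectives are known to agree only on unit vectors, and feasible sets contain no
  -- others.
  filter_upwards [hmax k, self_mem_nhdsWithin] with v hv hmem
  rw [projIndex_empirical hn α x μ hS hmem.1, projIndex_empirical hn α x μ hS (hu.1 k)]
  exact hv

theorem isDeflationMax_empirical {n : ℕ} (hn : n ≠ 0) {α : ℝ}
    (x : ℕ → EuclideanSpace ℝ (Fin p)) (μ : EuclideanSpace ℝ (Fin p))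
    (hS : (covMatrix (empirical x n)).PosDef) {u : Fin d → EuclideanSpace ℝ (Fin p)}
    (hu : Orthonormal ℝ u)
    (hmax : ∀ k, IsMaxOn (fun v : EuclideanSpace ℝ (Fin p) =>
      momentIndex α (sampleMoments n fun i => x i - μ).central3
        (sampleMoments n fun i => x i - μ).central4
        ((invSqrt (covMatrix (empirical x n))).mulVec v)) (feasible u k) (u k)) :
    IsDeflationMax α (empirical x n)
      (Matrix.of fun k => (invSqrt (covMatrix (empirical x n))).mulVec (u k)) := by
  refine ⟨u, hu, fun k v hv => ?_, (rowMatrix_mul_of_transpose u (transpose_invSqrt _)).symm⟩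
  rw [Set.mem_ofPred_eq, projIndex_empirical hn α x μ hS hv.1,
    projIndex_empirical hn α x μ hS (hu.1 k)]
  exact hmax k hv

/-- Without observations, the covariance matrix is singular unless `p = 0`. -/
theorem eq_zero_of_posDef_empirical_zero (x : ℕ → EuclideanSpace ℝ (Fin p))
    (h : (covMatrix (empirical x 0)).PosDef) : p = 0 := by
  by_contra hp
  rw [covMatrix_empirical_zero] at h
  have := h.diag_pos (i := ⟨0, Nat.pos_of_ne_zero hp⟩)
  simp at this

end Estimator

end

end SignalSeparation

/-! ### The theorem. -/

open SignalSeparation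

theorem theorem3
    {d p : ℕ} (hd : d ≤ p) (α : ℝ) (hα : α ∈ Set.Icc (0 : ℝ) 1)
    -- a random vector that follows the model with identity mixing
    {Ω₀ : Type*} [MeasurableSpace Ω₀] (P₀ : Measure Ω₀) [IsProbabilityMeasure P₀]
    (μ : EuclideanSpace ℝ (Fin p)) (x z : Ω₀ → EuclideanSpace ℝ (Fin p))
    (hmodel : SignalSeparation.Model d μ 1 x z P₀)
    -- eighth moments exist
    (hmom : ∀ k, MemLp (fun ω => z ω k) 8 P₀)
    (hpos : ∀ j : Fin d,
      0 < SignalSeparation.indexValue α (fun ω => z ω (Fin.castLE hd j)) P₀)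
    -- a random sample from the distribution of `x`
    {Ω : Type*} [MeasurableSpace Ω] (P : Measure Ω) [IsProbabilityMeasure P]
    (X : ℕ → Ω → EuclideanSpace ℝ (Fin p))
    (hindep : iIndepFun X P) (hident : ∀ i, IdentDistrib (X i) x P P₀) :
    ∃ W : ℕ → Ω → Matrix (Fin d) (Fin p) ℝ,
      -- `W n` solves the sequential maximization problems of the empirical distribution
      (∀ n ω, (SignalSeparation.covMatrix
            (SignalSeparation.empirical (fun i => X i ω) n)).PosDef →
          SignalSeparation.IsDeflationLocalMax α
            (SignalSeparation.empirical (fun i => X i ω) n) (W n ω)) ∧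
      -- and globally so if the population values of the index are strictly ordered
      ((∀ j j' : Fin d, j < j' →
          SignalSeparation.indexValue α (fun ω => z ω (Fin.castLE hd j')) P₀ <
            SignalSeparation.indexValue α (fun ω => z ω (Fin.castLE hd j)) P₀) →
        ∀ n ω, (SignalSeparation.covMatrix
            (SignalSeparation.empirical (fun i => X i ω) n)).PosDef →
          SignalSeparation.IsDeflationMax α
            (SignalSeparation.empirical (fun i => X i ω) n) (W n ω)) ∧
      -- consistency
      TendstoInMeasure P (fun n ω => SignalSeparation.vecE (W n ω)) atTop
        (fun _ => SignalSeparation.vecE (SignalSeparation.idZero d p)) ∧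
      -- asymptotic normality
      ∃ V : Matrix (Fin p × Fin d) (Fin p × Fin d) ℝ,
        V.PosSemidef ∧
        (∀ (k : Fin d) (l : Fin p),
          V (l, k) (l, k) = SignalSeparation.asv α z P₀ (Fin.castLE hd k) l) ∧
        TendstoInDistribution
          (fun (n : ℕ) ω => SignalSeparation.vecE
            (√(n : ℝ) • (W n ω - SignalSeparation.idZero d p)))
          atTop id (fun _ => P) (multivariateGaussian 0 V) := by
  set γ : Fin p → ℝ := fun k => mGamma (fun ω => z ω k) P₀ with hγ
  set κ : Fin p → ℝ := fun k => mKappa (fun ω => z ω k) P₀ with hκ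
  set r₀ : RawMoments p := fun i => ∫ ω, monomials (z ω) i ∂P₀ with hr₀
  have hr : r₀.IsIndep γ κ := isIndep_integral_monomials hmodel.indep
    (fun k => (hmom k).1.aemeasurable) hmodel.mean_zero hmodel.var_one
  have hnoise : ∀ a : Fin p, d ≤ (a : ℕ) → α * γ a ^ 2 + (1 - α) * κ a ^ 2 = 0 := fun a ha => by
    have h1 : γ a = 0 :=
      mGamma_of_gaussian (hmodel.noise a ha) (hmodel.mean_zero a) (hmodel.var_one a)
    have h2 : κ a = 0 :=
      mKappa_of_gaussian (hmodel.noise a ha) (hmodel.mean_zero a) (hmodel.var_one a)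
    simp [h1, h2]
  obtain ⟨f, hfm, hfsol, hfo⟩ := exists_solution_functional hd hα hpos hnoise hr
  -- The means of `φ ∘ X i` are the sample moments about μ. The true μ may be used because
  -- `projIndex_empirical` and `covMatrix_empirical` hold for moments about any point.
  let φ : EuclideanSpace ℝ (Fin p) → RawMoments p := fun v => monomials (v - μ)
  have hφ : Measurable φ := (continuous_monomials.comp (continuous_id.sub continuous_const)).measurable
  have hz : φ ∘ x = fun ω => monomials (z ω) := by
    ext ω i
    simp only [φ, Function.comp_apply, hmodel.generated ω, map_one]
    simp
  have hYindep : iIndepFun (fun i => φ ∘ X i) P := hindep.comp (fun _ => φ) fun _ => hφ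
  have hYident : ∀ i, IdentDistrib (φ ∘ X i) (fun ω => monomials (z ω)) P P₀ := fun i => by
    rw [← hz]; exact (hident i).comp hφ
  have hY₀ := memLp_monomials hmom
  have hSmem : ∀ n ω, (fun i => mean n fun j => (φ ∘ X j) ω i) ∈
      {r : RawMoments p | (Matrix.of r.central2).transpose = Matrix.of r.central2} := fun n ω =>
    transpose_central2_sampleMoments n fun j => X j ω - μ
  let L := (vecCLM d p).comp (rowsDeriv hd α γ κ)
  have hg : (fun r => vecCLM d p (f r) - vecCLM d p (coordRows hd) - L (r - r₀))
      =o[𝓝[{r | (Matrix.of r.central2).transpose = Matrix.of r.central2}] r₀]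
      fun r => r - r₀ := by
    have := ((vecCLM d p).isBigO_comp (fun r => f r - coordRows hd - rowsDeriv hd α γ κ (r - r₀))
      (𝓝[{r | (Matrix.of r.central2).transpose = Matrix.of r.central2}] r₀)).trans_isLittleO hfo
    simpa only [map_sub, L, ContinuousLinearMap.comp_apply] using this
  have hid : vecCLM d p (coordRows hd) = vecE (idZero d p) := by
    rw [vecCLM_apply, coordRows_eq_idZero]
  have hgm : Measurable fun r => vecCLM d p (f r) := (vecCLM d p).continuous.measurable.comp hfm
  -- Continuity at the population moments is read off from the expansion; it is all that consistency
  -- needs.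
  have hgt : Tendsto (fun r => vecCLM d p (f r))
      (𝓝[{r | (Matrix.of r.central2).transpose = Matrix.of r.central2}] r₀)
      (𝓝 (vecE (idZero d p))) := by
    have h0 : Tendsto (fun r : RawMoments p => r - r₀)
        (𝓝[{r | (Matrix.of r.central2).transpose = Matrix.of r.central2}] r₀) (𝓝 0) := by
      have : Tendsto (fun r : RawMoments p => r - r₀) (𝓝 r₀) (𝓝 (r₀ - r₀)) :=
        (continuous_id.sub continuous_const).tendsto r₀
      rw [sub_self] at this
      exact this.mono_left nhdsWithin_le_nhds
    have h1 := hg.isBigO.trans_tendsto h0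
    have h2 := (L.continuous.tendsto 0).comp h0
    have h3 := (h1.add h2).add_const (vecE (idZero d p))
    rw [map_zero, add_zero, zero_add] at h3
    refine h3.congr fun r => ?_
    simp only [Function.comp_apply, hid]
    abel
  have hLm : ∀ a, MemLp (fun ω => L (monomials (z ω) - r₀) a) 2 P₀ := fun a =>
    memLp_clm_apply L (U := fun ω => monomials (z ω) - r₀)
      (fun i => (hY₀ i).sub (memLp_const _)) a
  refine ⟨fun n ω => Matrix.of (f (sampleMoments n fun j => X j ω - μ)), fun n ω hS => ?_,
    fun hord n ω hS => ?_, ?_,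
    Matrix.of fun a b => cov[fun ω => L (monomials (z ω) - r₀) a,
      fun ω => L (monomials (z ω) - r₀) b; P₀], ?_, fun k l => ?_, ?_⟩
  -- For n = 0 the covariance matrix is zero, which is positive definite only if p = 0. Then d = 0
  -- and nothing is to be shown.
  · rcases Nat.eq_zero_or_pos n with rfl | hn
    · obtain rfl := eq_zero_of_posDef_empirical_zero _ hS
      obtain rfl := Nat.le_zero.1 hd
      exact ⟨Fin.elim0, ⟨fun i => i.elim0, fun i => i.elim0⟩, fun k => k.elim0,
        Subsingleton.elim _ _⟩
    · have hcov := covMatrix_empirical hn.ne' (fun j => X j ω) μ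
      have hS' := hS
      rw [hcov] at hS'
      obtain ⟨u, hu, hloc, -, hfu⟩ := hfsol _ hS'
      rw [← hcov] at hloc hfu
      beta_reduce
      rw [hfu]
      exact isDeflationLocalMax_empirical hn.ne' _ μ hS hu hloc
  · rcases Nat.eq_zero_or_pos n with rfl | hn
    · obtain rfl := eq_zero_of_posDef_empirical_zero _ hS
      obtain rfl := Nat.le_zero.1 hd
      exact ⟨Fin.elim0, ⟨fun i => i.elim0, fun i => i.elim0⟩, fun k => k.elim0,
        Subsingleton.elim _ _⟩
    · have hcov := covMatrix_empirical hn.ne' (fun j => X j ω) μ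
      have hS' := hS
      rw [hcov] at hS'
      obtain ⟨u, hu, -, hmax, hfu⟩ := hfsol _ hS'
      have hmax := hmax hord
      rw [← hcov] at hmax hfu
      beta_reduce
      rw [hfu]
      exact isDeflationMax_empirical hn.ne' _ μ hS hu hmax
  · exact tendstoInMeasure_mean hYindep hYident hY₀ hSmem hgt
  · exact posSemidef_covariance hLm
  · rw [Matrix.of_apply, covariance_self (hLm _).aemeasurable]
    -- Every index j up to the row index k belongs to a signal, so its curvature is nonzero; the
    -- entries left of the diagonal need this for the column l < k.
    refine variance_entryDeriv hmodel.indep hmom hmodel.mean_zero hmodel.var_one hr _ l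
      fun j hj => ?_
    have hjd : (j : ℕ) < d := (Fin.le_def.1 hj).trans_lt k.2
    exact curvature_ne_zero hα (hpos ⟨j, hjd⟩)
  · have h := tendstoInDistribution_sqrt_smul_sub hYindep hYident hY₀ hSmem hgm L hg
    rw [hid] at h
    exact h
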